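/- Notation. For $1\le k\le N$ and $\beta=dd^c|z|^2$ on $\mathbb C^N$, let $\Gamma_k$ be the set of real $(1,1)$-forms $\alpha$ on $\mathbb C^N$ with constant coefficients such that $\alpha^l\wedge\beta^{N-l}\ge 0$ for $l=1,\dots,k$. A function $u:\Omega\to\mathbb R\cup\{-\infty\}$ on a connected open set $\Omega\subseteq\mathbb C^N$ is called $k$-subharmonic if it is subharmonic (upper semicontinuous with the sub-mean value property; the constant $-\infty$ is allowed) and $$dd^c u\wedge\alpha_1\wedge\dots\wedge\alpha_{k-1}\wedge\beta^{N-k}\ge 0$$ in the sense of currents for all $\alpha_1,\dots,\alpha_{k-1}\in\Gamma_k$ (a condition that is void for $u\equiv-\infty$). Theorem C. Let $M,N>1$, $1\le m<M$, $1\le n\le N$ with $m\le n$. Let $\Omega_N\subseteq\mathbb C^N$ and $\Omega_M\subseteq\mathbb C^M$ be non-empty connected open sets, and let $f:\Omega_N\to\Omega_M$ be a holomorphic map. Then the following are equivalent: (1) $f$ is an $(m,n)$-subharmonic morphism, i.e. for every $m$-subharmonic function $\varphi:\Omega_M\to\mathbb R\cup\{-\infty\}$ the function $\varphi\circ f:\Omega_N\to\mathbb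 R\cup\{-\infty\}$ is $n$-subharmonic; (2) $f$ has the following form: (a) if $M\le N$ and $m=n$, then $f$ is constant or $f(z)=cAz+w_0$ for all $z\in\Omega_N$, where $c\in\mathbb R$, $w_0\in\mathbb C^M$, and $A$ is a complex $M\times N$ matrix whose rows $X_1,\dots,X_M\in\mathbb C^N$ satisfy $\|X_1\|=\dots=\|X_M\|$ and $\langle X_j,X_k\rangle=0$ for $j\ne k$ (that is, up to a homothety, $f$ is an orthogonal projection $\mathbb C^N=\mathbb C^M\times\mathbb C^{N-M}\to\mathbb C^M$); (b) if $M\le N$ and $m<n$, then $f$ is constant; (c) if $M>N$, then $f$ is constant. -/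

import Mathlib

open MeasureTheory
open scoped ContDiff Matrix

noncomputable section

/-- `ℂ^N` with its Euclidean norm and its Lebesgue measure. -/
abbrev CSpace (N : ℕ) : Type := EuclideanSpace ℂ (Fin N)

/-- The algebra of differential forms on `ℂ^N` with constant (complex) coefficients, with the
wedge product as multiplication: the exterior algebra on the `2N` generators
`dz_j` (index `(j, 0)`) and `dz̄_j` (index `(j, 1)`). -/
abbrev ConstForm (N : ℕ) : Type := ExteriorAlgebra ℂ (Fin N × Fin 2 → ℂ)

/-- The form `dz_j`. -/
def dz {N : ℕ} (j : Fin N) : ConstForm N := ExteriorAlgebra.ι ℂ (Pi.single (j, 0) 1)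

/-- The form `dz̄_j`. -/
def dzBar {N : ℕ} (j : Fin N) : ConstForm N := ExteriorAlgebra.ι ℂ (Pi.single (j, 1) 1)

/-- The `(1,1)`-form `2i ∑ a_{jk} dz_j ∧ dz̄_k`. It is a real form iff `a` is Hermitian. With
`dd^c = 2i ∂∂̄`, it is `dd^c u` at a point at which `u` has the complex Hessian matrix `a`. -/
def form11 {N : ℕ} (a : Matrix (Fin N) (Fin N) ℂ) : ConstForm N :=
  ∑ j, ∑ k, (2 * Complex.I * a j k) • (dz j * dzBar k)

/-- The Kähler form `β = dd^c |z|² = 2i ∑ dz_j ∧ dz̄_j`. -/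
def kahlerForm (N : ℕ) : ConstForm N := form11 1

/-- The density of the top-degree part of a form with respect to Lebesgue measure
`dV = dx_1 ∧ dy_1 ∧ ⋯ ∧ dx_N ∧ dy_N`. The alternating map `det` takes the value `1` on
`(dz_1, dz̄_1, …, dz_N, dz̄_N)`, and `dz_1 ∧ dz̄_1 ∧ ⋯ ∧ dz_N ∧ dz̄_N = (-2i)^N dV`. For a real
form the density is real, so that taking the real part only changes the type. -/
def volDensity {N : ℕ} (η : ConstForm N) : ℝ :=
  ((-2 * Complex.I) ^ N *
    ExteriorAlgebra.liftAlternating (R := ℂ) (M := Fin N × Fin 2 → ℂ) (N := ℂ)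
      (Pi.single (N * 2)
        ((Matrix.detRowAlternating (n := Fin N × Fin 2) (R := ℂ)).domDomCongr finProdFinEquiv))
      η).re

/-- The cone `Γ_k` of real `(1,1)`-forms `α` with constant coefficients such that
`α^l ∧ β^{N-l} ≥ 0` for `l = 1, …, k`; a form is represented by its Hermitian matrix. -/
def gammaCone (N k : ℕ) : Set (Matrix (Fin N) (Fin N) ℂ) :=
  {a | a.IsHermitian ∧
    ∀ l : ℕ, 1 ≤ l → l ≤ k → 0 ≤ volDensity (form11 a ^ l * kahlerForm N ^ (N - l))}

/-- The Wirtinger derivative `∂g/∂z_j = (∂g/∂x_j - i ∂g/∂y_j) / 2`. -/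
def wirtinger {N : ℕ} (j : Fin N) (g : CSpace N → ℂ) (z : CSpace N) : ℂ :=
  (fderiv ℝ g z (EuclideanSpace.single j 1)
    - Complex.I * fderiv ℝ g z (EuclideanSpace.single j Complex.I)) / 2

/-- The Wirtinger derivative `∂g/∂z̄_j = (∂g/∂x_j + i ∂g/∂y_j) / 2`. -/
def wirtingerBar {N : ℕ} (j : Fin N) (g : CSpace N → ℂ) (z : CSpace N) : ℂ :=
  (fderiv ℝ g z (EuclideanSpace.single j 1)
    + Complex.I * fderiv ℝ g z (EuclideanSpace.single j Complex.I)) / 2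

/-- The complex Hessian matrix `(∂²χ / ∂z_j ∂z̄_k)` of a real-valued function. -/
def complexHessian {N : ℕ} (χ : CSpace N → ℝ) (z : CSpace N) : Matrix (Fin N) (Fin N) ℂ :=
  Matrix.of fun j k => wirtinger j (wirtingerBar k (fun w => (χ w : ℂ))) z

/-- The mean value over the ball `B(z, r)` of an extended-real-valued function that is bounded
above on the ball: mean of the positive part minus mean of the negative part. -/
def ballMean {N : ℕ} (u : CSpace N → EReal) (z : CSpace N) (r : ℝ) : EReal :=
  ((⨍⁻ x in Metric.ball z r, (u x).toENNReal ∂volume : ENNReal) : EReal)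
    - ((⨍⁻ x in Metric.ball z r, (-u x).toENNReal ∂volume : ENNReal) : EReal)

/-- `u : Ω → ℝ ∪ {-∞}` is subharmonic: upper semicontinuous with the sub-mean value property. The
function that is identically `-∞` is included. -/
structure SubharmonicOn {N : ℕ} (u : CSpace N → EReal) (Ω : Set (CSpace N)) : Prop where
  ne_top : ∀ z ∈ Ω, u z ≠ ⊤
  usc : UpperSemicontinuousOn u Ω
  sub_mean : ∀ z ∈ Ω, ∀ r : ℝ, 0 < r → Metric.closedBall z r ⊆ Ω → u z ≤ ballMean u z r

/-- The current `dd^c u ∧ Θ` on `Ω`, for a form `Θ` of bidegree `(N-1, N-1)` with constant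
coefficients, is positive: `∫ u dd^c χ ∧ Θ ≥ 0` for every smooth `χ ≥ 0` with compact support
in `Ω`. A subharmonic function on a connected open set is either locally integrable (hence finite
almost everywhere) or identically `-∞`; in the latter case the condition is void. -/
def DdcWedgeNonneg {N : ℕ} (u : CSpace N → EReal) (Ω : Set (CSpace N)) (Θ : ConstForm N) : Prop :=
  ∀ χ : CSpace N → ℝ, ContDiff ℝ ∞ χ → HasCompactSupport χ → tsupport χ ⊆ Ω → (∀ z, 0 ≤ χ z) →
    0 ≤ ∫ z in Ω, (u z).toReal * volDensity (form11 (complexHessian χ z) * Θ)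

/-- `u` is `k`-subharmonic on `Ω ⊆ ℂ^N` (for `1 ≤ k ≤ N`): it is subharmonic and
`dd^c u ∧ α_1 ∧ ⋯ ∧ α_{k-1} ∧ β^{N-k} ≥ 0` in the sense of currents for all
`α_1, …, α_{k-1} ∈ Γ_k`. -/
structure KSubharmonicOn {N : ℕ} (k : ℕ) (u : CSpace N → EReal) (Ω : Set (CSpace N)) : Prop where
  subharmonic : SubharmonicOn u Ω
  ddc_nonneg : ∀ α : Fin (k - 1) → Matrix (Fin N) (Fin N) ℂ, (∀ i, α i ∈ gammaCone N k) →
    DdcWedgeNonneg u Ω ((List.ofFn fun i => form11 (α i)).prod * kahlerForm N ^ (N - k))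

/-- `f : Ω → Ω'` is an `(m,n)`-subharmonic morphism: `φ ∘ f` is `n`-subharmonic on `Ω` for every
`m`-subharmonic function `φ` on `Ω'`. -/
def IsSubharmonicMorphism {N M : ℕ} (m n : ℕ) (f : CSpace N → CSpace M)
    (Ω : Set (CSpace N)) (Ω' : Set (CSpace M)) : Prop :=
  ∀ φ : CSpace M → EReal, KSubharmonicOn m φ Ω' → KSubharmonicOn n (φ ∘ f) Ω

/-- `f` is constant on `Ω`. -/
def IsConstantOn {N M : ℕ} (f : CSpace N → CSpace M) (Ω : Set (CSpace N)) : Prop :=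
  ∃ w : CSpace M, ∀ z ∈ Ω, f z = w

/-- On `Ω`, `f(z) = c A z + w₀` with `c` real and `A` an `M × N` matrix whose rows
`X_1, …, X_M` have equal norms and are pairwise orthogonal. -/
def IsHomotheticProjectionOn {N M : ℕ} (f : CSpace N → CSpace M) (Ω : Set (CSpace N)) : Prop :=
  ∃ (c : ℝ) (X : Fin M → CSpace N) (w₀ : CSpace M),
    (∀ j k, ‖X j‖ = ‖X k‖) ∧ (∀ j k, j ≠ k → inner ℂ (X j) (X k) = 0) ∧
    ∀ z ∈ Ω, f z =
      (c : ℂ) • WithLp.toLp 2 ((Matrix.of fun j i => X j i) *ᵥ (fun i => z i)) + w₀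

end

/-! Necessity: quadratic forms suffice as test functions. For a constant `H ∈ Γ_m` the function `∑
H_ab w_a conj(w_b)` is `m`-subharmonic (`kSubharmonicOn_quadForm`). Its pullback by `f` is smooth
with complex Hessian `K H Kᴴ`, where `K` is the transposed Jacobian, so `K H Kᴴ ∈ Γ_n` at every
point. The rest of this step is linear algebra (`exists_smul_one_of_congr_mem`). Let `p_i` be the
eigenvalues of `Kᴴ K`, the largest being `p_{i₀}`, and let `H` be diagonal in an eigenbasis with `m`
entries `1`, the entry `-1/m` at `i₀` and zeros elsewhere. If `p_{i₀} > 0`, the elementary symmetric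
functions of the products `h_i p_i` up to order `m` can be nonnegative only if `p` equals `p_{i₀}`
wherever `h_i = 1`; the one of order `m + 1` is then negative. Hence `Kᴴ K = c(z) • 1`, and `c = 0`
if `m < n` or, by rank, if `N < M`. So the gradients of the components of `f` are orthogonal and of
equal length at each point. Since `M > 1`, polarised differentiation in `z` and `z̄` shows that all
second derivatives vanish (`fderiv_fderiv_eq_zero_of_orthogonal`), and `f` is affine.

Sufficiency: constant maps are immediate. A nonconstant homothetic projection splits `ℂ^N`
orthogonally into copies of `ℂ^M` and the kernel (`Slicing`). Balls meet the slices in balls, so the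
sub-mean value inequality follows by Fubini. For positivity, the matrix `∫ (u ∘ f) dd^c χ`
annihilates the fibre directions and is the congruence by `K` of an integral of the corresponding
matrices of `u` on slices (`Slicing.momentMatrix_eq`, `Slicing.sectionMatrix_mul_eq`). These lie in
`Γ_m`, which is a convex cone stable under the congruence.

Both directions rest on Gårding's theory of hyperbolic polynomials, applied to the determinant on
Hermitian matrices and its derivatives in the direction of the identity. It shows that the mixed
products `α_1 ∧ ⋯ ∧ α_k ∧ β^{N-k}` are nonnegative on `Γ_k` (`polarForm_nonneg`) and that `Γ_k` is
recovered from the inequalities `x ∧ a^{k-1} ∧ β^{N-k} ≥ 0` (`mem_gammaCone_of_forall`). Hence a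
subharmonic, locally integrable `u` is `k`-subharmonic iff `∫ u dd^c χ ∈ Γ_k` for every test
function `χ ≥ 0`, and no regularisation of `u` is needed. -/

set_option linter.unusedSectionVars false

/-! ### Hyperbolic forms and Gårding's inequality -/

section Hyperbolic

open Polynomial

variable {V : Type*} [AddCommGroup V] [Module ℂ V]

/-- Expanding the first slot, `T(x + sy, ⋯) = T(x, ⋯) + s T(y, ⋯)`, gives the polynomial by
induction on the degree. The leading coefficient and the derivative are carried along because root
counting and Gauss–Lucas need them. -/
theorem MultilinearMap.exists_polynomial_eval_add_smul {d : ℕ}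
    (T : MultilinearMap ℂ (fun _ : Fin d => V) ℂ) (x y : V) :
    ∃ P : ℂ[X], (∀ s, P.eval s = T (fun _ => x + s • y)) ∧ P.natDegree ≤ d ∧
      P.coeff d = T (fun _ => y) ∧
      ∀ s, P.derivative.eval s = ∑ i, T (Function.update (fun _ => x + s • y) i y) := by
  induction d with
  | zero =>
    refine ⟨C (T (fun _ => y)), fun s => ?_, by simp, by simp, by simp⟩
    simp only [eval_C]
    congr 1
    exact Subsingleton.elim _ _
  | succ d ih =>
    obtain ⟨P, hP, hPd, hPc, hP'⟩ := ih (T.curryLeft x)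
    obtain ⟨Q, hQ, hQd, hQc, hQ'⟩ := ih (T.curryLeft y)
    have hc : ∀ (z : V), (fun _ : Fin (d + 1) => z) = Fin.cons z (fun _ : Fin d => z) := by
      intro z; ext i; refine Fin.cases ?_ (fun _ => ?_) i <;> simp
    have hlin : ∀ (s : ℂ) (v : Fin d → V), T (Fin.cons (x + s • y) v)
        = T.curryLeft x v + s * T.curryLeft y v := by
      intro s v
      rw [← MultilinearMap.curryLeft_apply, map_add, map_smul]
      simp
    refine ⟨P + X * Q, fun s => ?_, ?_, ?_, fun s => ?_⟩
    · rw [hc, hlin]; simp [hP, hQ]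
    · refine (natDegree_add_le _ _).trans (max_le (hPd.trans d.le_succ) ?_)
      refine natDegree_mul_le.trans ?_
      have := natDegree_X_le (R := ℂ)
      omega
    · rw [coeff_add, coeff_X_mul, coeff_eq_zero_of_natDegree_lt (by omega), hQc, zero_add, hc y,
        MultilinearMap.curryLeft_apply]
    · rw [Fin.sum_univ_succ]
      have h0 : Function.update (fun _ : Fin (d + 1) => x + s • y) 0 y
          = Fin.cons y (fun _ => x + s • y) := by
        rw [hc (x + s • y), Fin.update_cons_zero]
      have hs : ∀ i : Fin d, Function.update (fun _ : Fin (d + 1) => x + s • y) i.succ y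
          = Fin.cons (x + s • y) (Function.update (fun _ => x + s • y) i y) := by
        intro i
        rw [hc (x + s • y), Fin.cons_update]
      simp only [h0, hs, hlin]
      rw [Finset.sum_add_distrib, ← Finset.mul_sum]
      simp only [derivative_add, derivative_mul, derivative_X, eval_add, eval_mul, eval_X, hP',
        hQ', hQ, one_mul, MultilinearMap.curryLeft_apply]
      ring

theorem MultilinearMap.exists_roots_add_smul {d : ℕ}
    (T : MultilinearMap ℂ (fun _ : Fin d => V) ℂ) (x y : V) (hy : T (fun _ => y) ≠ 0) :
    ∃ m : Multiset ℂ, m.card = d ∧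
      ∀ s : ℂ, T (fun _ => x + s • y) = T (fun _ => y) * (m.map fun r => s - r).prod := by
  obtain ⟨P, hP, hPd, hPc, -⟩ := T.exists_polynomial_eval_add_smul x y
  have hdeg : P.natDegree = d := le_antisymm hPd (le_natDegree_of_ne_zero (by rwa [hPc]))
  have hs : P.Splits := IsAlgClosed.splits P
  refine ⟨P.roots, ?_, fun s => ?_⟩
  · rw [← hdeg]; exact hs.natDegree_eq_card_roots.symm
  · rw [← hP, hs.eval_eq_prod_roots, leadingCoeff, hdeg, hPc]

theorem MultilinearMap.diag_smul {d : ℕ} (T : MultilinearMap ℂ (fun _ : Fin d => V) ℂ)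
    (c : ℂ) (x : V) : T (fun _ => c • x) = c ^ d * T (fun _ => x) := by
  have := T.map_smul_univ (fun _ => c) (fun _ => x)
  simpa using this

variable [TopologicalSpace V] [ContinuousAdd V] [ContinuousSMul ℂ V]

/-- A symmetric multilinear form `T` of degree `d` is hyperbolic with respect to `e` on the real
subspace `R` if `T(e, …, e) > 0` and for `x ∈ R` the polynomial `t ↦ T(x + te, …, x + te)` has only
real roots. -/
structure IsHyperbolic (R : Submodule ℝ V) {d : ℕ} (T : MultilinearMap ℂ (fun _ : Fin d => V) ℂ)
    (e : V) : Prop where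
  cont : Continuous T
  symm : ∀ (σ : Equiv.Perm (Fin d)) (v : Fin d → V), T (fun i => v (σ i)) = T v
  mem : e ∈ R
  pos : ∃ r : ℝ, 0 < r ∧ T (fun _ => e) = r
  real : ∀ x ∈ R, ∀ t : ℂ, T (fun _ => x + t • e) = 0 → t.im = 0

/-- The open hyperbolicity cone. -/
def openCone (R : Submodule ℝ V) {d : ℕ} (T : MultilinearMap ℂ (fun _ : Fin d => V) ℂ)
    (e : V) : Set V :=
  {x | x ∈ R ∧ ∀ t : ℝ, 0 ≤ t → T (fun _ => x + (t : ℂ) • e) ≠ 0}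

/-- The closed hyperbolicity cone. -/
def closedCone (R : Submodule ℝ V) {d : ℕ} (T : MultilinearMap ℂ (fun _ : Fin d => V) ℂ)
    (e : V) : Set V :=
  {x | x ∈ R ∧ ∀ t : ℝ, 0 < t → T (fun _ => x + (t : ℂ) • e) ≠ 0}

/-- A root in an open set persists under small perturbations. -/
theorem eventually_exists_root {d : ℕ} (T : MultilinearMap ℂ (fun _ : Fin d => V) ℂ)
    (hT : Continuous T) (x₀ x₁ y : V) (hy : T (fun _ => y) ≠ 0) (U : Set ℂ) (hU : IsOpen U)
    (τ₀ : ℝ) (s₀ : ℂ) (hs₀ : s₀ ∈ U) (h : T (fun _ => x₀ + (τ₀ : ℂ) • x₁ + s₀ • y) = 0) :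
    ∀ᶠ τ : ℝ in nhds τ₀, ∃ s ∈ U, T (fun _ => x₀ + (τ : ℂ) • x₁ + s • y) = 0 := by
  have hF : Continuous fun p : ℝ × ℂ => T (fun _ => x₀ + (p.1 : ℂ) • x₁ + p.2 • y) := by
    refine hT.comp (continuous_pi fun _ => ?_)
    have : Continuous fun p : ℝ × ℂ => (p.1 : ℂ) := Complex.continuous_ofReal.comp continuous_fst
    fun_prop
  obtain ⟨ε, hε, hεU⟩ := Metric.isOpen_iff.1 hU s₀ hs₀
  have hc : Continuous fun τ : ℝ => ‖T (fun _ => x₀ + (τ : ℂ) • x₁ + s₀ • y)‖ :=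
    (hF.comp (continuous_id.prodMk continuous_const)).norm
  -- If all roots were at distance at least `ε` from `s₀`, factorisation would bound `|T|` at `s₀`
  -- from below by this number; continuity in `τ` makes the value at `s₀` smaller.
  have hpos : 0 < ‖T (fun _ => y)‖ * ε ^ d := by positivity
  have hev : ∀ᶠ τ : ℝ in nhds τ₀,
      ‖T (fun _ => x₀ + (τ : ℂ) • x₁ + s₀ • y)‖ < ‖T (fun _ => y)‖ * ε ^ d := by
    refine hc.continuousAt.eventually (Iio_mem_nhds ?_)
    simpa only [h, norm_zero] using hpos
  filter_upwards [hev] with τ hτ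
  obtain ⟨m, hm, hroot⟩ := T.exists_roots_add_smul (x₀ + (τ : ℂ) • x₁) y hy
  by_contra hno
  have hfar : ∀ r ∈ m, ε ≤ ‖s₀ - r‖ := by
    intro r hr
    by_contra! hlt
    refine hno ⟨r, hεU ?_, ?_⟩
    · rw [Metric.mem_ball, dist_comm, dist_eq_norm]; exact hlt
    · rw [hroot]
      have : (0 : ℂ) ∈ m.map fun r' => r - r' := Multiset.mem_map.2 ⟨r, hr, sub_self r⟩
      rw [Multiset.prod_eq_zero this, mul_zero]
  have hprod : ∀ m : Multiset ℂ, (∀ r ∈ m, ε ≤ ‖s₀ - r‖) →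
      ε ^ m.card ≤ ‖(m.map fun r => s₀ - r).prod‖ := by
    intro m
    induction m using Multiset.induction_on with
    | empty => simp
    | cons a m ih =>
      intro h
      simp only [Multiset.card_cons, Multiset.map_cons, Multiset.prod_cons, norm_mul, pow_succ']
      exact mul_le_mul (h a (Multiset.mem_cons_self a m))
        (ih fun r hr => h r (Multiset.mem_cons_of_mem hr)) (by positivity) (by positivity)
  have h1 := hprod m hfar
  rw [hm] at h1
  rw [hroot, norm_mul] at hτ
  exact absurd hτ (not_lt.2 (by gcongr))

/-- The roots of `s ↦ T(x₀ + τ x₁ + s y)` depend continuously on `τ`: an open set whose frontier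
they do not meet is not entered. -/
theorem no_root_of_path {d : ℕ} (T : MultilinearMap ℂ (fun _ : Fin d => V) ℂ) (hT : Continuous T)
    (x₀ x₁ y : V) (hy : T (fun _ => y) ≠ 0) (U : Set ℂ) (hU : IsOpen U)
    (hfr : ∀ τ ∈ Set.Icc (0 : ℝ) 1, ∀ s ∈ frontier U, T (fun _ => x₀ + (τ : ℂ) • x₁ + s • y) ≠ 0)
    (h0 : ∀ s ∈ U, T (fun _ => x₀ + s • y) ≠ 0) :
    ∀ s ∈ U, T (fun _ => x₀ + x₁ + s • y) ≠ 0 := by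
  have hF : Continuous fun p : ℝ × ℂ => T (fun _ => x₀ + (p.1 : ℂ) • x₁ + p.2 • y) := by
    refine hT.comp (continuous_pi fun _ => ?_)
    have : Continuous fun p : ℝ × ℂ => (p.1 : ℂ) := Complex.continuous_ofReal.comp continuous_fst
    fun_prop
  set A : Set ℝ := {τ | ∃ s ∈ U, T (fun _ => x₀ + (τ : ℂ) • x₁ + s • y) = 0}
  set B : Set ℝ := {τ | ∀ s ∈ closure U, T (fun _ => x₀ + (τ : ℂ) • x₁ + s • y) ≠ 0}
  have hA : IsOpen A := by
    rw [isOpen_iff_mem_nhds]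
    rintro τ₀ ⟨s₀, hs₀, h⟩
    exact eventually_exists_root T hT x₀ x₁ y hy U hU τ₀ s₀ hs₀ h
  -- Roots cannot come in from infinity: after division by `s`, homogeneity leaves `T(s⁻¹(x₀ + τx₁)
  -- + y)`, which is close to `T(y, …, y) ≠ 0` for large `s`. The bounded part of the closure of `U`
  -- is compact, and there nonvanishing is stable in `τ`.
  have hB : IsOpen B := by
    rw [isOpen_iff_mem_nhds]
    intro τ₀ hτ₀
    have hG : Continuous fun p : ℝ × ℂ => T (fun _ => p.2 • (x₀ + (p.1 : ℂ) • x₁) + y) := by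
      refine hT.comp (continuous_pi fun _ => ?_)
      have : Continuous fun p : ℝ × ℂ => (p.1 : ℂ) := Complex.continuous_ofReal.comp continuous_fst
      fun_prop
    have hne : ∀ᶠ p in nhds ((τ₀, 0) : ℝ × ℂ), T (fun _ => p.2 • (x₀ + (p.1 : ℂ) • x₁) + y) ≠ 0 :=
      hG.continuousAt.eventually_ne (by simpa using hy)
    rw [nhds_prod_eq] at hne
    obtain ⟨pa, hpa, pb, hpb, hab⟩ := Filter.eventually_prod_iff.1 hne
    obtain ⟨δ, hδ, hδb⟩ := Metric.eventually_nhds_iff.1 hpb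
    have hK : IsCompact (closure U ∩ Metric.closedBall 0 δ⁻¹) :=
      (isCompact_closedBall _ _).inter_left isClosed_closure
    have hev := hK.eventually_forall_of_forall_eventually (x₀ := τ₀)
      (P := fun τ s => T (fun _ => x₀ + (τ : ℂ) • x₁ + s • y) ≠ 0)
      (fun s hs => hF.continuousAt.eventually_ne (hτ₀ s hs.1))
    filter_upwards [hev, hpa] with τ h1 h2 s hs
    by_cases hsb : s ∈ Metric.closedBall (0 : ℂ) δ⁻¹
    · exact h1 s ⟨hs, hsb⟩
    · have hsn : δ⁻¹ < ‖s‖ := by simpa using hsb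
      have hs0 : s ≠ 0 := by
        rintro rfl
        rw [norm_zero] at hsn
        exact absurd hsn (not_lt.2 (by positivity))
      have h3 := hab h2 (y := s⁻¹) (hδb (by
        rw [dist_zero_right, norm_inv]
        exact inv_lt_of_inv_lt₀ hδ hsn))
      have h4 : x₀ + (τ : ℂ) • x₁ + s • y = s • (s⁻¹ • (x₀ + (τ : ℂ) • x₁) + y) := by
        rw [smul_add, smul_smul, mul_inv_cancel₀ hs0, one_smul]
      rw [h4, T.diag_smul]
      exact mul_ne_zero (pow_ne_zero _ hs0) h3
  have hcov : Set.Icc (0 : ℝ) 1 ⊆ B ∪ A := by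
    intro τ hτ
    by_cases hA' : τ ∈ A
    · exact Or.inr hA'
    · refine Or.inl fun s hs h => ?_
      by_cases hsU : s ∈ U
      · exact hA' ⟨s, hsU, h⟩
      · exact hfr τ hτ s ⟨hs, by rwa [hU.interior_eq]⟩ h
  intro s hs h
  have hA1 : (1 : ℝ) ∈ A := ⟨s, hs, by simpa using h⟩
  have hB0 : (0 : ℝ) ∈ B := by
    rcases hcov ⟨le_rfl, zero_le_one⟩ with h | ⟨s, hs, h⟩
    · exact h
    · exact absurd (by simpa using h) (h0 s hs)
  -- `A` and `B` are open, disjoint, cover the interval and would both meet it.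
  obtain ⟨τ, -, hτB, s', hs', h'⟩ := isPreconnected_Icc B A hB hA hcov
    ⟨0, ⟨le_rfl, zero_le_one⟩, hB0⟩ ⟨1, ⟨zero_le_one, le_rfl⟩, hA1⟩
  exact hτB s' (subset_closure hs') h'


namespace IsHyperbolic

variable {R : Submodule ℝ V} {d : ℕ}

theorem diag_ne_zero {T : MultilinearMap ℂ (fun _ : Fin d => V) ℂ} {e : V}
    (h : IsHyperbolic R T e) : T (fun _ => e) ≠ 0 := by
  obtain ⟨r, hr, h⟩ := h.pos
  rw [h]
  exact_mod_cast hr.ne'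

/-- The roots `r` of `s ↦ T(a + se)` are real and negative, so `T(a) = T(e) ∏ (-r)` is positive. -/
theorem pos_of_mem {T : MultilinearMap ℂ (fun _ : Fin d => V) ℂ} {e : V}
    (h : IsHyperbolic R T e) {a : V} (ha : a ∈ openCone R T e) :
    ∃ r : ℝ, 0 < r ∧ T (fun _ => a) = r := by
  obtain ⟨m, -, hm⟩ := T.exists_roots_add_smul a e h.diag_ne_zero
  obtain ⟨r₀, hr₀, hr₀e⟩ := h.pos
  have hroot : ∀ r ∈ m, r.im = 0 ∧ r.re < 0 := by
    intro r hr
    have hz : T (fun _ => a + r • e) = 0 := by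
      rw [hm]
      have : (0 : ℂ) ∈ m.map fun r' => r - r' := Multiset.mem_map.2 ⟨r, hr, sub_self r⟩
      rw [Multiset.prod_eq_zero this, mul_zero]
    have him := h.real a ha.1 r hz
    refine ⟨him, ?_⟩
    by_contra! hre
    refine ha.2 r.re hre ?_
    rwa [show ((r.re : ℝ) : ℂ) = r from Complex.ext rfl him.symm]
  have hprod : ∀ m : Multiset ℂ, (∀ r ∈ m, r.im = 0 ∧ r.re < 0) →
      ∃ ρ : ℝ, 0 < ρ ∧ (m.map fun r => (0 : ℂ) - r).prod = ρ := by
    intro m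
    induction m using Multiset.induction_on with
    | empty => intro; exact ⟨1, one_pos, by simp⟩
    | cons r m ih =>
      intro hr
      obtain ⟨ρ, hρ, hρm⟩ := ih fun s hs => hr s (Multiset.mem_cons_of_mem hs)
      obtain ⟨h1, h2⟩ := hr r (Multiset.mem_cons_self r m)
      refine ⟨-r.re * ρ, mul_pos (neg_pos.2 h2) hρ, ?_⟩
      rw [Multiset.map_cons, Multiset.prod_cons, hρm]
      push_cast
      rw [show ((r.re : ℝ) : ℂ) = r from Complex.ext rfl h1.symm]
      ring
  obtain ⟨ρ, hρ, hρm⟩ := hprod m hroot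
  refine ⟨r₀ * ρ, mul_pos hr₀ hρ, ?_⟩
  have := hm 0
  rw [zero_smul, add_zero, hr₀e, hρm] at this
  rw [this]
  push_cast
  rfl

theorem self_mem {T : MultilinearMap ℂ (fun _ : Fin d => V) ℂ} {e : V}
    (h : IsHyperbolic R T e) : e ∈ openCone R T e := by
  refine ⟨h.mem, fun t ht => ?_⟩
  rw [show e + (t : ℂ) • e = ((1 + t : ℝ) : ℂ) • e by push_cast; rw [add_smul, one_smul],
    T.diag_smul]
  refine mul_ne_zero (pow_ne_zero _ ?_) h.diag_ne_zero
  have : 0 < 1 + t := by linarith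
  exact_mod_cast this.ne'

theorem smul_mem_real (x : V) (hx : x ∈ R) (t : ℝ) : (t : ℂ) • x ∈ R := by
  rw [Complex.coe_smul]
  exact R.smul_mem t hx

/-- The shift `iεe` keeps the roots in `s` off the real axis, because for real `s` the rest of the
vector is in `R`. So no root crosses the axis while `x` is deformed to `0`. At `x = 0` homogeneity
gives `s = iε/ρ` with `ρ < 0`, in the lower half-plane. -/
theorem ne_zero_of_im_pos {T : MultilinearMap ℂ (fun _ : Fin d => V) ℂ} {e : V}
    (h : IsHyperbolic R T e) {a : V} (ha : a ∈ openCone R T e) {x : V} (hx : x ∈ R) {ε : ℝ}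
    (hε : 0 < ε) {s : ℂ} (hs : 0 < s.im) :
    T (fun _ => ((ε : ℂ) * Complex.I) • e + x + s • a) ≠ 0 := by
  obtain ⟨ra, hra, hra'⟩ := h.pos_of_mem ha
  have ha0 : T (fun _ => a) ≠ 0 := by rw [hra']; exact_mod_cast hra.ne'
  refine no_root_of_path T h.cont _ x a ha0 {s | 0 < s.im}
    (isOpen_lt continuous_const Complex.continuous_im) ?_ ?_ s hs
  · intro τ _ s hs h0
    have hs0 : s.im = 0 := by
      rw [Complex.frontier_setOfPred_lt_im] at hs
      exact hs
    have hmem : (τ : ℂ) • x + s • a ∈ R := by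
      rw [show s = ((s.re : ℝ) : ℂ) from Complex.ext rfl hs0]
      exact R.add_mem (smul_mem_real x hx τ) (smul_mem_real a ha.1 _)
    have := h.real _ hmem ((ε : ℂ) * Complex.I) (by rw [← h0]; congr 1; ext; abel)
    simp at this
    exact hε.ne' this
  · intro s hs h0
    have hs0 : s ≠ 0 := by rintro rfl; simp at hs
    rw [show ((ε : ℂ) * Complex.I) • e + s • a = s • (a + (ε * Complex.I / s) • e) by
      rw [smul_add, smul_smul, mul_div_cancel₀ _ hs0, add_comm], T.diag_smul] at h0
    have h1 := (mul_eq_zero.1 h0).resolve_left (pow_ne_zero _ hs0)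
    have him := h.real a ha.1 _ h1
    set ρ := (ε * Complex.I / s).re with hρ
    have hρs : (ρ : ℂ) = ε * Complex.I / s := Complex.ext rfl him.symm
    have hneg : ρ < 0 := by
      by_contra! hge
      exact ha.2 ρ hge (by rw [hρs]; exact h1)
    have h2 : (ρ : ℂ) * s = ε * Complex.I := by rw [hρs, div_mul_cancel₀ _ hs0]
    have h3 := congrArg Complex.im h2
    simp at h3
    have : 0 < s.im := hs
    nlinarith

/-- Gårding: a hyperbolic form is hyperbolic with respect to each element of its open cone. -/
theorem of_mem {T : MultilinearMap ℂ (fun _ : Fin d => V) ℂ} {e : V}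
    (h : IsHyperbolic R T e) {a : V} (ha : a ∈ openCone R T e) : IsHyperbolic R T a := by
  have hpos := h.pos_of_mem ha
  obtain ⟨ra, hra, hra'⟩ := hpos
  have ha0 : T (fun _ => a) ≠ 0 := by rw [hra']; exact_mod_cast hra.ne'
  have key : ∀ x ∈ R, ∀ t : ℂ, 0 < t.im → T (fun _ => x + t • a) ≠ 0 := by
    intro x hx t ht h0
    -- A root in the upper half-plane would survive the perturbation `x + iεe` for some small `ε >
    -- 0`.
    have hev := eventually_exists_root T h.cont x (Complex.I • e) a ha0 {s | 0 < s.im}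
      (isOpen_lt continuous_const Complex.continuous_im) 0 t ht (by simpa using h0)
    have hev' := (hev.filter_mono nhdsWithin_le_nhds).and
      (self_mem_nhdsWithin : ∀ᶠ τ in nhdsWithin (0 : ℝ) (Set.Ioi 0), τ ∈ Set.Ioi (0 : ℝ))
    obtain ⟨ε, ⟨s, hs, hz⟩, hε⟩ := hev'.exists
    refine h.ne_zero_of_im_pos ha hx hε hs ?_
    rw [← hz, smul_smul, add_comm x]
  refine ⟨h.cont, h.symm, ha.1, h.pos_of_mem ha, fun x hx t ht => ?_⟩
  rcases lt_trichotomy t.im 0 with hlt | heq | hgt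
  · refine absurd ?_ (key (-x) (R.neg_mem hx) (-t) (by simpa using hlt))
    have := T.diag_smul (-1) (x + t • a)
    rw [ht, mul_zero] at this
    rw [← this]
    congr 1; ext; simp only [neg_smul, one_smul, neg_add]
  · exact heq
  · exact absurd ht (key x hx t hgt)

/-- Move from `e` to `b` along the segment and follow the roots in direction `a`. They are real, so
a root entering the right half-plane would pass through `0`; but `T` does not vanish on the segment,
whose points other than `e` are positive multiples of `b + te` with `t ≥ 0`. -/
theorem openCone_subset {T : MultilinearMap ℂ (fun _ : Fin d => V) ℂ} {e : V}
    (h : IsHyperbolic R T e) {a : V} (ha : a ∈ openCone R T e) :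
    openCone R T e ⊆ openCone R T a := by
  intro b hb
  have h' := h.of_mem ha
  refine ⟨hb.1, fun t ht => ?_⟩
  rcases ht.eq_or_lt with rfl | ht
  · simpa using hb.2 0 le_rfl
  have := no_root_of_path T h.cont e (b - e) a h'.diag_ne_zero {s | 0 < s.re}
    (isOpen_lt continuous_const Complex.continuous_re) ?_ ?_ t (by simpa using ht)
  · simpa using this
  · intro τ hτ s hs h0
    have hs0 : s.re = 0 := by
      rw [Complex.frontier_setOfPred_lt_re] at hs
      exact hs
    have hmem : e + (τ : ℂ) • (b - e) ∈ R :=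
      R.add_mem h.mem (smul_mem_real _ (R.sub_mem hb.1 h.mem) τ)
    have hsz : s = 0 := Complex.ext hs0 (h'.real _ hmem s h0)
    rw [hsz, zero_smul, add_zero] at h0
    rcases hτ.1.eq_or_lt with rfl | hτ0
    · exact h.diag_ne_zero (by simpa using h0)
    · have hτc : (τ : ℂ) ≠ 0 := by exact_mod_cast hτ0.ne'
      rw [show e + (τ : ℂ) • (b - e) = (τ : ℂ) • (b + (((1 - τ) / τ : ℝ) : ℂ) • e) by
        push_cast
        rw [smul_add, smul_smul, mul_div_cancel₀ _ hτc, sub_smul, one_smul, smul_sub]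
        abel, T.diag_smul] at h0
      exact mul_ne_zero (pow_ne_zero _ hτc) (hb.2 _ (div_nonneg (by linarith [hτ.2]) hτ.1)) h0
  · intro s hs h0
    have him := h'.real e h.mem s h0
    have hsr : s = ((s.re : ℝ) : ℂ) := Complex.ext rfl him
    have hsp : 0 < s.re := hs
    have hs0 : s ≠ 0 := by rintro rfl; simp at hsp
    rw [show e + s • a = s • (a + ((s.re⁻¹ : ℝ) : ℂ) • e) by
      rw [Complex.ofReal_inv, ← hsr, smul_add, smul_smul, mul_inv_cancel₀ hs0, one_smul, add_comm],
      T.diag_smul] at h0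
    exact mul_ne_zero (pow_ne_zero _ hs0) (ha.2 _ (inv_nonneg.2 hsp.le)) h0

omit [TopologicalSpace V] [ContinuousAdd V] [ContinuousSMul ℂ V] in
theorem apply_update_eq {T : MultilinearMap ℂ (fun _ : Fin (d + 1) => V) ℂ}
    (hT : ∀ (σ : Equiv.Perm (Fin (d + 1))) (v : Fin (d + 1) → V), T (fun i => v (σ i)) = T v)
    (c y : V) (i : Fin (d + 1)) :
    T (Function.update (fun _ => c) i y) = T (Fin.cons y fun _ => c) := by
  rw [← hT (Equiv.swap 0 i)]
  congr 1
  ext j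
  rw [Function.update_apply]
  refine Fin.cases ?_ (fun j => ?_) j
  · simp
  · rw [Fin.cons_succ, if_neg]
    intro hj
    rw [Equiv.swap_apply_eq_iff, Equiv.swap_apply_right] at hj
    exact Fin.succ_ne_zero _ hj

/-- Gauss–Lucas: by symmetry, contracting one slot with `e` is differentiation in `s` up to the
factor `d + 1`. With `S` the real axis this preserves hyperbolicity; with `S` the left half-plane it
enlarges the open cone. -/
theorem curry_root_mem {T : MultilinearMap ℂ (fun _ : Fin (d + 1) => V) ℂ} {e : V}
    (h : IsHyperbolic R T e) (x : V) {S : Set ℂ} (hS : Convex ℝ S)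
    (hroot : ∀ s, T (fun _ => x + s • e) = 0 → s ∈ S) (s : ℂ)
    (hs : T.curryLeft e (fun _ => x + s • e) = 0) : s ∈ S := by
  obtain ⟨P, hP, hPd, hPc, hP'⟩ := T.exists_polynomial_eval_add_smul x e
  have hdeg : P.natDegree = d + 1 :=
    le_antisymm hPd (le_natDegree_of_ne_zero (by rw [hPc]; exact h.diag_ne_zero))
  have hdeg0 : 0 < P.degree := natDegree_pos_iff_degree_pos.1 (by omega)
  have hP'0 : P.derivative ≠ 0 := by
    intro h0
    have := derivative_eq_zero.1 h0
    omega
  have hmem : s ∈ P.derivative.rootSet ℂ := by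
    rw [mem_rootSet]
    refine ⟨hP'0, ?_⟩
    rw [coe_aeval_eq_eval, hP']
    simp only [apply_update_eq h.symm]
    rw [← MultilinearMap.curryLeft_apply, hs]
    simp
  refine convexHull_min ?_ hS (rootSet_derivative_subset_convexHull_rootSet hdeg0 hmem)
  intro z hz
  rw [mem_rootSet, coe_aeval_eq_eval, hP] at hz
  exact hroot z hz.2

theorem curryLeft {T : MultilinearMap ℂ (fun _ : Fin (d + 1) => V) ℂ} {e : V}
    (h : IsHyperbolic R T e) : IsHyperbolic R (T.curryLeft e) e := by
  refine ⟨?_, fun σ v => ?_, h.mem, ?_, fun x hx t ht => ?_⟩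
  · refine h.cont.comp (continuous_pi fun i => ?_)
    refine Fin.cases ?_ (fun i => ?_) i
    · exact continuous_const
    · exact continuous_apply i
  · rw [MultilinearMap.curryLeft_apply, MultilinearMap.curryLeft_apply,
      ← h.symm (Equiv.Perm.decomposeFin.symm (0, σ)) (Fin.cons e v)]
    congr 1
    ext i
    refine Fin.cases ?_ (fun i => ?_) i
    · simp
    · simp
  · obtain ⟨r, hr, hre⟩ := h.pos
    refine ⟨r, hr, ?_⟩
    rw [← hre, MultilinearMap.curryLeft_apply]
    congr 1
    ext i
    refine Fin.cases ?_ (fun i => ?_) i <;> simp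
  · refine h.curry_root_mem x (S := {s | s.im = 0}) ?_ (h.real x hx) t ht
    exact convex_hyperplane Complex.imLm.isLinear 0

theorem openCone_subset_curryLeft {T : MultilinearMap ℂ (fun _ : Fin (d + 1) => V) ℂ} {e : V}
    (h : IsHyperbolic R T e) : openCone R T e ⊆ openCone R (T.curryLeft e) e := by
  intro b hb
  refine ⟨hb.1, fun t ht h0 => ?_⟩
  have := h.curry_root_mem b (S := {s | s.re < 0}) (convex_halfSpace_lt Complex.reLm.isLinear 0)
    (fun s hs => ?_) t h0
  · simp at this
    linarith
  · have him := h.real b hb.1 s hs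
    by_contra! hre
    simp only [Set.mem_ofPred_eq, not_lt] at hre
    refine hb.2 s.re hre ?_
    rwa [show ((s.re : ℝ) : ℂ) = s from Complex.ext rfl him.symm]

/-- Take `v 0` as the new direction of hyperbolicity and contract with it: the other vectors lie in
the open cone of the contracted form, and the degree drops by one. -/
theorem pos_of_forall_mem_openCone {T : MultilinearMap ℂ (fun _ : Fin d => V) ℂ} {e : V}
    (h : IsHyperbolic R T e) (v : Fin d → V) (hv : ∀ i, v i ∈ openCone R T e) :
    ∃ r : ℝ, 0 < r ∧ T v = r := by
  induction d generalizing e with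
  | zero =>
    obtain ⟨r, hr, hre⟩ := h.pos
    exact ⟨r, hr, by rw [← hre]; congr 1; exact Subsingleton.elim _ _⟩
  | succ d ih =>
    have h0 := h.of_mem (hv 0)
    have := ih h0.curryLeft (fun i => v i.succ) fun i =>
      h0.openCone_subset_curryLeft (h.openCone_subset (hv 0) (hv i.succ))
    rwa [MultilinearMap.curryLeft_apply, show (Fin.cons (v 0) fun i => v i.succ) = v from
      Fin.cons_self_tail v] at this

theorem add_smul_mem_openCone {T : MultilinearMap ℂ (fun _ : Fin d => V) ℂ} {e : V}
    (h : IsHyperbolic R T e) {a : V} (ha : a ∈ closedCone R T e) {ε : ℝ} (hε : 0 < ε) :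
    a + (ε : ℂ) • e ∈ openCone R T e := by
  refine ⟨R.add_mem ha.1 (smul_mem_real e h.mem ε), fun t ht => ?_⟩
  have := ha.2 (ε + t) (by linarith)
  rwa [Complex.ofReal_add, add_smul, ← add_assoc] at this

/-- **Gårding's inequality** (weak form). -/
theorem nonneg_of_forall_mem_closedCone {T : MultilinearMap ℂ (fun _ : Fin d => V) ℂ} {e : V}
    (h : IsHyperbolic R T e) (v : Fin d → V) (hv : ∀ i, v i ∈ closedCone R T e) :
    0 ≤ (T v).re := by
  have hc : Continuous fun ε : ℝ => (T fun i => v i + (ε : ℂ) • e).re := by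
    refine Complex.continuous_re.comp (h.cont.comp (continuous_pi fun i => ?_))
    have := Complex.continuous_ofReal
    fun_prop
  have ht : Filter.Tendsto (fun ε : ℝ => (T fun i => v i + (ε : ℂ) • e).re)
      (nhdsWithin 0 (Set.Ioi 0)) (nhds (T v).re) := by
    have := hc.tendsto 0
    simp only [Complex.ofReal_zero, zero_smul, add_zero] at this
    exact this.mono_left nhdsWithin_le_nhds
  refine ge_of_tendsto ht ?_
  filter_upwards [self_mem_nhdsWithin] with ε hε
  obtain ⟨r, hr, hre⟩ := h.pos_of_forall_mem_openCone (fun i => v i + (ε : ℂ) • e)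
    fun i => h.add_smul_mem_openCone (hv i) hε
  rw [hre]
  simpa using hr.le

theorem openCone_subset_closedCone {T : MultilinearMap ℂ (fun _ : Fin d => V) ℂ} {e : V} :
    openCone R T e ⊆ closedCone R T e := fun _ hx => ⟨hx.1, fun t ht => hx.2 t ht.le⟩

/-- The closed cone is determined by its polar forms `T(·, a, …, a)`. -/
theorem mem_closedCone_of_forall {T : MultilinearMap ℂ (fun _ : Fin (d + 1) => V) ℂ} {e : V}
    (h : IsHyperbolic R T e) {x : V} (hx : x ∈ R)
    (hnn : ∀ a ∈ closedCone R T e, 0 ≤ (T (Fin.cons x fun _ => a)).re) :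
    x ∈ closedCone R T e := by
  refine ⟨hx, fun t₁ ht₁ hz₁ => ?_⟩
  obtain ⟨P, hP, hPd, hPc, hP'⟩ := T.exists_polynomial_eval_add_smul x e
  have hPne : P ≠ 0 := by
    rintro rfl
    exact h.diag_ne_zero (by rw [← hPc]; simp)
  -- A positive root `t₁` is assumed, and `t₀ ≥ t₁ > 0` is the largest root of `P(t) = T(x + te)`.
  -- For `t > t₀` the point `a = x + te` is in the open cone and the hypothesis applies to it.
  obtain ⟨z₀, hz₀, hmax⟩ := P.roots.toFinset.exists_max_image Complex.re
    ⟨t₁, by rw [Multiset.mem_toFinset, mem_roots hPne, IsRoot, hP]; exact hz₁⟩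
  rw [Multiset.mem_toFinset, mem_roots hPne, IsRoot, hP] at hz₀
  have him := h.real x hx z₀ hz₀
  set t₀ := z₀.re with ht₀
  have hz₀' : (t₀ : ℂ) = z₀ := Complex.ext rfl him.symm
  have ht₁₀ : t₁ ≤ t₀ := by
    have := hmax t₁ (by rw [Multiset.mem_toFinset, mem_roots hPne, IsRoot, hP]; exact hz₁)
    simpa using this
  have hopen : ∀ t : ℝ, t₀ < t → x + (t : ℂ) • e ∈ openCone R T e := by
    intro t ht
    refine ⟨R.add_mem hx (smul_mem_real e h.mem t), fun s hs h0 => ?_⟩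
    rw [add_assoc, ← add_smul, ← Complex.ofReal_add] at h0
    have := hmax ((t + s : ℝ) : ℂ) (by rw [Multiset.mem_toFinset, mem_roots hPne, IsRoot, hP]; exact h0)
    rw [Complex.ofReal_re] at this
    linarith
  have hder : ∀ t : ℝ, HasDerivAt (fun t : ℝ => (P.eval (t : ℂ)).re)
      (P.derivative.eval (t : ℂ)).re t := fun t => (P.hasDerivAt (t : ℂ)).real_of_complex
  -- Since `x = a - te`, the polar form is `T(x, a, …, a) = P(t) - t P'(t)/(d + 1)`.
  have hle : ∀ t : ℝ, t₀ < t →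
      t * (P.derivative.eval (t : ℂ)).re ≤ (d + 1) * (P.eval (t : ℂ)).re := by
    intro t ht
    have h1 := hnn _ (openCone_subset_closedCone (hopen t ht))
    have h2 : T (Fin.cons x fun _ => x + (t : ℂ) • e)
        = P.eval (t : ℂ) - t * T (Fin.cons e fun _ => x + (t : ℂ) • e) := by
      rw [hP, show (fun _ : Fin (d + 1) => x + (t : ℂ) • e)
        = Fin.cons (x + (t : ℂ) • e) (fun _ => x + (t : ℂ) • e) by
          ext i; refine Fin.cases ?_ (fun _ => ?_) i <;> simp]
      simp only [← MultilinearMap.curryLeft_apply, map_add, map_smul, add_apply,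
        smul_apply, smul_eq_mul]
      ring
    have h3 : P.derivative.eval (t : ℂ) = (d + 1) * T (Fin.cons e fun _ => x + (t : ℂ) • e) := by
      rw [hP']
      simp only [apply_update_eq h.symm]
      simp
    have h4 : (P.derivative.eval (t : ℂ)).re
        = (d + 1) * (T (Fin.cons e fun _ => x + (t : ℂ) • e)).re := by
      rw [h3]
      have : ((d : ℂ) + 1) = ((d + 1 : ℝ) : ℂ) := by push_cast; rfl
      rw [this, Complex.re_ofReal_mul]
    rw [h2, Complex.sub_re, Complex.re_ofReal_mul] at h1
    rw [h4]
    have : (0 : ℝ) ≤ d + 1 := by positivity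
    nlinarith
  -- The inequality says that `P(t)/t^(d+1)` has nonpositive derivative. It vanishes at `t₀` but is
  -- positive at `t₀ + 1`, a contradiction.
  have hanti : AntitoneOn (fun t : ℝ => (P.eval (t : ℂ)).re / t ^ (d + 1)) (Set.Ici t₀) := by
    have hd : ∀ t : ℝ, 0 < t → HasDerivAt (fun t : ℝ => (P.eval (t : ℂ)).re / t ^ (d + 1))
        (((P.derivative.eval (t : ℂ)).re * t ^ (d + 1)
          - (P.eval (t : ℂ)).re * ((d + 1 : ℕ) * t ^ d)) / (t ^ (d + 1)) ^ 2) t := by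
      intro t ht
      exact (hder t).div (hasDerivAt_pow (d + 1) t) (pow_ne_zero _ ht.ne')
    refine antitoneOn_of_deriv_nonpos (convex_Ici t₀) ?_ ?_ ?_
    · intro t ht
      exact (hd t (by linarith [Set.mem_Ici.1 ht])).continuousAt.continuousWithinAt
    · rw [interior_Ici]
      intro t ht
      exact (hd t (by linarith [Set.mem_Ioi.1 ht])).differentiableAt.differentiableWithinAt
    · rw [interior_Ici]
      intro t ht
      have htp : 0 < t := by linarith [Set.mem_Ioi.1 ht]
      rw [(hd t htp).deriv]
      refine div_nonpos_of_nonpos_of_nonneg ?_ (by positivity)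
      have := hle t ht
      have h5 : (P.derivative.eval (t : ℂ)).re * t ^ (d + 1)
          - (P.eval (t : ℂ)).re * ((d + 1 : ℕ) * t ^ d)
          = (t * (P.derivative.eval (t : ℂ)).re - (d + 1) * (P.eval (t : ℂ)).re) * t ^ d := by
        push_cast
        ring
      rw [h5]
      exact mul_nonpos_of_nonpos_of_nonneg (by linarith) (by positivity)
  have h6 := hanti (Set.mem_Ici.2 le_rfl) (Set.mem_Ici.2 (by linarith : t₀ ≤ t₀ + 1)) (by linarith)
  obtain ⟨r, hr, hre⟩ := h.pos_of_mem (hopen (t₀ + 1) (by linarith))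
  simp only [hP] at h6
  rw [hre, hz₀', hz₀, Complex.ofReal_re, Complex.zero_re, zero_div] at h6
  have : 0 < r / (t₀ + 1) ^ (d + 1) := div_pos hr (pow_pos (by linarith) _)
  linarith

end IsHyperbolic

end Hyperbolic

/-! ### Constant-coefficient forms and determinants -/

section Forms

open ExteriorAlgebra

theorem ExteriorAlgebra.ι_mul_ι_commute_ι {R M : Type*} [CommRing R] [AddCommGroup M] [Module R M]
    (a b c : M) : Commute (ι R a * ι R b) (ι R c) := by
  have h1 := ι_add_mul_swap (R := R) b c
  have h2 := ι_add_mul_swap (R := R) a c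
  rw [Commute, SemiconjBy, mul_assoc, eq_neg_of_add_eq_zero_left h1, mul_neg, ← mul_assoc,
    eq_neg_of_add_eq_zero_left h2]
  simp [mul_assoc]

theorem form11_commute {N : ℕ} (a b : Matrix (Fin N) (Fin N) ℂ) :
    Commute (form11 a) (form11 b) := by
  unfold form11
  refine Commute.sum_left _ _ _ fun j _ => Commute.sum_left _ _ _ fun k _ =>
    Commute.sum_right _ _ _ fun j' _ => Commute.sum_right _ _ _ fun k' _ => ?_
  exact ((ι_mul_ι_commute_ι _ _ _).mul_right (ι_mul_ι_commute_ι _ _ _)).smul_left _ |>.smul_right _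

/-- `form11` as a linear map. -/
def form11Lin (N : ℕ) : Matrix (Fin N) (Fin N) ℂ →ₗ[ℂ] ConstForm N where
  toFun := form11
  map_add' a b := by
    simp only [form11, Matrix.add_apply, mul_add, add_smul, Finset.sum_add_distrib]
  map_smul' c a := by
    simp only [form11, Matrix.smul_apply, smul_eq_mul, RingHom.id_apply, Finset.smul_sum, smul_smul]
    refine Finset.sum_congr rfl fun j _ => Finset.sum_congr rfl fun k _ => ?_
    congr 1
    ring

@[simp]
theorem form11Lin_apply {N : ℕ} (a : Matrix (Fin N) (Fin N) ℂ) : form11Lin N a = form11 a := rfl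

/-- The complex density of the top-degree part of a form. -/
def topCoeff (N : ℕ) : ConstForm N →ₗ[ℂ] ℂ :=
  ((-2 * Complex.I) ^ N : ℂ) •
    ExteriorAlgebra.liftAlternating (R := ℂ) (M := Fin N × Fin 2 → ℂ) (N := ℂ)
      (Pi.single (N * 2)
        ((Matrix.detRowAlternating (n := Fin N × Fin 2) (R := ℂ)).domDomCongr finProdFinEquiv))

theorem volDensity_eq {N : ℕ} (η : ConstForm N) : volDensity η = (topCoeff N η).re := rfl

/-- The form `(A_1, …, A_k) ↦ A_1 ∧ ⋯ ∧ A_k ∧ β^(N-k)`. -/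
def polarForm (N k : ℕ) : MultilinearMap ℂ (fun _ : Fin k => Matrix (Fin N) (Fin N) ℂ) ℂ :=
  (topCoeff N ∘ₗ LinearMap.mulRight ℂ (kahlerForm N ^ (N - k))).compMultilinearMap
    ((MultilinearMap.mkPiAlgebraFin ℂ k (ConstForm N)).compLinearMap fun _ => form11Lin N)

theorem polarForm_apply {N k : ℕ} (v : Fin k → Matrix (Fin N) (Fin N) ℂ) :
    polarForm N k v
      = topCoeff N ((List.ofFn fun i => form11 (v i)).prod * kahlerForm N ^ (N - k)) := by
  simp [polarForm]

theorem polarForm_diag {N k : ℕ} (a : Matrix (Fin N) (Fin N) ℂ) :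
    polarForm N k (fun _ => a) = topCoeff N (form11 a ^ k * kahlerForm N ^ (N - k)) := by
  simp [polarForm_apply]

theorem polarForm_cons {N k : ℕ} (a : Matrix (Fin N) (Fin N) ℂ)
    (v : Fin k → Matrix (Fin N) (Fin N) ℂ) :
    polarForm N (k + 1) (Fin.cons a v) = topCoeff N (form11 a *
      ((List.ofFn fun i => form11 (v i)).prod * kahlerForm N ^ (N - (k + 1)))) := by
  simp [polarForm_apply, List.ofFn_succ, mul_assoc]

theorem polarForm_symm {N k : ℕ} (σ : Equiv.Perm (Fin k)) (v : Fin k → Matrix (Fin N) (Fin N) ℂ) :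
    polarForm N k (fun i => v (σ i)) = polarForm N k v := by
  rw [polarForm_apply, polarForm_apply]
  congr 2
  refine List.Perm.prod_eq' (Equiv.Perm.ofFn_comp_perm σ fun i => form11 (v i)) ?_
  rw [List.pairwise_ofFn]
  intro i j _
  exact form11_commute _ _

/-- The identity matrix represents `β`, so filling a slot with it trades a free factor for one more
power of `β`. Thus all these polar forms are iterated derivatives of the determinant in one
direction. -/
theorem polarForm_curryLeft_one {N k : ℕ} (hk : k + 1 ≤ N) :
    (polarForm N (k + 1)).curryLeft 1 = polarForm N k := by
  refine MultilinearMap.ext fun v => ?_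
  rw [MultilinearMap.curryLeft_apply, polarForm_cons, polarForm_apply]
  congr 1
  rw [show form11 (1 : Matrix (Fin N) (Fin N) ℂ) = kahlerForm N from rfl, ← mul_assoc]
  have hc : Commute (kahlerForm N) (List.ofFn fun i => form11 (v i)).prod := by
    refine Commute.list_prod_right _ _ fun x hx => ?_
    obtain ⟨i, rfl⟩ := List.mem_ofFn.1 hx
    exact form11_commute _ _
  rw [hc.eq, mul_assoc, ← pow_succ', show N - (k + 1) + 1 = N - k by omega]

/-- `finProdFinEquiv` lists the pairs `(i, 0), (i, 1)` consecutively, so the product of two-forms is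
already in the order that the volume functional uses. -/
theorem liftAlternating_prod_pairs {N : ℕ} {V : Type*} [AddCommGroup V] [Module ℂ V]
    (g : V [⋀^(Fin N × Fin 2)]→ₗ[ℂ] ℂ) (v : Fin N × Fin 2 → V) :
    ExteriorAlgebra.liftAlternating (R := ℂ) (M := V) (N := ℂ)
      (Pi.single (N * 2) (g.domDomCongr finProdFinEquiv))
      (List.ofFn fun i : Fin N => ι ℂ (v (i, 0)) * ι ℂ (v (i, 1))).prod = g v := by
  have h : (List.ofFn fun i : Fin N => ι ℂ (v (i, 0)) * ι ℂ (v (i, 1))).prod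
      = ιMulti ℂ (N * 2) (fun i => v (finProdFinEquiv.symm i)) := by
    rw [ιMulti_apply, List.ofFn_mul, List.prod_flatten, List.map_ofFn]
    congr 2
    ext i
    have h0 : ∀ c : Fin 2, (⟨(i : ℕ) * 2 + c, by omega⟩ : Fin (N * 2)) = finProdFinEquiv (i, c) := by
      intro c
      ext
      simp [finProdFinEquiv]
      ring
    simp only [Function.comp_apply, h0, Equiv.symm_apply_apply]
    simp [List.ofFn_succ]
  rw [h, liftAlternating_apply_ιMulti, Pi.single_eq_same, AlternatingMap.domDomCongr_apply]
  congr 1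
  ext p
  simp only [Function.comp_apply, Equiv.symm_apply_apply]

/-- Rows and columns are permuted in the same way to reach block diagonal form, so no sign appears.
-/
theorem det_interleave {N : ℕ} (P Q : Matrix (Fin N) (Fin N) ℂ) :
    Matrix.det (Matrix.of fun (p q : Fin N × Fin 2) =>
      if p.2 = 0 then (if q.2 = 0 then P p.1 q.1 else 0)
      else (if q.2 = 0 then 0 else Q p.1 q.1)) = P.det * Q.det := by
  let e : Fin N ⊕ Fin N ≃ Fin N × Fin 2 :=
    { toFun := Sum.elim (fun i => (i, 0)) (fun i => (i, 1))
      invFun := fun p => if p.2 = 0 then Sum.inl p.1 else Sum.inr p.1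
      left_inv := by rintro (i | i) <;> simp
      right_inv := by
        rintro ⟨i, c⟩
        fin_cases c <;> simp }
  rw [← Matrix.det_submatrix_equiv_self e, ← Matrix.det_fromBlocks_zero₂₁ P 0 Q]
  congr 1
  ext (i | i) (j | j) <;> simp [e]

theorem card_injective_self (N : ℕ) :
    (Finset.univ.filter fun s : Fin N → Fin N => Function.Injective s).card = N.factorial := by
  rw [← Fintype.card_subtype, Fintype.card_congr (Equiv.subtypeInjectiveEquivEmbedding _ _),
    Fintype.card_embedding_eq, Fintype.card_fin, Nat.descFactorial_self]

/-- Write the form as `∑ dz_j ∧ w_j` and expand the power over maps `s` of the index set.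
Noninjective `s` repeat a `dz_j` and contribute zero. A permutation contributes its sign twice, so
all `N!` of them give `(2i)^N det a`; finally `(-2i)^N (2i)^N = 4^N`. -/
theorem topCoeff_form11_pow {N : ℕ} (a : Matrix (Fin N) (Fin N) ℂ) :
    topCoeff N (form11 a ^ N) = (4 ^ N * N.factorial : ℝ) * a.det := by
  set w : Fin N → Fin N × Fin 2 → ℂ :=
    fun j q => if q.2 = 0 then 0 else 2 * Complex.I * a j q.1 with hw
  have hform : form11 a = ∑ j, dz j * ι ℂ (w j) := by
    unfold form11
    refine Finset.sum_congr rfl fun j _ => ?_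
    have hwj : w j = ∑ k, (2 * Complex.I * a j k) • (Pi.single (k, 1) 1 : Fin N × Fin 2 → ℂ) := by
      ext ⟨q, c⟩
      fin_cases c
      · simp [hw]
      · simp [hw, Pi.single_apply]
    rw [hwj, map_sum, Finset.mul_sum]
    refine Finset.sum_congr rfl fun k _ => ?_
    rw [map_smul, mul_smul_comm]
    rfl
  have hexp : form11 a ^ N
      = ∑ s : Fin N → Fin N, (List.ofFn fun i => dz (s i) * ι ℂ (w (s i))).prod := by
    rw [hform, ← MultilinearMap.mkPiAlgebraFin_apply_const (R := ℂ) (n := N), MultilinearMap.map_sum]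
    simp
  have hterm : ∀ s : Fin N → Fin N,
      ExteriorAlgebra.liftAlternating (R := ℂ) (M := Fin N × Fin 2 → ℂ) (N := ℂ)
        (Pi.single (N * 2)
          ((Matrix.detRowAlternating (n := Fin N × Fin 2) (R := ℂ)).domDomCongr finProdFinEquiv))
        (List.ofFn fun i => dz (s i) * ι ℂ (w (s i))).prod
      = if Function.Injective s then (2 * Complex.I) ^ N * a.det else 0 := by
    intro s
    have h1 := liftAlternating_prod_pairs (Matrix.detRowAlternating (n := Fin N × Fin 2) (R := ℂ))
      (fun p => if p.2 = 0 then (Pi.single (s p.1, 0) 1 : Fin N × Fin 2 → ℂ) else w (s p.1))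
    simp only [if_true, one_ne_zero, if_false] at h1
    have h2 : (Matrix.detRowAlternating (n := Fin N × Fin 2) (R := ℂ))
        (fun p => if p.2 = 0 then (Pi.single (s p.1, 0) 1 : Fin N × Fin 2 → ℂ) else w (s p.1))
        = ((1 : Matrix (Fin N) (Fin N) ℂ).submatrix s id).det
          * (((2 * Complex.I) • a).submatrix s id).det := by
      rw [← det_interleave]
      refine congrArg Matrix.det ?_
      ext ⟨p, c⟩ ⟨q, c'⟩
      fin_cases c <;> fin_cases c' <;> simp [hw, Pi.single_apply, Matrix.one_apply, eq_comm]
    refine h1.trans (h2.trans ?_)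
    split_ifs with hs
    · let σ : Equiv.Perm (Fin N) := Equiv.ofBijective s (Finite.injective_iff_bijective.1 hs)
      have hσ : s = σ := rfl
      rw [hσ, Matrix.det_permute, Matrix.det_permute, Matrix.det_smul, Matrix.det_one, mul_one,
        Fintype.card_fin, ← mul_assoc]
      have : ((Equiv.Perm.sign σ : ℤ) : ℂ) * ((Equiv.Perm.sign σ : ℤ) : ℂ) = 1 := by
        rw [← Int.cast_mul, Int.units_coe_mul_self, Int.cast_one]
      rw [this, one_mul]
    · rw [Function.not_injective_iff] at hs
      obtain ⟨i, j, hij, hne⟩ := hs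
      rw [Matrix.det_zero_of_row_eq hne (congrArg (fun x k => (1 : Matrix (Fin N) (Fin N) ℂ) x k) hij), zero_mul]
  rw [topCoeff, LinearMap.smul_apply, hexp, map_sum, Finset.sum_congr rfl fun s _ => hterm s,
    ← Finset.sum_filter, Finset.sum_const, card_injective_self, nsmul_eq_mul, smul_eq_mul]
  push_cast
  have : (-2 * Complex.I) ^ N * (2 * Complex.I) ^ N = 4 ^ N := by
    rw [← mul_pow]
    congr 1
    ring_nf
    rw [Complex.I_sq]
    ring
  rw [← this]
  ring

end Forms

/-! ### The cones `Γ_k` as hyperbolicity cones -/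

section Cones

theorem MultilinearMap.continuous_of_matrix {N k : ℕ}
    (T : MultilinearMap ℂ (fun _ : Fin k => Matrix (Fin N) (Fin N) ℂ) ℂ) : Continuous T := by
  have h : ∀ v, T v = ∑ f : Fin k → Fin N × Fin N, (∏ i, v i (f i).1 (f i).2) *
      T fun i => Matrix.single (f i).1 (f i).2 1 := by
    intro v
    have hv : v = fun i => ∑ p : Fin N × Fin N, v i p.1 p.2 • Matrix.single p.1 p.2 (1 : ℂ) := by
      ext1 i
      conv_lhs => rw [Matrix.matrix_eq_sum_single (v i)]
      rw [Fintype.sum_prod_type]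
      simp
    conv_lhs => rw [hv]
    rw [MultilinearMap.map_sum]
    refine Finset.sum_congr rfl fun f _ => ?_
    rw [MultilinearMap.map_smul_univ, smul_eq_mul]
  rw [show (T : _ → ℂ) = _ from funext h]
  refine continuous_finsetSum _ fun f _ => (continuous_finsetProd _ fun i _ => ?_).mul
    continuous_const
  exact ((continuous_apply i).matrix_elem _ _)

/-- The real space of Hermitian matrices. -/
def hermitianSubmodule (N : ℕ) : Submodule ℝ (Matrix (Fin N) (Fin N) ℂ) where
  carrier := {a | a.IsHermitian}
  add_mem' ha hb := Matrix.IsHermitian.add ha hb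
  zero_mem' := Matrix.isHermitian_zero
  smul_mem' c a ha := by
    have ha' : aᴴ = a := ha
    change (c • a)ᴴ = c • a
    rw [Matrix.conjTranspose_smul, ha']
    simp

theorem polarForm_top {N : ℕ} (a : Matrix (Fin N) (Fin N) ℂ) :
    polarForm N N (fun _ => a) = (4 ^ N * N.factorial : ℝ) * a.det := by
  rw [polarForm_diag, Nat.sub_self, pow_zero, mul_one, topCoeff_form11_pow]

theorem Matrix.IsHermitian.im_eq_zero_of_det_add_smul {N : ℕ} {a : Matrix (Fin N) (Fin N) ℂ}
    (ha : a.IsHermitian) {t : ℂ} (h : (a + t • (1 : Matrix (Fin N) (Fin N) ℂ)).det = 0) :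
    t.im = 0 := by
  obtain ⟨v, hv, hv0⟩ := Matrix.exists_mulVec_eq_zero_iff.2 h
  have h1 : star v ⬝ᵥ (a *ᵥ v) + t * (star v ⬝ᵥ v) = 0 := by
    have := congrArg (fun x => star v ⬝ᵥ x) hv0
    simpa [Matrix.add_mulVec, Matrix.smul_mulVec, dotProduct_add, dotProduct_smul] using this
  have h2 : (star v ⬝ᵥ (a *ᵥ v)).im = 0 := ha.im_star_dotProduct_mulVec_self v
  have h3 : star v ⬝ᵥ v = ((∑ i, ‖v i‖ ^ 2 : ℝ) : ℂ) := by
    rw [dotProduct, Complex.ofReal_sum]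
    refine Finset.sum_congr rfl fun i _ => ?_
    rw [Pi.star_apply, Complex.star_def, mul_comm, Complex.mul_conj, Complex.normSq_eq_norm_sq]
  have h4 : 0 < ∑ i, ‖v i‖ ^ 2 := by
    obtain ⟨i, hi⟩ := Function.ne_iff.1 hv
    exact Finset.sum_pos' (fun i _ => by positivity) ⟨i, Finset.mem_univ i, by
      have : v i ≠ 0 := hi
      positivity⟩
  have h5 := congrArg Complex.im h1
  rw [h3, Complex.add_im, h2, mul_comm, Complex.im_ofReal_mul, zero_add, Complex.zero_im] at h5
  exact (mul_eq_zero.1 h5).resolve_left h4.ne'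

/-- For `k = N` the form is a positive multiple of the determinant, and Hermitian matrices have real
eigenvalues. Each decrease of `k` is a contraction with the identity, which preserves hyperbolicity.
-/
theorem isHyperbolic_polarForm {N k : ℕ} (hk : k ≤ N) :
    IsHyperbolic (hermitianSubmodule N) (polarForm N k) 1 := by
  induction hk using Nat.decreasingInduction with
  | self =>
    refine ⟨MultilinearMap.continuous_of_matrix _, polarForm_symm, Matrix.isHermitian_one,
      ⟨4 ^ N * N.factorial, by positivity, by simp [polarForm_top]⟩, fun x hx t ht => ?_⟩
    rw [polarForm_top] at ht
    refine Matrix.IsHermitian.im_eq_zero_of_det_add_smul hx ((mul_eq_zero.1 ht).resolve_left ?_)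
    have : (0 : ℝ) < 4 ^ N * N.factorial := by positivity
    exact_mod_cast this.ne'
  | of_succ k hk ih =>
    rw [← polarForm_curryLeft_one hk]
    exact ih.curryLeft

theorem polarForm_one_pos {N k : ℕ} (hk : k ≤ N) : 0 < (polarForm N k fun _ => 1).re := by
  obtain ⟨r, hr, h⟩ := (isHyperbolic_polarForm hk).pos
  rw [h]
  exact hr

theorem mem_gammaCone {N k : ℕ} {a : Matrix (Fin N) (Fin N) ℂ} :
    a ∈ gammaCone N k ↔ a.IsHermitian ∧
      ∀ l : ℕ, 1 ≤ l → l ≤ k → 0 ≤ (polarForm N l fun _ => a).re := by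
  simp only [gammaCone, volDensity_eq, polarForm_diag]
  rfl

theorem topCoeff_add_pow {N k : ℕ} (hk : k ≤ N) (a : Matrix (Fin N) (Fin N) ℂ) (t : ℂ) :
    polarForm N k (fun _ => a + t • (1 : Matrix (Fin N) (Fin N) ℂ))
      = ∑ l ∈ Finset.range (k + 1), (k.choose l) * t ^ (k - l) * polarForm N l (fun _ => a) := by
  have h1 : form11 (a + t • (1 : Matrix (Fin N) (Fin N) ℂ)) = form11 a + t • kahlerForm N := by
    rw [← form11Lin_apply, map_add, map_smul]
    rfl
  have hc : Commute (form11 a) (t • kahlerForm N) := (form11_commute a 1).smul_right t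
  rw [polarForm_diag, h1, hc.add_pow, Finset.sum_mul, map_sum]
  refine Finset.sum_congr rfl fun l hl => ?_
  have hl' : l ≤ k := by
    rw [Finset.mem_range] at hl
    omega
  have h2 : form11 a ^ l * (t • kahlerForm N) ^ (k - l) * (k.choose l : ConstForm N)
        * kahlerForm N ^ (N - k)
      = ((k.choose l) * t ^ (k - l) : ℂ) • (form11 a ^ l * kahlerForm N ^ (N - l)) := by
    have h3 : (k.choose l : ConstForm N) = ((k.choose l : ℂ)) • (1 : ConstForm N) := by
      rw [Nat.cast_smul_eq_nsmul, nsmul_eq_mul, mul_one]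
    rw [smul_pow, show N - l = (k - l) + (N - k) by omega, pow_add, h3]
    simp only [mul_smul_comm, smul_mul_assoc, mul_one, smul_smul, mul_assoc]
  rw [h2, map_smul, polarForm_diag, smul_eq_mul]

/-- The coefficients of `t ↦ (a + tβ)^k ∧ β^(N-k)` are positive multiples of the numbers in the
definition of `Γ_k`, with a positive leading one; if they are nonnegative, no positive root exists.
Conversely, Gårding's inequality with some slots equal to `a` and the others to `β` gives each
coefficient its sign. -/
theorem gammaCone_eq_closedCone {N k : ℕ} (hk : k ≤ N) :
    gammaCone N k = closedCone (hermitianSubmodule N) (polarForm N k) 1 := by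
  ext a
  rw [mem_gammaCone]
  constructor
  · rintro ⟨ha, hnn⟩
    refine ⟨ha, fun t ht h0 => ?_⟩
    rw [topCoeff_add_pow hk, Finset.sum_range_succ'] at h0
    have h1 := congrArg Complex.re h0
    rw [Complex.add_re, Complex.re_sum, Complex.zero_re] at h1
    have h2 : ∀ l : ℕ, ((k.choose l) * (t : ℂ) ^ (k - l) * polarForm N l (fun _ => a)).re
        = (k.choose l) * t ^ (k - l) * (polarForm N l fun _ => a).re := by
      intro l
      rw [← Complex.ofReal_natCast, ← Complex.ofReal_pow, ← Complex.ofReal_mul,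
        Complex.re_ofReal_mul]
    simp only [h2] at h1
    have h3 : (polarForm N 0 fun _ => a) = polarForm N 0 fun _ => 1 := by
      congr 1
      exact Subsingleton.elim _ _
    have h4 := polarForm_one_pos (Nat.zero_le N)
    have h5 : 0 ≤ ∑ l ∈ Finset.range k,
        (k.choose (l + 1) : ℝ) * t ^ (k - (l + 1)) * (polarForm N (l + 1) fun _ => a).re :=
      Finset.sum_nonneg fun l hl => mul_nonneg (by positivity)
        (hnn (l + 1) (by omega) (by rw [Finset.mem_range] at hl; omega))
    have h6 : 0 < (k.choose 0 : ℝ) * t ^ (k - 0) * (polarForm N 0 fun _ => a).re := by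
      rw [h3, Nat.choose_zero_right]
      positivity
    linarith
  · intro ha
    refine ⟨ha.1, fun l hl hlk => ?_⟩
    -- Pad the form of degree `l` with `j` copies of the identity, to raise its degree to `k`.
    have hstep : ∀ j : ℕ, l + j ≤ N →
        polarForm N l (fun _ => a) = polarForm N (l + j) (fun i => if (i : ℕ) < j then 1 else a) := by
      intro j
      induction j with
      | zero => intro _; simp
      | succ j ih =>
        intro hj
        rw [ih (by omega), ← polarForm_curryLeft_one (by omega : l + j + 1 ≤ N),
          MultilinearMap.curryLeft_apply]
        change _ = polarForm N (l + j + 1) _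
        congr 1
        ext1 i
        refine Fin.cases ?_ (fun i => ?_) i <;> simp
    obtain ⟨j, rfl⟩ := Nat.exists_eq_add_of_le hlk
    rw [hstep j hk]
    refine (isHyperbolic_polarForm hk).nonneg_of_forall_mem_closedCone _ fun i => ?_
    split_ifs
    · exact IsHyperbolic.openCone_subset_closedCone (isHyperbolic_polarForm hk).self_mem
    · exact ha

/-- Gårding's inequality for the cones `Γ_k`. -/
theorem polarForm_nonneg {N k : ℕ} (hk : k ≤ N) (v : Fin k → Matrix (Fin N) (Fin N) ℂ)
    (hv : ∀ i, v i ∈ gammaCone N k) : 0 ≤ (polarForm N k v).re := by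
  rw [gammaCone_eq_closedCone hk] at hv
  exact (isHyperbolic_polarForm hk).nonneg_of_forall_mem_closedCone v hv

/-- The cone `Γ_k` is self-polar with respect to the polar form. -/
theorem mem_gammaCone_of_forall {N k : ℕ} (hk : k + 1 ≤ N) {x : Matrix (Fin N) (Fin N) ℂ}
    (hx : x.IsHermitian)
    (h : ∀ a ∈ gammaCone N (k + 1), 0 ≤ (polarForm N (k + 1) (Fin.cons x fun _ => a)).re) :
    x ∈ gammaCone N (k + 1) := by
  rw [gammaCone_eq_closedCone hk] at h ⊢
  exact (isHyperbolic_polarForm hk).mem_closedCone_of_forall hx h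

open Polynomial in
/-- The forms `A^l ∧ β^(N-l)` are the coefficients of `det (X + A)`. -/
theorem charpoly_neg_coeff {N l : ℕ} (hl : l ≤ N) (a : Matrix (Fin N) (Fin N) ℂ) :
    (4 ^ N * N.factorial : ℝ) * (-a).charpoly.coeff (N - l)
      = N.choose l * polarForm N l (fun _ => a) := by
  have h : C ((4 ^ N * N.factorial : ℝ) : ℂ) * (-a).charpoly
      = ∑ l ∈ Finset.range (N + 1), C (N.choose l * polarForm N l (fun _ => a)) * X ^ (N - l) := by
    refine Polynomial.funext fun t => ?_
    have h1 : (-a).charpoly.eval t = (a + t • (1 : Matrix (Fin N) (Fin N) ℂ)).det := by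
      rw [Matrix.eval_charpoly]
      congr 1
      rw [sub_neg_eq_add, add_comm]
      congr 1
      ext i j
      simp [Matrix.scalar_apply, Matrix.diagonal_apply, Matrix.one_apply]
    rw [eval_mul, eval_C, h1, ← polarForm_top, topCoeff_add_pow le_rfl, eval_finsetSum]
    refine Finset.sum_congr rfl fun l _ => ?_
    simp
    ring
  have h2 := congrArg (fun p => p.coeff (N - l)) h
  simp only [coeff_C_mul, finsetSum_coeff, coeff_X_pow] at h2
  rw [h2, Finset.sum_eq_single l]
  · simp
  · intro j hj hne
    rw [Finset.mem_range] at hj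
    rw [if_neg (by omega), mul_zero]
  · intro h
    rw [Finset.mem_range] at h
    omega

/-- The coefficient of `X^(N-l)` in `det (X + a)` is the `l`-th elementary symmetric function of the
eigenvalues. In this form the condition can be compared between matrices of different sizes. -/
theorem mem_gammaCone_iff_coeff {N k : ℕ} (hk : k ≤ N) {a : Matrix (Fin N) (Fin N) ℂ} :
    a ∈ gammaCone N k ↔ a.IsHermitian ∧
      ∀ l : ℕ, 1 ≤ l → l ≤ k → 0 ≤ ((-a).charpoly.coeff (N - l)).re := by
  rw [mem_gammaCone]
  refine and_congr_right fun _ => forall_congr' fun l => forall₂_congr fun _ hl => ?_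
  have h := congrArg Complex.re (charpoly_neg_coeff (hl.trans hk) a)
  rw [Complex.re_ofReal_mul, ← Complex.ofReal_natCast, Complex.re_ofReal_mul] at h
  have h1 : (0 : ℝ) < 4 ^ N * N.factorial := by positivity
  have h2 : (0 : ℝ) < N.choose l := by exact_mod_cast Nat.choose_pos (hl.trans hk)
  rw [← mul_nonneg_iff_of_pos_left h2, ← h, mul_nonneg_iff_of_pos_left h1]

end Cones

/-! ### Congruences that map `Γ_m` into `Γ_n` -/

section ConeMaps

open Polynomial

/-- The products `K (H Kᴴ)` and `(H Kᴴ) K` have the same characteristic polynomial up to a power of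
`X`. -/
theorem charpoly_congr_coeff {M N l : ℕ} (hM : l ≤ M) (hN : l ≤ N)
    (K : Matrix (Fin N) (Fin M) ℂ) (H : Matrix (Fin M) (Fin M) ℂ) :
    (-(K * H * Kᴴ)).charpoly.coeff (N - l) = (-(H * (Kᴴ * K))).charpoly.coeff (M - l) := by
  have h := Matrix.charpoly_mul_comm' (-K) (H * Kᴴ)
  rw [Fintype.card_fin, Fintype.card_fin] at h
  have h1 := congrArg (fun p => p.coeff (M + (N - l))) h
  rw [add_comm M, coeff_X_pow_mul, show N - l + M = (M - l) + N by omega, coeff_X_pow_mul] at h1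
  rw [show -(K * H * Kᴴ) = -K * (H * Kᴴ) by rw [Matrix.neg_mul, Matrix.mul_assoc],
    show -(H * (Kᴴ * K)) = H * Kᴴ * -K by rw [Matrix.mul_neg, Matrix.mul_assoc], h1]

theorem smul_mem_gammaCone {N k : ℕ} {a : Matrix (Fin N) (Fin N) ℂ} (ha : a ∈ gammaCone N k)
    {c : ℝ} (hc : 0 ≤ c) : (c : ℂ) • a ∈ gammaCone N k := by
  rw [mem_gammaCone] at ha ⊢
  refine ⟨IsHyperbolic.smul_mem_real (R := hermitianSubmodule N) a ha.1 c, fun l h1 h2 => ?_⟩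
  rw [MultilinearMap.diag_smul, ← Complex.ofReal_pow, Complex.re_ofReal_mul]
  exact mul_nonneg (pow_nonneg hc l) (ha.2 l h1 h2)

/-- A multiple of a coisometry maps `Γ_m` into `Γ_m`. -/
theorem congr_mem_gammaCone {M N m : ℕ} (hM : m ≤ M) (hN : m ≤ N) {K : Matrix (Fin N) (Fin M) ℂ}
    {c : ℝ} (hc : 0 ≤ c) (hK : Kᴴ * K = (c : ℂ) • 1) {H : Matrix (Fin M) (Fin M) ℂ}
    (hH : H ∈ gammaCone M m) : K * H * Kᴴ ∈ gammaCone N m := by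
  have h := smul_mem_gammaCone hH hc
  rw [mem_gammaCone_iff_coeff hM] at h
  rw [mem_gammaCone_iff_coeff hN]
  refine ⟨Matrix.isHermitian_mul_mul_conjTranspose K hH.1, fun l h1 h2 => ?_⟩
  rw [charpoly_congr_coeff (h2.trans hM) (h2.trans hN), hK, Matrix.mul_smul, Matrix.mul_one]
  exact h.2 l h1 h2

theorem charpoly_neg_unitary_conj {M : ℕ} (U : Matrix.unitaryGroup (Fin M) ℂ) (d : Fin M → ℝ) :
    (-((U : Matrix (Fin M) (Fin M) ℂ) * Matrix.diagonal (fun i => (d i : ℂ))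
      * star (U : Matrix (Fin M) (Fin M) ℂ))).charpoly
      = (∏ i, (X + C (d i))).map Complex.ofRealHom := by
  rw [← Matrix.neg_mul, Matrix.charpoly_mul_comm, Matrix.mul_neg, ← Matrix.mul_assoc,
    Unitary.coe_star_mul_self, Matrix.one_mul, Matrix.diagonal_neg, Matrix.charpoly_diagonal,
    Polynomial.map_prod]
  refine Finset.prod_congr rfl fun i _ => ?_
  simp

/-- The vector with entries `1` on `T`, `-1/m` at `i₀`, and `0` elsewhere. -/
noncomputable def testVector {M : ℕ} (m : ℕ) (T : Finset (Fin M)) (i₀ : Fin M) (i : Fin M) : ℝ :=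
  if i ∈ T then 1 else if i = i₀ then -(1 / m) else 0

theorem prod_testVector {M m : ℕ} {T : Finset (Fin M)} (hT : T.card = m) {i₀ : Fin M}
    (hi₀ : i₀ ∉ T) (p : Fin M → ℝ) :
    ∏ i, (X + C (testVector m T i₀ i * p i))
      = (X - C (p i₀ / m)) * (∏ i ∈ T, (X + C (p i))) * X ^ (M - (m + 1)) := by
  rw [← Finset.prod_mul_prod_compl T, ← Finset.mul_prod_erase Tᶜ _ (Finset.mem_compl.2 hi₀)]
  have h1 : ∏ i ∈ T, (X + C (testVector m T i₀ i * p i)) = ∏ i ∈ T, (X + C (p i)) :=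
    Finset.prod_congr rfl fun i hi => by simp [testVector, hi]
  have h2 : ∏ i ∈ Tᶜ.erase i₀, (X + C (testVector m T i₀ i * p i))
      = ∏ _i ∈ Tᶜ.erase i₀, (X : ℝ[X]) :=
    Finset.prod_congr rfl fun i hi => by
      rw [Finset.mem_erase, Finset.mem_compl] at hi
      simp [testVector, hi.1, hi.2]
  have h3 : (X + C (testVector m T i₀ i₀ * p i₀) : ℝ[X]) = X - C (p i₀ / m) := by
    rw [testVector, if_neg hi₀, if_pos rfl, sub_eq_add_neg, ← C_neg]
    congr 2
    ring
  rw [h1, h2, h3, Finset.prod_const, Finset.card_erase_of_mem (Finset.mem_compl.2 hi₀),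
    Finset.card_compl, Fintype.card_fin, hT, Nat.sub_sub]
  ring

theorem coeff_prod_testVector {M m : ℕ} (hm : m < M) {T : Finset (Fin M)} (hT : T.card = m)
    {i₀ : Fin M} (hi₀ : i₀ ∉ T) (p : Fin M → ℝ) {j : ℕ} (hj : j ≤ m) :
    (∏ i, (X + C (testVector m T i₀ i * p i))).coeff (M - (m - j))
      = (∏ i ∈ T, (X + C (p i))).coeff j - p i₀ / m * (∏ i ∈ T, (X + C (p i))).coeff (j + 1) := by
  rw [prod_testVector hT hi₀, show M - (m - j) = (j + 1) + (M - (m + 1)) by omega,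
    coeff_mul_X_pow, sub_mul, coeff_sub, coeff_X_mul, coeff_C_mul]

/-- The first symmetric function that `Γ_m` does not control. Its sign is what rules out nonconstant
morphisms for `n > m`. -/
theorem coeff_zero_prod_testVector {M m : ℕ} {T : Finset (Fin M)} (hT : T.card = m)
    {i₀ : Fin M} (hi₀ : i₀ ∉ T) (p : Fin M → ℝ) :
    (∏ i, (X + C (testVector m T i₀ i * p i))).coeff (M - (m + 1))
      = - (p i₀ / m * (∏ i ∈ T, (X + C (p i))).coeff 0) := by
  have := coeff_mul_X_pow ((X - C (p i₀ / m)) * (∏ i ∈ T, (X + C (p i)))) (M - (m + 1)) 0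
  rw [zero_add] at this
  rw [prod_testVector hT hi₀, this, sub_mul, coeff_sub, coeff_X_mul_zero, coeff_C_mul, zero_sub]

/-- The numerical core: if `∏ (X + h_i p_i)` satisfies the inequalities of `Γ_m`, where `p` is
maximal at `i₀`, then `p` is constant on `T ∪ {i₀}`. -/
theorem eq_of_coeff_nonneg {M m : ℕ} (hm1 : 1 ≤ m) {T : Finset (Fin M)}
    (hT : T.card = m) {i₀ : Fin M} {p : Fin M → ℝ} (hp : ∀ i, 0 ≤ p i) (hmax : ∀ i, p i ≤ p i₀)
    (hp0 : 0 < p i₀)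
    (h : ∀ j < m, 0 ≤ (∏ i ∈ T, (X + C (p i))).coeff j
      - p i₀ / m * (∏ i ∈ T, (X + C (p i))).coeff (j + 1)) :
    0 < (∏ i ∈ T, (X + C (p i))).coeff 0 ∧ ∀ i ∈ T, p i = p i₀ := by
  set Q : ℝ[X] := ∏ i ∈ T, (X + C (p i)) with hQ
  have hmR : (0 : ℝ) < m := by exact_mod_cast hm1
  have hc : 0 < p i₀ / m := by positivity
  have hmonic : Q.Monic := monic_prod_of_monic _ _ fun i _ => monic_X_add_C _
  have hdeg : Q.natDegree = m := by
    rw [hQ, natDegree_prod_of_monic _ _ fun i _ => monic_X_add_C _]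
    simp [hT]
  -- The hypothesis bounds each coefficient below by a positive multiple of the next one; descend
  -- from the leading coefficient `1`.
  have hpos : ∀ k ≤ m, 0 < Q.coeff (m - k) := by
    intro k
    induction k with
    | zero =>
      intro _
      rw [Nat.sub_zero, ← hdeg, hmonic.coeff_natDegree]
      exact one_pos
    | succ k ih =>
      intro hk
      have h1 := ih (by omega)
      have h2 := h (m - (k + 1)) (by omega)
      rw [show m - (k + 1) + 1 = m - k by omega] at h2
      nlinarith
  have h0 : 0 < Q.coeff 0 := by simpa using hpos m le_rfl
  refine ⟨h0, ?_⟩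
  have hQ0 : Q.coeff 0 = ∏ i ∈ T, p i := by
    rw [coeff_zero_eq_eval_zero, hQ, eval_prod]
    simp
  have hpne : ∀ i ∈ T, 0 < p i := by
    intro i hi
    refine (hp i).lt_of_ne fun h => ?_
    rw [hQ0, Finset.prod_eq_zero hi h.symm] at h0
    exact lt_irrefl _ h0
  -- The logarithmic derivative of `Q` at `0`.
  have hQ1 : Q.coeff 1 = Q.coeff 0 * ∑ i ∈ T, 1 / p i := by
    have h1 : Q.coeff 1 = Q.derivative.eval 0 := by
      rw [← coeff_zero_eq_eval_zero, coeff_derivative]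
      simp
    rw [h1, hQ, derivative_prod_finset, eval_finsetSum, ← hQ, hQ0, Finset.mul_sum]
    refine Finset.sum_congr rfl fun i hi => ?_
    rw [← Finset.mul_prod_erase T p hi]
    have := (hpne i hi).ne'
    simp [eval_prod]
    field_simp
  have h1 := h 0 (by omega)
  rw [zero_add, hQ1] at h1
  -- The case `j = 0`. The sum has `m` terms `p i₀ / p i`, each at least `1` by maximality, so all
  -- of them equal `1`.
  have h2 : p i₀ * ∑ i ∈ T, 1 / p i ≤ m := by
    have : 0 ≤ Q.coeff 0 * (1 - p i₀ / m * ∑ i ∈ T, 1 / p i) := by linarith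
    have h3 := nonneg_of_mul_nonneg_right this h0
    rw [div_mul_eq_mul_div] at h3
    have h4 : p i₀ * ∑ i ∈ T, 1 / p i / 1 ≤ m := by
      simpa using (div_le_one hmR).1 (sub_nonneg.1 h3)
    simpa using h4
  rw [Finset.mul_sum] at h2
  have h3 : ∑ i ∈ T, (p i₀ * (1 / p i) - 1) ≤ 0 := by
    rw [Finset.sum_sub_distrib]
    simp only [Finset.sum_const, hT, nsmul_eq_mul, mul_one]
    linarith
  have h4 : ∀ i ∈ T, 0 ≤ p i₀ * (1 / p i) - 1 := by
    intro i hi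
    rw [mul_one_div, sub_nonneg, le_div_iff₀ (hpne i hi), one_mul]
    exact hmax i
  intro i hi
  have h5 := (Finset.sum_eq_zero_iff_of_nonneg h4).1 (le_antisymm h3 (Finset.sum_nonneg h4)) i hi
  have h6 := (hpne i hi).ne'
  field_simp at h5
  linarith

/-- The condition of order `l` reads `C(m, l-1)/m ≤ C(m, l)`. It is an equality for `l = m`, so
`-1/m` is the most negative entry that `m` ones can compensate. -/
theorem testVector_mem_gammaCone {M m : ℕ} (hm : m < M) (hm1 : 1 ≤ m) {T : Finset (Fin M)}
    (hT : T.card = m) {i₀ : Fin M} (hi₀ : i₀ ∉ T) (U : Matrix.unitaryGroup (Fin M) ℂ) :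
    (U : Matrix (Fin M) (Fin M) ℂ) * Matrix.diagonal (fun i => (testVector m T i₀ i : ℂ))
      * star (U : Matrix (Fin M) (Fin M) ℂ) ∈ gammaCone M m := by
  rw [mem_gammaCone_iff_coeff hm.le]
  refine ⟨?_, fun l h1 h2 => ?_⟩
  · refine Matrix.isHermitian_mul_mul_conjTranspose _ ?_
    rw [Matrix.IsHermitian, Matrix.diagonal_conjTranspose]
    congr 1
    ext i
    simp
  · have h3 := coeff_prod_testVector hm hT hi₀ (fun _ => 1) (Nat.sub_le m l)
    rw [show m - (m - l) = l by omega] at h3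
    simp only [mul_one, map_one, Finset.prod_const, hT, coeff_X_add_one_pow] at h3
    rw [charpoly_neg_unitary_conj, coeff_map, h3, Complex.ofRealHom_eq_coe, Complex.ofReal_re,
      sub_nonneg, one_div, inv_mul_le_iff₀ (by exact_mod_cast hm1)]
    have h4 := Nat.choose_succ_right_eq m (m - l)
    have h5 : m.choose (m - l + 1) ≤ m * m.choose (m - l) := by
      calc m.choose (m - l + 1) ≤ m.choose (m - l + 1) * (m - l + 1) :=
            Nat.le_mul_of_pos_right _ (by omega)
        _ = m.choose (m - l) * (m - (m - l)) := h4
        _ ≤ m.choose (m - l) * m := Nat.mul_le_mul_left _ (Nat.sub_le _ _)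
        _ = _ := mul_comm _ _
    exact_mod_cast h5

open scoped ComplexOrder in
/-- A linear map which carries `Γ_m` to `Γ_n` is a multiple of a coisometry. -/
theorem exists_smul_one_of_congr_mem {M N m n : ℕ} (hm1 : 1 ≤ m) (hmM : m < M) (hmn : m ≤ n)
    (hnN : n ≤ N) (K : Matrix (Fin N) (Fin M) ℂ)
    (hK : ∀ H ∈ gammaCone M m, K * H * Kᴴ ∈ gammaCone N n) :
    ∃ c : ℝ, Kᴴ * K = (c : ℂ) • 1 ∧ (m < n → c = 0) ∧ (N < M → c = 0) := by
  have hP : (Kᴴ * K).PosSemidef := Matrix.posSemidef_conjTranspose_mul_self K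
  set U := hP.isHermitian.eigenvectorUnitary
  set p := hP.isHermitian.eigenvalues with hpdef
  have hspec : Kᴴ * K = (U : Matrix (Fin M) (Fin M) ℂ) * Matrix.diagonal (fun i => (p i : ℂ))
      * star (U : Matrix (Fin M) (Fin M) ℂ) := hP.isHermitian.spectral_theorem
  have hp : ∀ i, 0 ≤ p i := hP.eigenvalues_nonneg
  have : Nonempty (Fin M) := ⟨⟨0, by omega⟩⟩
  obtain ⟨i₀, hmax⟩ := Finite.exists_max p
  -- `H` is taken diagonal in an eigenbasis of `Kᴴ K`, so `H Kᴴ K` has the eigenvalues `h_i p_i`.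
  have hcoef : ∀ T : Finset (Fin M), T.card = m → i₀ ∉ T → ∀ l : ℕ, 1 ≤ l → l ≤ n → l ≤ M →
      0 ≤ (∏ i, (X + C (testVector m T i₀ i * p i))).coeff (M - l) := by
    intro T hT hi₀ l h1 h2 h3
    have h4 := ((mem_gammaCone_iff_coeff hnN).1
      (hK _ (testVector_mem_gammaCone hmM hm1 hT hi₀ U))).2 l h1 h2
    rw [charpoly_congr_coeff h3 (h2.trans hnN), hspec] at h4
    have h5 : (U : Matrix (Fin M) (Fin M) ℂ) * Matrix.diagonal (fun i => (testVector m T i₀ i : ℂ))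
        * star (U : Matrix (Fin M) (Fin M) ℂ) * ((U : Matrix (Fin M) (Fin M) ℂ)
          * Matrix.diagonal (fun i => (p i : ℂ)) * star (U : Matrix (Fin M) (Fin M) ℂ))
        = (U : Matrix (Fin M) (Fin M) ℂ)
          * Matrix.diagonal (fun i => ((testVector m T i₀ i * p i : ℝ) : ℂ))
          * star (U : Matrix (Fin M) (Fin M) ℂ) := by
      have hU : star (U : Matrix (Fin M) (Fin M) ℂ) * (U : Matrix (Fin M) (Fin M) ℂ) = 1 :=
        Unitary.coe_star_mul_self U
      have hD : Matrix.diagonal (fun i => ((testVector m T i₀ i * p i : ℝ) : ℂ))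
          = Matrix.diagonal (fun i => (testVector m T i₀ i : ℂ))
            * Matrix.diagonal (fun i => (p i : ℂ)) := by
        rw [Matrix.diagonal_mul_diagonal]
        simp
      rw [hD]
      simp only [Matrix.mul_assoc]
      rw [← Matrix.mul_assoc (star (U : Matrix (Fin M) (Fin M) ℂ)) (U : Matrix (Fin M) (Fin M) ℂ),
        hU, Matrix.one_mul]
    rw [h5, charpoly_neg_unitary_conj, coeff_map, Complex.ofRealHom_eq_coe, Complex.ofReal_re] at h4
    exact h4
  have hcore : ∀ T : Finset (Fin M), T.card = m → i₀ ∉ T → 0 < p i₀ →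
      0 < (∏ i ∈ T, (X + C (p i))).coeff 0 ∧ ∀ i ∈ T, p i = p i₀ := by
    intro T hT hi₀ hp0
    refine eq_of_coeff_nonneg hm1 hT hp hmax hp0 fun j hj => ?_
    rw [← coeff_prod_testVector hmM hT hi₀ p hj.le]
    exact hcoef T hT hi₀ _ (by omega) (by omega) (by omega)
  have hall : ∀ i, p i = p i₀ := by
    intro i
    by_cases hi : i = i₀
    · rw [hi]
    rcases (hp i₀).eq_or_lt with h0 | h0
    · exact le_antisymm (hmax i) (h0 ▸ hp i)
    -- Since `m < M`, any given index other than `i₀` lies in an `m`-element set that avoids `i₀`.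
    obtain ⟨T, hT1, hT2, hT⟩ := Finset.exists_subsuperset_card_eq (s := {i})
      (t := Finset.univ.erase i₀) (n := m) (by simpa using hi) (by simpa using hm1)
      (by rw [Finset.card_erase_of_mem (Finset.mem_univ _), Finset.card_fin]; omega)
    exact (hcore T hT (fun h => by simpa using hT2 h) h0).2 i (by simpa using hT1)
  have hPc : Kᴴ * K = (p i₀ : ℂ) • 1 := by
    rw [hspec, show (fun i => (p i : ℂ)) = fun _ => (p i₀ : ℂ) from funext fun i => by rw [hall i],
      ← Matrix.smul_one_eq_diagonal, Matrix.mul_smul, Matrix.mul_one, Matrix.smul_mul,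
      Unitary.mul_star_self_of_mem U.2]
  refine ⟨p i₀, hPc, fun hlt => ?_, fun hlt => ?_⟩
  · by_contra hne
    have h0 : 0 < p i₀ := (hp i₀).lt_of_ne (Ne.symm hne)
    obtain ⟨T, hT2, hT⟩ := Finset.exists_subset_card_eq (s := Finset.univ.erase i₀) (n := m)
      (by rw [Finset.card_erase_of_mem (Finset.mem_univ _), Finset.card_fin]; omega)
    have hi₀ : i₀ ∉ T := fun h => by simpa using hT2 h
    -- For `m < n` the condition of order `m + 1` is available; it contradicts `p i₀ > 0`.
    have h1 := hcoef T hT hi₀ (m + 1) (by omega) (by omega) (by omega)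
    rw [coeff_zero_prod_testVector hT hi₀] at h1
    have h2 := (hcore T hT hi₀ h0).1
    have h3 : 0 < p i₀ / m := div_pos h0 (by exact_mod_cast hm1)
    have := mul_pos h3 h2
    linarith
  · by_contra hne
    have h1 : (Kᴴ * K).rank = M := by
      rw [hPc, Matrix.rank_of_isUnit]
      · simp
      · rw [Matrix.isUnit_iff_isUnit_det, Matrix.det_smul, Matrix.det_one, mul_one]
        exact (isUnit_iff_ne_zero.2 (by exact_mod_cast hne)).pow _
    have h2 : (Kᴴ * K).rank ≤ N := by
      refine (Matrix.rank_mul_le_right _ _).trans ?_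
      exact (Matrix.rank_le_card_height K).trans (by simp)
    omega

end ConeMaps

/-! ### Smoothness of holomorphic maps of several variables -/

section Holomorphic

open Metric Set

variable {E F : Type*} [NormedAddCommGroup E] [NormedSpace ℂ E] [FiniteDimensional ℂ E]
  [NormedAddCommGroup F] [NormedSpace ℂ F] [FiniteDimensional ℂ F]

/-- The directional derivatives of a holomorphic map of several variables are holomorphic. -/
theorem DifferentiableOn.fderiv_apply_complex {f : E → F} {Ω : Set E} (hΩ : IsOpen Ω)
    (hf : DifferentiableOn ℂ f Ω) (v : E) : DifferentiableOn ℂ (fun z => fderiv ℂ f z v) Ω := by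
  have : CompleteSpace F := FiniteDimensional.complete ℂ F
  have : CompleteSpace E := FiniteDimensional.complete ℂ E
  have : ProperSpace (E →L[ℂ] F) := FiniteDimensional.proper ℂ _
  borelize E
  borelize (E →L[ℂ] F)
  intro z₀ hz₀
  refine DifferentiableAt.differentiableWithinAt ?_
  have hc : ContinuousAt f z₀ := (hf.differentiableAt (hΩ.mem_nhds hz₀)).continuousAt
  obtain ⟨δ, hδ, hδΩ⟩ := Metric.mem_nhds_iff.1 (Filter.inter_mem (hΩ.mem_nhds hz₀)
    (hc.preimage_mem_nhds (ball_mem_nhds (f z₀) one_pos)))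
  set r := δ / 4 with hr
  have hr0 : 0 < r := by positivity
  have hball : ∀ z ∈ ball z₀ (2 * r), ball z (2 * r) ⊆ Ω ∩ f ⁻¹' ball (f z₀) 1 := by
    intro z hz
    refine (ball_subset_ball' ?_).trans hδΩ
    rw [mem_ball] at hz
    linarith
  -- Cauchy's estimate: `f` maps the ball of radius `2r` about `z` into a ball of radius `2`. This
  -- bound is the dominating function for differentiation under the integral.
  have hbound : ∀ z ∈ ball z₀ (2 * r), ‖fderiv ℂ f z‖ ≤ 1 / r := by
    intro z hz
    have h1 : DifferentiableOn ℂ f (ball z (2 * r)) := hf.mono fun x hx => (hball z hz hx).1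
    have hzz := (hball z hz (mem_ball_self (by positivity))).2
    have h2 : MapsTo f (ball z (2 * r)) (ball (f z) 2) := by
      intro x hx
      have hx' := (hball z hz hx).2
      rw [mem_preimage, mem_ball] at hx' hzz
      rw [mem_ball]
      have := dist_triangle_right (f x) (f z) (f z₀)
      linarith
    have h3 := Complex.norm_fderiv_le_div_of_mapsTo_ball h1 (h2.mono_right ball_subset_closedBall)
      (by positivity)
    refine h3.trans (le_of_eq ?_)
    field_simp
  have hdiff : ∀ z ∈ ball z₀ (2 * r), DifferentiableAt ℂ f z := fun z hz =>
    hf.differentiableAt (hΩ.mem_nhds (hball z hz (mem_ball_self (by positivity))).1)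
  set ρ := r / (‖v‖ + 1) with hρ
  have hρ0 : 0 < ρ := by positivity
  have hin : ∀ z ∈ ball z₀ r, ∀ w : ℂ, ‖w‖ ≤ ρ → z + w • v ∈ ball z₀ (2 * r) := by
    intro z hz w hw
    have h1 : ‖w • v‖ < r := by
      rw [norm_smul]
      calc ‖w‖ * ‖v‖ ≤ ρ * ‖v‖ := by gcongr
        _ < ρ * (‖v‖ + 1) := by
          have : 0 < ρ := hρ0
          nlinarith
        _ = r := by rw [hρ]; field_simp
    rw [mem_ball, dist_eq_norm] at hz ⊢
    calc ‖z + w • v - z₀‖ = ‖(z - z₀) + w • v‖ := by congr 1; abel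
      _ ≤ ‖z - z₀‖ + ‖w • v‖ := norm_add_le _ _
      _ < 2 * r := by linarith
  have hcm : ∀ θ : ℝ, ‖circleMap 0 ρ θ‖ ≤ ρ := fun θ => by simp [abs_of_pos hρ0]
  set k : ℝ → ℂ := fun θ => _root_.deriv (circleMap 0 ρ) θ * ((circleMap 0 ρ θ - 0) ^ 2)⁻¹ with hk
  have hkc : Continuous k := by
    have h1 : Continuous (_root_.deriv (circleMap 0 ρ)) := by
      rw [show _root_.deriv (circleMap 0 ρ) = fun θ => circleMap 0 ρ θ * Complex.I from
        funext fun θ => by simp]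
      fun_prop
    refine h1.mul (Continuous.inv₀ (by fun_prop) fun θ => ?_)
    simp [hρ0.ne']
  -- Cauchy's formula on the complex line through `z` in direction `v`. The parameter `z` enters
  -- only through `f`, so the integral can be differentiated once more in `z`.
  have hrep : ∀ z ∈ ball z₀ r, fderiv ℂ f z v = (2 * Real.pi * Complex.I : ℂ)⁻¹ •
      ∫ θ in (0 : ℝ)..2 * Real.pi, k θ • f (z + circleMap 0 ρ θ • v) := by
    intro z hz
    set U : Set ℂ := {w | z + w • v ∈ Ω}
    have hU : IsOpen U := hΩ.preimage (by fun_prop)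
    have hsub : closedBall (0 : ℂ) ρ ⊆ U := fun w hw =>
      (hball _ (hin z hz w (by simpa using hw)) (mem_ball_self (by positivity))).1
    have hφ : DifferentiableOn ℂ (fun w : ℂ => f (z + w • v)) U :=
      hf.comp (Differentiable.differentiableOn (by fun_prop)) fun w hw => hw
    have h1 := Complex.cderiv_eq_deriv hU hφ hρ0 hsub
    have h2 : _root_.deriv (fun w : ℂ => f (z + w • v)) 0 = fderiv ℂ f z v := by
      have h3 : HasDerivAt (fun w : ℂ => z + w • v) v 0 := by
        simpa using ((hasDerivAt_id (0 : ℂ)).smul_const v).const_add z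
      have h4 : HasFDerivAt f (fderiv ℂ f z) (z + (0 : ℂ) • v) := by
        rw [zero_smul, add_zero]
        exact (hdiff z (ball_subset_ball (by linarith) hz)).hasFDerivAt
      exact (h4.comp_hasDerivAt 0 h3).deriv
    rw [← h2, ← h1, Complex.cderiv, circleIntegral]
    simp only [hk, smul_smul]
  have hmem : ball z₀ r ∈ nhds z₀ := ball_mem_nhds z₀ hr0
  have hFc : ∀ z ∈ ball z₀ r, Continuous fun θ : ℝ => k θ • f (z + circleMap 0 ρ θ • v) := by
    intro z hz
    refine hkc.smul (continuous_iff_continuousAt.2 fun θ => ?_)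
    exact ContinuousAt.comp (f := fun θ : ℝ => z + circleMap 0 ρ θ • v)
      (hdiff _ (hin z hz _ (hcm θ))).continuousAt
      (by fun_prop)
  have hder := intervalIntegral.hasFDerivAt_integral_of_dominated_of_fderiv_le (𝕜 := ℂ)
    (μ := volume) (a := 0) (b := 2 * Real.pi) (s := ball z₀ r) (x₀ := z₀)
    (F := fun z θ => k θ • f (z + circleMap 0 ρ θ • v))
    (F' := fun z θ => k θ • fderiv ℂ f (z + circleMap 0 ρ θ • v))
    (bound := fun θ => ‖k θ‖ * (1 / r)) hmem ?_ ?_ ?_ ?_ ?_ ?_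
  · refine ((hder.differentiableAt.const_smul
      ((2 * Real.pi * Complex.I : ℂ)⁻¹)).congr_of_eventuallyEq ?_)
    filter_upwards [hmem] with z hz using hrep z hz
  · filter_upwards [hmem] with z hz
    exact (hFc z hz).aestronglyMeasurable
  · exact (hFc z₀ (mem_ball_self hr0)).intervalIntegrable _ _
  · refine hkc.aestronglyMeasurable.smul ?_
    refine (Measurable.stronglyMeasurable ?_).aestronglyMeasurable
    exact (measurable_fderiv ℂ f).comp (Continuous.measurable (by fun_prop))
  · refine Filter.Eventually.of_forall fun θ _ z hz => ?_
    rw [norm_smul]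
    gcongr
    exact hbound _ (hin z hz _ (hcm θ))
  · exact (hkc.norm.mul continuous_const).intervalIntegrable _ _
  · refine Filter.Eventually.of_forall fun θ _ z hz => ?_
    have h1 : HasFDerivAt f (fderiv ℂ f (z + circleMap 0 ρ θ • v)) (z + circleMap 0 ρ θ • v) :=
      (hdiff _ (hin z hz _ (hcm θ))).hasFDerivAt
    have h2 : HasFDerivAt (fun z : E => z + circleMap 0 ρ θ • v) (ContinuousLinearMap.id ℂ E) z :=
      (hasFDerivAt_id z).add_const _
    exact (h1.comp z h2).const_smul (k θ)

theorem DifferentiableOn.contDiffOn_complex {f : E → F} {Ω : Set E} (hΩ : IsOpen Ω)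
    (hf : DifferentiableOn ℂ f Ω) : ContDiffOn ℂ ∞ f Ω := by
  refine contDiffOn_infty.2 fun n => ?_
  induction n generalizing f with
  | zero => exact contDiffOn_zero.2 hf.continuousOn
  | succ n ih =>
    push_cast
    rw [contDiffOn_succ_iff_fderiv_apply hΩ.uniqueDiffOn]
    refine ⟨hf, fun h => absurd h (by exact_mod_cast WithTop.coe_ne_top), fun y => ?_⟩
    refine (ih (hf.fderiv_apply_complex hΩ y)).congr fun z hz => ?_
    rw [fderivWithin_of_isOpen hΩ hz]

end Holomorphic

/-! ### Rigidity of orthogonal gradients of equal length -/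

section Rigidity

open scoped ComplexConjugate

variable {E : Type*} [NormedAddCommGroup E] [NormedSpace ℂ E]

theorem DifferentiableOn.hasDerivAt_line {P : E → ℂ} {Ω : Set E} (hΩ : IsOpen Ω)
    (hP : DifferentiableOn ℂ P Ω) {z : E} (hz : z ∈ Ω) (w : E) :
    HasDerivAt (fun t : ℝ => P (z + (t : ℂ) • w)) (fderiv ℂ P z w) 0 := by
  have h1 : HasDerivAt (fun t : ℂ => z + t • w) w ((0 : ℝ) : ℂ) := by
    simpa using ((hasDerivAt_id ((0 : ℝ) : ℂ)).smul_const w).const_add z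
  have h2 : HasFDerivAt P (fderiv ℂ P z) (z + (((0 : ℝ) : ℂ)) • w) := by
    rw [Complex.ofReal_zero, zero_smul, add_zero]
    exact (hP.differentiableAt (hΩ.mem_nhds hz)).hasFDerivAt
  exact (h2.comp_hasDerivAt _ h1).comp_ofReal

theorem sum_mul_conj_deriv {ι : Type*} [Fintype ι] {P Q : ι → E → ℂ} {Ω : Set E} (hΩ : IsOpen Ω)
    (hP : ∀ i, DifferentiableOn ℂ (P i) Ω) (hQ : ∀ i, DifferentiableOn ℂ (Q i) Ω)
    (h : ∀ z ∈ Ω, ∑ i, P i z * conj (Q i z) = 0) {z : E} (hz : z ∈ Ω) (w : E) :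
    ∑ i, fderiv ℂ (P i) z w * conj (Q i z) + ∑ i, P i z * conj (fderiv ℂ (Q i) z w) = 0 := by
  have h1 : HasDerivAt (fun t : ℝ => ∑ i, P i (z + (t : ℂ) • w) * conj (Q i (z + (t : ℂ) • w)))
      (∑ i, (fderiv ℂ (P i) z w * conj (Q i z) + P i z * conj (fderiv ℂ (Q i) z w))) 0 := by
    refine HasDerivAt.fun_sum fun i _ => ?_
    have h2 := ((hP i).hasDerivAt_line hΩ hz w)
    have h3 := ((hQ i).hasDerivAt_line hΩ hz w).star
    simpa using h2.fun_mul h3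
  have hev : ∀ᶠ t : ℝ in nhds 0, ∑ i, P i (z + (t : ℂ) • w) * conj (Q i (z + (t : ℂ) • w)) = 0 := by
    have hc : Continuous fun t : ℝ => z + (t : ℂ) • w := by
      have := Complex.continuous_ofReal
      fun_prop
    have hmem : ∀ᶠ t : ℝ in nhds 0, z + (t : ℂ) • w ∈ Ω :=
      hc.continuousAt.preimage_mem_nhds (hΩ.mem_nhds (by simpa using hz))
    filter_upwards [hmem] with t ht using h _ ht
  have h5 := (h1.congr_of_eventuallyEq (hev.mono fun t ht => ht.symm) :
    HasDerivAt (fun _ : ℝ => (0 : ℂ)) _ 0)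
  rw [← Finset.sum_add_distrib]
  exact h5.unique (hasDerivAt_const _ _)

/-- The antiholomorphic derivative of a vanishing sum `∑ P_i conj(Q_i)`. -/
theorem sum_mul_conj_deriv_right {ι : Type*} [Fintype ι] {P Q : ι → E → ℂ} {Ω : Set E}
    (hΩ : IsOpen Ω) (hP : ∀ i, DifferentiableOn ℂ (P i) Ω) (hQ : ∀ i, DifferentiableOn ℂ (Q i) Ω)
    (h : ∀ z ∈ Ω, ∑ i, P i z * conj (Q i z) = 0) {z : E} (hz : z ∈ Ω) (w : E) :
    ∑ i, P i z * conj (fderiv ℂ (Q i) z w) = 0 := by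
  have h1 := sum_mul_conj_deriv hΩ hP hQ h hz w
  -- Replacing `w` by `iw` multiplies the holomorphic part by `i` and the antiholomorphic part by
  -- `-i`, which separates the two.
  have h2 := sum_mul_conj_deriv hΩ hP hQ h hz (Complex.I • w)
  simp only [map_smul, smul_eq_mul, map_mul, Complex.conj_I, mul_assoc,
    mul_left_comm _ (-Complex.I) _, ← Finset.mul_sum] at h2
  have h3 : Complex.I * (2 * ∑ i, P i z * conj (fderiv ℂ (Q i) z w)) = 0 := by
    linear_combination Complex.I * h1 - h2
  simpa using h3

/-- The holomorphic derivative of a vanishing sum `∑ P_i conj(Q_i)`. -/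
theorem sum_mul_conj_deriv_left {ι : Type*} [Fintype ι] {P Q : ι → E → ℂ} {Ω : Set E}
    (hΩ : IsOpen Ω) (hP : ∀ i, DifferentiableOn ℂ (P i) Ω) (hQ : ∀ i, DifferentiableOn ℂ (Q i) Ω)
    (h : ∀ z ∈ Ω, ∑ i, P i z * conj (Q i z) = 0) {z : E} (hz : z ∈ Ω) (w : E) :
    ∑ i, fderiv ℂ (P i) z w * conj (Q i z) = 0 := by
  have h1 := sum_mul_conj_deriv hΩ hP hQ h hz w
  rwa [sum_mul_conj_deriv_right hΩ hP hQ h hz w, add_zero] at h1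

theorem sum_mul_conj_eq_deriv_right {ι : Type*} [Fintype ι] {P Q P' Q' : ι → E → ℂ} {Ω : Set E}
    (hΩ : IsOpen Ω) (hP : ∀ i, DifferentiableOn ℂ (P i) Ω) (hQ : ∀ i, DifferentiableOn ℂ (Q i) Ω)
    (hP' : ∀ i, DifferentiableOn ℂ (P' i) Ω) (hQ' : ∀ i, DifferentiableOn ℂ (Q' i) Ω)
    (h : ∀ z ∈ Ω, ∑ i, P i z * conj (Q i z) = ∑ i, P' i z * conj (Q' i z)) {z : E} (hz : z ∈ Ω)
    (w : E) : ∑ i, P i z * conj (fderiv ℂ (Q i) z w)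
      = ∑ i, P' i z * conj (fderiv ℂ (Q' i) z w) := by
  -- The difference of the two sums is a single vanishing sum over `ι ⊕ ι`.
  have h1 := sum_mul_conj_deriv_right (ι := ι ⊕ ι) hΩ (P := Sum.elim P fun i => -P' i)
    (Q := Sum.elim Q Q') (by rintro (i | i); exacts [hP i, (hP' i).neg])
    (by rintro (i | i); exacts [hQ i, hQ' i]) (fun z hz => by
      simp only [Fintype.sum_sum_type, Sum.elim_inl, Sum.elim_inr, Pi.neg_apply, neg_mul,
        Finset.sum_neg_distrib, h z hz, add_neg_cancel]) hz w
  simp only [Fintype.sum_sum_type, Sum.elim_inl, Sum.elim_inr, Pi.neg_apply, neg_mul,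
    Finset.sum_neg_distrib] at h1
  linear_combination h1

theorem sum_mul_conj_eq_deriv_left {ι : Type*} [Fintype ι] {P Q P' Q' : ι → E → ℂ} {Ω : Set E}
    (hΩ : IsOpen Ω) (hP : ∀ i, DifferentiableOn ℂ (P i) Ω) (hQ : ∀ i, DifferentiableOn ℂ (Q i) Ω)
    (hP' : ∀ i, DifferentiableOn ℂ (P' i) Ω) (hQ' : ∀ i, DifferentiableOn ℂ (Q' i) Ω)
    (h : ∀ z ∈ Ω, ∑ i, P i z * conj (Q i z) = ∑ i, P' i z * conj (Q' i z)) {z : E} (hz : z ∈ Ω)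
    (w : E) : ∑ i, fderiv ℂ (P i) z w * conj (Q i z)
      = ∑ i, fderiv ℂ (P' i) z w * conj (Q' i z) := by
  have h1 := sum_mul_conj_eq_deriv_right hΩ hQ hP hQ' hP' (fun z hz => by
    have := congrArg conj (h z hz)
    simpa [mul_comm] using this) hz w
  have := congrArg conj h1
  simpa [mul_comm] using this

theorem sum_mul_conj_self_eq_zero {ι : Type*} [Fintype ι] {a : ι → ℂ}
    (h : ∑ i, a i * conj (a i) = 0) (i : ι) : a i = 0 := by
  simp only [Complex.mul_conj, ← Complex.ofReal_sum] at h
  have h1 := (Finset.sum_eq_zero_iff_of_nonneg fun i _ => Complex.normSq_nonneg _).1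
    (Complex.ofReal_eq_zero.1 h) i (Finset.mem_univ i)
  exact Complex.normSq_eq_zero.1 h1

theorem sum_mul_sum_sum {ι R : Type*} [Fintype ι] [CommRing R] (h h' : ι → ι → R) (u v : ι → R) :
    ∑ k, (∑ j, (∑ i, h i j * h' i k) * u j) * v k
      = ∑ i, (∑ j, h i j * u j) * ∑ k, h' i k * v k := by
  simp only [Finset.sum_mul, Finset.mul_sum]
  rw [Finset.sum_comm]
  refine (Finset.sum_congr rfl fun j _ => Finset.sum_comm).trans ?_
  rw [Finset.sum_comm]
  refine Finset.sum_congr rfl fun i _ => ?_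
  rw [Finset.sum_comm]
  refine Finset.sum_congr rfl fun j _ => Finset.sum_congr rfl fun k _ => ?_
  ring

theorem fderiv_fderiv_apply_comm [FiniteDimensional ℂ E] {f : E → ℂ} {Ω : Set E} (hΩ : IsOpen Ω)
    (hf : DifferentiableOn ℂ f Ω) {z : E} (hz : z ∈ Ω) (v w : E) :
    fderiv ℂ (fun x => fderiv ℂ f x v) z w = fderiv ℂ (fun x => fderiv ℂ f x w) z v := by
  have hc : ContDiffAt ℂ ∞ f z := (hf.contDiffOn_complex hΩ).contDiffAt (hΩ.mem_nhds hz)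
  have hd : DifferentiableAt ℂ (fderiv ℂ f) z :=
    (hc.fderiv_right (m := 1) (WithTop.coe_le_coe.2 le_top)).differentiableAt one_ne_zero
  have happ : ∀ v w, fderiv ℂ (fun x => fderiv ℂ f x v) z w = fderiv ℂ (fderiv ℂ f) z w v := by
    intro v w
    rw [fderiv_clm_apply hd (differentiableAt_const v)]
    simp
  rw [happ, happ]
  exact (hc.isSymmSndFDerivAt (by
    rw [minSmoothness_of_isRCLikeNormedField]
    exact WithTop.coe_le_coe.2 le_top)).eq w v

/-- A holomorphic map into a space of dimension at least `2` whose component gradients are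
pairwise orthogonal and of the same length has vanishing second derivatives. -/
theorem fderiv_fderiv_eq_zero_of_orthogonal {N M : ℕ} (hM : 1 < M) (f : Fin M → CSpace N → ℂ)
    {Ω : Set (CSpace N)} (hΩ : IsOpen Ω) (hf : ∀ a, DifferentiableOn ℂ (f a) Ω)
    (horth : ∀ z ∈ Ω, ∀ a b, a ≠ b → ∑ i, fderiv ℂ (f a) z (EuclideanSpace.single i 1)
      * conj (fderiv ℂ (f b) z (EuclideanSpace.single i 1)) = 0)
    (hnorm : ∀ z ∈ Ω, ∀ a b, ∑ i, fderiv ℂ (f a) z (EuclideanSpace.single i 1)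
        * conj (fderiv ℂ (f a) z (EuclideanSpace.single i 1))
      = ∑ i, fderiv ℂ (f b) z (EuclideanSpace.single i 1)
        * conj (fderiv ℂ (f b) z (EuclideanSpace.single i 1)))
    {z : CSpace N} (hz : z ∈ Ω) (a : Fin M) (i j : Fin N) :
    fderiv ℂ (fun x => fderiv ℂ (f a) x (EuclideanSpace.single i 1)) z
      (EuclideanSpace.single j 1) = 0 := by
  set e : Fin N → CSpace N := fun i => EuclideanSpace.single i 1
  set g : Fin M → Fin N → CSpace N → ℂ := fun a i z => fderiv ℂ (f a) z (e i) with hg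
  set H : Fin M → Fin N → Fin N → CSpace N → ℂ := fun a i j z => fderiv ℂ (g a i) z (e j) with hH
  have gd : ∀ a i, DifferentiableOn ℂ (g a i) Ω := fun a i => (hf a).fderiv_apply_complex hΩ (e i)
  have Hd : ∀ a i j, DifferentiableOn ℂ (H a i j) Ω :=
    fun a i j => (gd a i).fderiv_apply_complex hΩ (e j)
  have Hsymm : ∀ a i j, ∀ z ∈ Ω, H a i j z = H a j i z :=
    fun a i j z hz => fderiv_fderiv_apply_comm hΩ (hf a) hz (e i) (e j)
  have h2 : ∀ z ∈ Ω, ∀ a b, a ≠ b → ∀ j, ∑ i, H a i j z * conj (g b i z) = 0 :=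
    fun z hz a b hab j => sum_mul_conj_deriv_left hΩ (gd a) (gd b)
      (fun z hz => horth z hz a b hab) hz (e j)
  have h2' : ∀ z ∈ Ω, ∀ a b, ∀ j, ∑ i, H a i j z * conj (g a i z) = ∑ i, H b i j z * conj (g b i z) :=
    fun z hz a b j => sum_mul_conj_eq_deriv_left hΩ (gd a) (gd a) (gd b) (gd b)
      (fun z hz => hnorm z hz a b) hz (e j)
  have h3 : ∀ z ∈ Ω, ∀ a b, a ≠ b → ∀ j k, ∑ i, H a i j z * conj (H b i k z) = 0 :=
    fun z hz a b hab j k => sum_mul_conj_deriv_right hΩ (fun i => Hd a i j) (gd b)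
      (fun z hz => h2 z hz a b hab j) hz (e k)
  have h3' : ∀ z ∈ Ω, ∀ a b, ∀ j k,
      ∑ i, H a i j z * conj (H a i k z) = ∑ i, H b i j z * conj (H b i k z) :=
    fun z hz a b j k => sum_mul_conj_eq_deriv_right hΩ (fun i => Hd a i j) (gd a)
      (fun i => Hd b i j) (gd b) (fun z hz => h2' z hz a b j) hz (e k)
  have hex : ∀ c : Fin M, ∃ a, a ≠ c := by
    intro c
    have : Nontrivial (Fin M) := Fin.nontrivial_iff_two_le.2 hM
    exact exists_ne c
  -- the second derivatives vanish on pairs of gradients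
  have h4 : ∀ z ∈ Ω, ∀ a b c, ∑ p : Fin N × Fin N, H a p.1 p.2 z * conj (g b p.1 z * g c p.2 z) = 0 := by
    intro z hz a b c
    have hL : ∀ a b c, ∑ p : Fin N × Fin N, H a p.1 p.2 z * conj (g b p.1 z * g c p.2 z)
        = ∑ j, (∑ i, H a i j z * conj (g b i z)) * conj (g c j z) := by
      intro a b c
      rw [Fintype.sum_prod_type_right]
      simp only [Finset.sum_mul, map_mul, mul_assoc]
    have hsw : ∀ a b c, ∑ p : Fin N × Fin N, H a p.1 p.2 z * conj (g b p.1 z * g c p.2 z)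
        = ∑ p : Fin N × Fin N, H a p.1 p.2 z * conj (g c p.1 z * g b p.2 z) := by
      intro a b c
      rw [← Equiv.sum_comp (Equiv.prodComm _ _)]
      refine Finset.sum_congr rfl fun p _ => ?_
      simp only [Equiv.prodComm_apply, Prod.fst_swap, Prod.snd_swap]
      rw [Hsymm a _ _ z hz, mul_comm (g b p.2 z)]
    have hne : ∀ a b c, a ≠ b →
        ∑ p : Fin N × Fin N, H a p.1 p.2 z * conj (g b p.1 z * g c p.2 z) = 0 := by
      intro a b c hab
      rw [hL]
      exact Finset.sum_eq_zero fun j _ => by rw [h2 z hz a b hab j, zero_mul]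
    -- For `a ≠ b` the inner sum is zero. For `a = b` the equal lengths allow the common index to be
    -- changed to some `a' ≠ c`, and the symmetry of second derivatives then exchanges the two
    -- gradients.
    by_cases hab : a = b
    · subst hab
      obtain ⟨a', ha'⟩ := hex c
      rw [hL]
      simp only [h2' z hz a a']
      rw [← hL, hsw]
      exact hne a' c a' ha'
    · exact hne a b c hab
  -- By equal lengths `a` may be replaced by some `b ≠ c`. The `z̄_k`-derivative of `h4` has two
  -- terms, and the one that pairs the Hessians of `b` and `c` vanishes by `h3`.
  have h5 : ∀ z ∈ Ω, ∀ a c k, ∑ j, (∑ i, H a i j z * conj (H a i k z)) * conj (g c j z) = 0 := by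
    intro z hz a c k
    obtain ⟨b, hb⟩ := hex c
    simp only [h3' z hz a b]
    have h6 := sum_mul_conj_deriv_right hΩ (P := fun p : Fin N × Fin N => H b p.1 p.2)
      (Q := fun p z => g b p.1 z * g c p.2 z) (fun p => Hd b p.1 p.2)
      (fun p => (gd b p.1).mul (gd c p.2)) (fun z hz => h4 z hz b b c) hz (e k)
    have h7 : ∀ p : Fin N × Fin N, fderiv ℂ (fun z => g b p.1 z * g c p.2 z) z (e k)
        = g b p.1 z * H c p.2 k z + H b p.1 k z * g c p.2 z := by
      intro p
      rw [fderiv_fun_mul ((gd b p.1).differentiableAt (hΩ.mem_nhds hz))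
        ((gd c p.2).differentiableAt (hΩ.mem_nhds hz))]
      simp only [add_apply, smul_apply, smul_eq_mul, hH]
      ring
    simp only [h7, map_add, mul_add, Finset.sum_add_distrib] at h6
    have h8 : ∑ p : Fin N × Fin N, H b p.1 p.2 z * conj (g b p.1 z * H c p.2 k z) = 0 := by
      rw [Fintype.sum_prod_type]
      refine Finset.sum_eq_zero fun i _ => ?_
      have h9 := h3 z hz b c hb i k
      calc ∑ j, H b i j z * conj (g b i z * H c j k z)
          = conj (g b i z) * ∑ j, H b j i z * conj (H c j k z) := by
            rw [Finset.mul_sum]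
            refine Finset.sum_congr rfl fun j _ => ?_
            rw [Hsymm b i j z hz, map_mul]
            ring
        _ = 0 := by rw [h9, mul_zero]
    rw [h8, zero_add, Fintype.sum_prod_type_right] at h6
    simpa only [Finset.sum_mul, map_mul, mul_assoc] using h6
  have h6 : ∀ z ∈ Ω, ∀ a c i, ∑ j, H a i j z * conj (g c j z) = 0 := by
    intro z hz a c
    refine sum_mul_conj_self_eq_zero ?_
    -- Contracting `h5` with the gradient of `c` gives a sum of squares `∑_i |∑_j H_ij conj(g_j)|²`.
    have h7 : ∑ k, (∑ j, (∑ i, H a i j z * conj (H a i k z)) * conj (g c j z)) * g c k z = 0 :=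
      Finset.sum_eq_zero fun k _ => by rw [h5 z hz a c k, zero_mul]
    rw [← h7]
    rw [sum_mul_sum_sum]
    simp only [map_sum, map_mul, Complex.conj_conj]
  -- One more `z̄`-derivative; with `k = i` and symmetry this is `∑_j |H_ij|² = 0`.
  have h7 : ∀ k, ∑ j, H a i j z * conj (H a j k z) = 0 := fun k =>
    sum_mul_conj_deriv_right hΩ (fun j => Hd a i j) (gd a) (fun z hz => h6 z hz a a i) hz (e k)
  have h8 := h7 i
  have h9 : ∑ j, H a i j z * conj (H a i j z) = 0 := by
    rw [← h8]
    exact Finset.sum_congr rfl fun j _ => by rw [Hsymm a j i z hz]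
  exact sum_mul_conj_self_eq_zero h9 j

end Rigidity

/-! ### Complex Hessians, Levi forms and integration by parts -/

section Hessian

open scoped ComplexConjugate

/-- The second directional derivative `∂_a ∂_b χ`. -/
noncomputable def hess {E : Type*} [NormedAddCommGroup E] [NormedSpace ℝ E] (χ : E → ℝ) (z a b : E) :
    ℝ := fderiv ℝ (fun w => fderiv ℝ χ w b) z a

/-- The Levi form `∂_a ∂̄_b χ`. -/
noncomputable def leviForm {N : ℕ} (χ : CSpace N → ℝ) (z a b : CSpace N) : ℂ :=
  (((hess χ z a b + hess χ z (Complex.I • a) (Complex.I • b) : ℝ) : ℂ)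
    + Complex.I * ((hess χ z a (Complex.I • b) - hess χ z (Complex.I • a) b : ℝ) : ℂ)) / 4

section Real

variable {E : Type*} [NormedAddCommGroup E] [NormedSpace ℝ E]

theorem ContDiffAt.differentiableAt_fderiv {χ : E → ℝ} {z : E} (h : ContDiffAt ℝ 2 χ z) :
    DifferentiableAt ℝ (fderiv ℝ χ) z :=
  (h.fderiv_right (m := 1) (by norm_num)).differentiableAt one_ne_zero

theorem ContDiffAt.hess_eq {χ : E → ℝ} {z : E} (h : ContDiffAt ℝ 2 χ z) (a b : E) :
    hess χ z a b = fderiv ℝ (fderiv ℝ χ) z a b := by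
  rw [hess, fderiv_clm_apply h.differentiableAt_fderiv (differentiableAt_const b)]
  simp

theorem ContDiffAt.hess_comm {χ : E → ℝ} {z : E} (h : ContDiffAt ℝ 2 χ z) (a b : E) :
    hess χ z a b = hess χ z b a := by
  rw [h.hess_eq, h.hess_eq]
  exact (h.isSymmSndFDerivAt (by simp)).eq a b

theorem ContDiff.continuous_hess {χ : E → ℝ} (h : ContDiff ℝ 2 χ) (a b : E) :
    Continuous fun z => hess χ z a b := by
  have h1 : ContDiff ℝ 1 (fun w => fderiv ℝ χ w b) :=
    (h.fderiv_right (m := 1) (by norm_num)).clm_apply contDiff_const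
  exact (h1.continuous_fderiv one_ne_zero).clm_apply continuous_const

theorem tsupport_hess_subset (χ : E → ℝ) (a b : E) :
    tsupport (fun z => hess χ z a b) ⊆ tsupport χ :=
  (tsupport_fderiv_apply_subset ℝ a).trans (tsupport_fderiv_apply_subset ℝ b)

theorem HasCompactSupport.hess {χ : E → ℝ} (h : HasCompactSupport χ) (a b : E) :
    HasCompactSupport fun z => hess χ z a b :=
  (h.fderiv_apply ℝ b).fderiv_apply ℝ a

theorem hess_comp_affine {E' : Type*} [NormedAddCommGroup E'] [NormedSpace ℝ E'] {χ : E → ℝ}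
    (h : ContDiff ℝ 2 χ) (R : E' →L[ℝ] E) (k : E) (w a b : E') :
    hess (fun w => χ (R w + k)) w a b = hess χ (R w + k) (R a) (R b) := by
  have h1 : ∀ w, HasFDerivAt (fun w => R w + k) R w := fun w => R.hasFDerivAt.add_const k
  have h2 : (fun w => fderiv ℝ (fun w => χ (R w + k)) w b)
      = fun w => fderiv ℝ χ (R w + k) (R b) := by
    ext w
    have h3 := (h.differentiable (by norm_num) (R w + k)).hasFDerivAt.comp w (h1 w)
    exact congrArg (fun L => L b) h3.fderiv
  have hd : Differentiable ℝ fun z => fderiv ℝ χ z (R b) :=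
    ((h.fderiv_right (m := 1) (by norm_num)).clm_apply contDiff_const).differentiable one_ne_zero
  have h4 := (hd (R w + k)).hasFDerivAt.comp w (h1 w)
  rw [hess, h2]
  exact congrArg (fun L => L a) h4.fderiv

theorem ContDiffOn.differentiableAt_fderiv_apply {G : E → ℝ} {Ω : Set E} (hΩ : IsOpen Ω)
    (hG : ContDiffOn ℝ 2 G Ω) {z : E} (hz : z ∈ Ω) (a : E) :
    DifferentiableAt ℝ (fun w => fderiv ℝ G w a) z :=
  (hG.contDiffAt (hΩ.mem_nhds hz)).differentiableAt_fderiv.clm_apply (differentiableAt_const a)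

theorem continuous_mul_of_tsupport {G χ : E → ℝ} {Ω : Set E} (hΩ : IsOpen Ω)
    (hG : ContinuousOn G Ω) (hχ : Continuous χ) (hsub : tsupport χ ⊆ Ω) :
    Continuous fun z => G z * χ z := by
  rw [continuous_iff_continuousAt]
  intro z
  by_cases hz : z ∈ tsupport χ
  · exact ((hG.continuousAt (hΩ.mem_nhds (hsub hz))).mul hχ.continuousAt)
  · have : (fun z => G z * χ z) =ᶠ[nhds z] fun _ => 0 := by
      filter_upwards [(isClosed_tsupport χ).isOpen_compl.mem_nhds hz] with w hw
      rw [image_eq_zero_of_notMem_tsupport hw, mul_zero]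
    exact continuousAt_const.congr this.symm

theorem integrable_mul_of_tsupport [MeasurableSpace E] [BorelSpace E] {μ : Measure E}
    [IsFiniteMeasureOnCompacts μ] {G χ : E → ℝ} {Ω : Set E} (hΩ : IsOpen Ω)
    (hG : ContinuousOn G Ω) (hχ : Continuous χ) (hc : HasCompactSupport χ) (hsub : tsupport χ ⊆ Ω) :
    Integrable (fun z => G z * χ z) μ :=
  (continuous_mul_of_tsupport hΩ hG hχ hsub).integrable_of_hasCompactSupport hc.mul_left

/-- Two integrations by parts. -/
theorem integral_mul_hess [FiniteDimensional ℝ E] [MeasurableSpace E] [BorelSpace E]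
    {μ : Measure E} [μ.IsAddHaarMeasure] {G χ : E → ℝ} {Ω : Set E} (hΩ : IsOpen Ω)
    (hG : ContDiffOn ℝ 2 G Ω) (hχ : ContDiff ℝ 2 χ) (hc : HasCompactSupport χ)
    (hsub : tsupport χ ⊆ Ω) (a b : E) :
    ∫ z, G z * hess χ z a b ∂μ = ∫ z, hess G z a b * χ z ∂μ := by
  have hG1 : ContinuousOn G Ω := hG.continuousOn
  have hG2 : ∀ v, ContDiffOn ℝ 1 (fun w => fderiv ℝ G w v) Ω := fun v =>
    ((contDiffOn_succ_iff_fderiv_of_isOpen (n := 1) hΩ).1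
      (by norm_num; exact hG)).2.2.clm_apply contDiffOn_const
  have hG3 : ∀ v w, ContinuousOn (fun z => hess G z v w) Ω := fun v w =>
    ((hG2 w).continuousOn_fderiv_of_isOpen hΩ le_rfl).clm_apply continuousOn_const
  have hχ1 : ∀ v, ContDiff ℝ 1 (fun w => fderiv ℝ χ w v) := fun v =>
    (hχ.fderiv_right (m := 1) (by norm_num)).clm_apply contDiff_const
  have hs1 : ∀ v, tsupport (fun w => fderiv ℝ χ w v) ⊆ Ω := fun v =>
    (tsupport_fderiv_apply_subset ℝ v).trans hsub
  have step1 : ∫ z, G z * hess χ z a b ∂μ = - ∫ z, fderiv ℝ G z a * fderiv ℝ χ z b ∂μ := by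
    refine integral_mul_fderiv_eq_neg_fderiv_mul_of_integrable ?_ ?_ ?_ ?_ ?_
    · exact integrable_mul_of_tsupport hΩ (hG2 a).continuousOn (hχ1 b).continuous
        (hc.fderiv_apply ℝ b) (hs1 b)
    · exact integrable_mul_of_tsupport hΩ hG1 (hχ.continuous_hess a b) (hc.hess a b)
        ((tsupport_hess_subset χ a b).trans hsub)
    · exact integrable_mul_of_tsupport hΩ hG1 (hχ1 b).continuous
        (hc.fderiv_apply ℝ b) (hs1 b)
    · intro z hz
      exact (hG.contDiffAt (hΩ.mem_nhds (hs1 b hz))).differentiableAt (by norm_num)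
    · intro z _
      exact (hχ1 b).differentiable one_ne_zero z
  have step2 : ∫ z, fderiv ℝ G z a * fderiv ℝ χ z b ∂μ = - ∫ z, hess G z b a * χ z ∂μ := by
    refine integral_mul_fderiv_eq_neg_fderiv_mul_of_integrable ?_ ?_ ?_ ?_ ?_
    · exact integrable_mul_of_tsupport hΩ (hG3 b a) hχ.continuous hc hsub
    · exact integrable_mul_of_tsupport hΩ (hG2 a).continuousOn (hχ1 b).continuous
        (hc.fderiv_apply ℝ b) (hs1 b)
    · exact integrable_mul_of_tsupport hΩ (hG2 a).continuousOn hχ.continuous hc hsub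
    · intro z hz
      exact hG.differentiableAt_fderiv_apply hΩ (hsub hz) a
    · intro z _
      exact hχ.differentiable (by norm_num) z
  rw [step1, step2, neg_neg]
  refine integral_congr_ae (Filter.Eventually.of_forall fun z => ?_)
  by_cases hz : z ∈ tsupport χ
  · simp only [(hG.contDiffAt (hΩ.mem_nhds (hsub hz))).hess_comm b a]
  · simp only [image_eq_zero_of_notMem_tsupport hz, mul_zero]

end Real

theorem single_I_eq {N : ℕ} (j : Fin N) :
    (EuclideanSpace.single j Complex.I : CSpace N) = Complex.I • EuclideanSpace.single j 1 := by
  ext i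
  simp

theorem fderiv_ofReal_comp {E : Type*} [NormedAddCommGroup E] [NormedSpace ℝ E] {g : E → ℝ} {z : E}
    (h : DifferentiableAt ℝ g z) (v : E) :
    fderiv ℝ (fun w => (g w : ℂ)) z v = (fderiv ℝ g z v : ℂ) := by
  have h1 := Complex.ofRealCLM.hasFDerivAt.comp z h.hasFDerivAt
  exact congrArg (fun L => L v) h1.fderiv

/-- The Levi form is defined for arbitrary directions, so it can be restricted to complex subspaces
and paired with fibre directions, which the coordinate matrix does not permit directly. -/
theorem complexHessian_apply {N : ℕ} {χ : CSpace N → ℝ} {z : CSpace N} (h : ContDiffAt ℝ 2 χ z)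
    (j k : Fin N) : complexHessian χ z j k
      = leviForm χ z (EuclideanSpace.single j 1) (EuclideanSpace.single k 1) := by
  set ej : CSpace N := EuclideanSpace.single j 1 with hej
  set ek : CSpace N := EuclideanSpace.single k 1 with hek
  have hev : ∀ᶠ w in nhds z, wirtingerBar k (fun w => (χ w : ℂ)) w
      = ((fderiv ℝ χ w ek : ℂ) + Complex.I * (fderiv ℝ χ w (Complex.I • ek) : ℂ)) / 2 := by
    filter_upwards [h.eventually (by norm_num)] with w hw
    have hd := hw.differentiableAt (by norm_num)
    rw [wirtingerBar, fderiv_ofReal_comp hd, fderiv_ofReal_comp hd, single_I_eq]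
  have hd : ∀ v, DifferentiableAt ℝ (fun w => fderiv ℝ χ w v) z := fun v =>
    h.differentiableAt_fderiv.clm_apply (differentiableAt_const v)
  have hd' : ∀ v, HasFDerivAt (fun w => (fderiv ℝ χ w v : ℂ))
      (fderiv ℝ (fun w => (fderiv ℝ χ w v : ℂ)) z) z := fun v =>
    (Complex.ofRealCLM.hasFDerivAt.comp z (hd v).hasFDerivAt).differentiableAt.hasFDerivAt
  have hF := ((hd' ek).add ((hd' (Complex.I • ek)).const_mul Complex.I)).mul_const (2 : ℂ)⁻¹
  have hF2 : ∀ v, fderiv ℝ (wirtingerBar k fun w => (χ w : ℂ)) z v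
      = ((hess χ z v ek : ℂ) + Complex.I * (hess χ z v (Complex.I • ek) : ℂ)) / 2 := by
    intro v
    rw [Filter.EventuallyEq.fderiv_eq (hev.mono fun w hw => hw.trans (div_eq_mul_inv _ _))]
    rw [show fderiv ℝ (fun w => ((fderiv ℝ χ w ek : ℂ)
        + Complex.I * (fderiv ℝ χ w (Complex.I • ek) : ℂ)) * 2⁻¹) z = _ from hF.fderiv]
    simp only [smul_apply, add_apply, smul_eq_mul, fderiv_ofReal_comp (hd _)]
    rw [hess, hess, div_eq_mul_inv, mul_comm]
  rw [complexHessian, Matrix.of_apply, wirtinger, hF2, hF2, single_I_eq, leviForm]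
  push_cast
  linear_combination (-(hess χ z (Complex.I • ej) (Complex.I • ek) : ℂ) / 4) * Complex.I_sq

theorem leviForm_add_left {N : ℕ} {χ : CSpace N → ℝ} {z : CSpace N} (h : ContDiffAt ℝ 2 χ z)
    (a a' b : CSpace N) : leviForm χ z (a + a') b = leviForm χ z a b + leviForm χ z a' b := by
  simp only [leviForm, h.hess_eq, smul_add, map_add, add_apply]
  push_cast
  ring

theorem conj_leviForm {N : ℕ} {χ : CSpace N → ℝ} {z : CSpace N} (h : ContDiffAt ℝ 2 χ z)
    (a b : CSpace N) : conj (leviForm χ z a b) = leviForm χ z b a := by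
  simp only [leviForm, h.hess_comm b, h.hess_comm (Complex.I • b), map_div₀, map_add, map_mul,
    Complex.conj_ofReal, Complex.conj_I, map_ofNat]
  push_cast
  ring

theorem leviForm_smul_left {N : ℕ} {χ : CSpace N → ℝ} {z : CSpace N} (h : ContDiffAt ℝ 2 χ z)
    (c : ℂ) (a b : CSpace N) : leviForm χ z (c • a) b = c * leviForm χ z a b := by
  have hr : ∀ v : CSpace N, c • v = c.re • v + c.im • (Complex.I • v) := by
    intro v
    conv_lhs => rw [← Complex.re_add_im c, add_smul, mul_smul]
    rfl
  have hI : ∀ v : CSpace N, Complex.I • Complex.I • v = -v := fun v => by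
    rw [smul_smul, Complex.I_mul_I, neg_one_smul]
  have hc : Complex.I • c • a = c.re • (Complex.I • a) + c.im • (-a) := by
    rw [smul_comm, hr (Complex.I • a), hI]
  simp only [leviForm, hc, h.hess_eq]
  rw [hr a]
  simp only [map_add, map_smul, map_neg, add_apply, smul_apply, neg_apply, smul_eq_mul]
  conv_rhs => rw [← Complex.re_add_im c]
  push_cast
  linear_combination (-(c.im : ℂ) * (((fderiv ℝ (fderiv ℝ χ) z a (Complex.I • b) : ℝ) : ℂ)
    - ((fderiv ℝ (fderiv ℝ χ) z (Complex.I • a) b : ℝ) : ℂ)) / 4) * Complex.I_sq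

theorem leviForm_add_right {N : ℕ} {χ : CSpace N → ℝ} {z : CSpace N} (h : ContDiffAt ℝ 2 χ z)
    (a b b' : CSpace N) : leviForm χ z a (b + b') = leviForm χ z a b + leviForm χ z a b' := by
  rw [← conj_leviForm h, leviForm_add_left h, map_add, conj_leviForm h, conj_leviForm h]

theorem leviForm_smul_right {N : ℕ} {χ : CSpace N → ℝ} {z : CSpace N} (h : ContDiffAt ℝ 2 χ z)
    (c : ℂ) (a b : CSpace N) : leviForm χ z a (c • b) = conj c * leviForm χ z a b := by
  rw [← conj_leviForm h, leviForm_smul_left h, map_mul, conj_leviForm h]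

theorem leviForm_eq_sum {N : ℕ} {χ : CSpace N → ℝ} {z : CSpace N} (h : ContDiffAt ℝ 2 χ z)
    (a b : CSpace N) :
    leviForm χ z a b = ∑ j, ∑ k, a j * complexHessian χ z j k * conj (b k) := by
  let L : CSpace N →ₗ[ℂ] CSpace N →ₗ⋆[ℂ] ℂ := LinearMap.mk₂'ₛₗ (RingHom.id ℂ) (starRingEnd ℂ)
    (leviForm χ z) (leviForm_add_left h) (leviForm_smul_left h) (leviForm_add_right h)
    (leviForm_smul_right h)
  have hsum : ∀ v : CSpace N, v = ∑ j, v j • (EuclideanSpace.single j 1 : CSpace N) := by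
    intro v
    ext i
    simp [Pi.single_apply]
  change L a b = _
  conv_lhs => rw [hsum a, hsum b]
  simp only [map_sum, LinearMap.sum_apply, map_smul, LinearMap.smul_apply, LinearMap.map_smulₛₗ,
    Finset.smul_sum]
  rw [Finset.sum_comm]
  refine Finset.sum_congr rfl fun j _ => Finset.sum_congr rfl fun k _ => ?_
  rw [complexHessian_apply h]
  change conj (b k) • a j • leviForm χ z _ _ = _
  simp only [smul_eq_mul]
  ring

theorem isHermitian_complexHessian {N : ℕ} {χ : CSpace N → ℝ} {z : CSpace N}
    (h : ContDiffAt ℝ 2 χ z) : (complexHessian χ z).IsHermitian := by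
  ext j k
  rw [Matrix.conjTranspose_apply, complexHessian_apply h, complexHessian_apply h]
  exact conj_leviForm h _ _

theorem ContDiff.continuous_leviForm {N : ℕ} {χ : CSpace N → ℝ} (h : ContDiff ℝ 2 χ)
    (a b : CSpace N) : Continuous fun z => leviForm χ z a b := by
  unfold leviForm
  have := fun a b => h.continuous_hess a b
  have := Complex.continuous_ofReal
  fun_prop

end Hessian

/-! ### Subharmonicity through the matrices `∫ u dd^c χ` -/

section Moments

open scoped ComplexConjugate

/-- A nonnegative test function on `Ω`. -/
structure IsTestFunction {N : ℕ} (χ : CSpace N → ℝ) (Ω : Set (CSpace N)) : Prop where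
  smooth : ContDiff ℝ ∞ χ
  compact : HasCompactSupport χ
  subset : tsupport χ ⊆ Ω
  nonneg : ∀ z, 0 ≤ χ z

theorem IsTestFunction.contDiff_two {N : ℕ} {χ : CSpace N → ℝ} {Ω : Set (CSpace N)}
    (h : IsTestFunction χ Ω) : ContDiff ℝ 2 χ := h.smooth.of_le (WithTop.coe_le_coe.2 le_top)

/-- The functional `A ↦ A ∧ Θ` on matrices. -/
noncomputable def wedgeFunctional {N : ℕ} (Θ : ConstForm N) : Matrix (Fin N) (Fin N) ℂ →ₗ[ℂ] ℂ :=
  topCoeff N ∘ₗ LinearMap.mulRight ℂ Θ ∘ₗ form11Lin N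

theorem volDensity_form11_mul {N : ℕ} (Θ : ConstForm N) (a : Matrix (Fin N) (Fin N) ℂ) :
    volDensity (form11 a * Θ) = (wedgeFunctional Θ a).re := rfl

theorem linearMap_matrix_apply {N : ℕ} (Λ : Matrix (Fin N) (Fin N) ℂ →ₗ[ℂ] ℂ)
    (a : Matrix (Fin N) (Fin N) ℂ) : Λ a = ∑ j, ∑ k, a j k * Λ (Matrix.single j k 1) := by
  conv_lhs => rw [Matrix.matrix_eq_sum_single a]
  simp only [map_sum]
  refine Finset.sum_congr rfl fun j _ => Finset.sum_congr rfl fun k _ => ?_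
  rw [← smul_eq_mul, ← map_smul, Matrix.smul_single, smul_eq_mul, mul_one]

theorem complexHessian_eq_zero {N : ℕ} {χ : CSpace N → ℝ} {z : CSpace N} (hz : z ∉ tsupport χ) :
    complexHessian χ z = 0 := by
  have hev : (fun w => (χ w : ℂ)) =ᶠ[nhds z] fun _ => 0 := by
    filter_upwards [(isClosed_tsupport χ).isOpen_compl.mem_nhds hz] with w hw
    rw [image_eq_zero_of_notMem_tsupport hw, Complex.ofReal_zero]
  ext j k
  have h1 : wirtingerBar k (fun w => (χ w : ℂ)) =ᶠ[nhds z] fun _ => 0 := by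
    filter_upwards [hev.eventuallyEq_nhds] with w hw
    simp [wirtingerBar, hw.fderiv_eq]
  simp [complexHessian, wirtinger, h1.fderiv_eq]

theorem ContDiff.continuous_complexHessian {N : ℕ} {χ : CSpace N → ℝ} (h : ContDiff ℝ 2 χ)
    (j k : Fin N) : Continuous fun z => complexHessian χ z j k := by
  simp only [fun z => complexHessian_apply (h.contDiffAt (x := z)) j k]
  exact h.continuous_leviForm _ _

theorem hasCompactSupport_complexHessian {N : ℕ} {χ : CSpace N → ℝ} (h : HasCompactSupport χ)
    (j k : Fin N) : HasCompactSupport fun z => complexHessian χ z j k :=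
  HasCompactSupport.intro h fun z hz => by rw [complexHessian_eq_zero hz]; rfl

theorem ContDiffOn.continuousOn_hess {E : Type*} [NormedAddCommGroup E] [NormedSpace ℝ E]
    {G : E → ℝ} {Ω : Set E} (hΩ : IsOpen Ω) (hG : ContDiffOn ℝ 2 G Ω) (a b : E) :
    ContinuousOn (fun z => hess G z a b) Ω := by
  have h : ContDiffOn ℝ 1 (fun w => fderiv ℝ G w b) Ω :=
    ((contDiffOn_succ_iff_fderiv_of_isOpen (n := 1) hΩ).1
      (by norm_num; exact hG)).2.2.clm_apply contDiffOn_const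
  exact (h.continuousOn_fderiv_of_isOpen hΩ le_rfl).clm_apply continuousOn_const

theorem ContDiffOn.continuousOn_complexHessian {N : ℕ} {G : CSpace N → ℝ} {Ω : Set (CSpace N)}
    (hΩ : IsOpen Ω) (hG : ContDiffOn ℝ 2 G Ω) (j k : Fin N) :
    ContinuousOn (fun z => complexHessian G z j k) Ω := by
  refine ContinuousOn.congr (f := fun z => leviForm G z (EuclideanSpace.single j 1)
    (EuclideanSpace.single k 1)) ?_ fun z hz => complexHessian_apply
      (hG.contDiffAt (hΩ.mem_nhds hz)) j k
  unfold leviForm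
  have := fun a b => hG.continuousOn_hess hΩ a b
  have := Complex.continuous_ofReal
  fun_prop

theorem integral_mul_leviForm {N : ℕ} {G χ : CSpace N → ℝ} {Ω : Set (CSpace N)} (hΩ : IsOpen Ω)
    (hG : ContDiffOn ℝ 2 G Ω) (hχ : IsTestFunction χ Ω) (a b : CSpace N) :
    ∫ z, (G z : ℂ) * leviForm χ z a b = ∫ z, leviForm G z a b * (χ z : ℂ) := by
  have h2 := hχ.contDiff_two
  have i1 : ∀ a b, Integrable fun z => G z * hess χ z a b := fun a b =>
    integrable_mul_of_tsupport hΩ hG.continuousOn (h2.continuous_hess a b) (hχ.compact.hess a b)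
      ((tsupport_hess_subset χ a b).trans hχ.subset)
  have i2 : ∀ a b, Integrable fun z => hess G z a b * χ z := fun a b =>
    integrable_mul_of_tsupport hΩ (hG.continuousOn_hess hΩ a b) h2.continuous hχ.compact hχ.subset
  have e : ∀ a b, ∫ z, G z * hess χ z a b = ∫ z, hess G z a b * χ z := fun a b =>
    integral_mul_hess hΩ hG h2 hχ.compact hχ.subset a b
  have hL : ∀ z, (G z : ℂ) * leviForm χ z a b
      = (((G z * hess χ z a b + G z * hess χ z (Complex.I • a) (Complex.I • b) : ℝ) : ℂ)
        + Complex.I * ((G z * hess χ z a (Complex.I • b) - G z * hess χ z (Complex.I • a) b : ℝ)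
          : ℂ)) / 4 := by
    intro z
    rw [leviForm]
    push_cast
    ring
  have hR : ∀ z, leviForm G z a b * (χ z : ℂ)
      = (((hess G z a b * χ z + hess G z (Complex.I • a) (Complex.I • b) * χ z : ℝ) : ℂ)
        + Complex.I * ((hess G z a (Complex.I • b) * χ z - hess G z (Complex.I • a) b * χ z : ℝ)
          : ℂ)) / 4 := by
    intro z
    rw [leviForm]
    push_cast
    ring
  simp only [hL, hR]
  rw [integral_div, integral_div, integral_add ((i1 _ _).add (i1 _ _)).ofReal
    (((i1 _ _).sub (i1 _ _)).ofReal.const_mul _), integral_add ((i2 _ _).add (i2 _ _)).ofReal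
    (((i2 _ _).sub (i2 _ _)).ofReal.const_mul _), integral_const_mul, integral_const_mul,
    integral_complex_ofReal, integral_complex_ofReal, integral_complex_ofReal,
    integral_complex_ofReal,
    integral_add (i1 _ _) (i1 _ _), integral_add (i2 _ _) (i2 _ _),
    integral_sub (i1 _ _) (i1 _ _), integral_sub (i2 _ _) (i2 _ _), e, e, e, e]

theorem integral_mul_complexHessian {N : ℕ} {G χ : CSpace N → ℝ} {Ω : Set (CSpace N)}
    (hΩ : IsOpen Ω) (hG : ContDiffOn ℝ 2 G Ω) (hχ : IsTestFunction χ Ω) (j k : Fin N) :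
    ∫ z, (G z : ℂ) * complexHessian χ z j k = ∫ z, complexHessian G z j k * (χ z : ℂ) := by
  simp only [fun z => complexHessian_apply (hχ.contDiff_two.contDiffAt (x := z)) j k]
  rw [integral_mul_leviForm hΩ hG hχ]
  refine integral_congr_ae (Filter.Eventually.of_forall fun z => ?_)
  by_cases hz : z ∈ tsupport χ
  · simp only [complexHessian_apply (hG.contDiffAt (hΩ.mem_nhds (hχ.subset hz)))]
  · simp only [image_eq_zero_of_notMem_tsupport hz, Complex.ofReal_zero, mul_zero]

/-- `∫ u dd^c χ` as a matrix. -/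
noncomputable def momentMatrix {N : ℕ} (u : CSpace N → EReal) (Ω : Set (CSpace N))
    (χ : CSpace N → ℝ) : Matrix (Fin N) (Fin N) ℂ :=
  Matrix.of fun j k => ∫ z in Ω, ((u z).toReal : ℂ) * complexHessian χ z j k

/-- A linear functional commutes with the integral. So for fixed `χ` every current condition is a
linear inequality on one matrix. -/
theorem wedgeFunctional_momentMatrix {N : ℕ} {u : CSpace N → EReal} {Ω : Set (CSpace N)}
    {χ : CSpace N → ℝ}
    (hint : ∀ j k, IntegrableOn (fun z => ((u z).toReal : ℂ) * complexHessian χ z j k) Ω)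
    (Λ : Matrix (Fin N) (Fin N) ℂ →ₗ[ℂ] ℂ) :
    ∫ z in Ω, (u z).toReal * (Λ (complexHessian χ z)).re = (Λ (momentMatrix u Ω χ)).re := by
  have h1 : ∀ z, (u z).toReal * (Λ (complexHessian χ z)).re
      = (∑ j, ∑ k, ((u z).toReal : ℂ) * complexHessian χ z j k * Λ (Matrix.single j k 1)).re := by
    intro z
    rw [← Complex.re_ofReal_mul, linearMap_matrix_apply, Finset.mul_sum]
    simp only [Finset.mul_sum, mul_assoc]
  have hi : ∀ j, Integrable (fun z => ∑ k, ((u z).toReal : ℂ) * complexHessian χ z j k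
      * Λ (Matrix.single j k 1)) (volume.restrict Ω) := fun j =>
    integrable_finsetSum _ fun k _ => (hint j k).mul_const _
  simp only [h1]
  have h2 := Complex.reCLM.integral_comp_comm (integrable_finsetSum Finset.univ fun j _ => hi j)
  simp only [Complex.reCLM_apply] at h2
  rw [h2, integral_finsetSum _ fun j _ => hi j, linearMap_matrix_apply]
  congr 1
  refine Finset.sum_congr rfl fun j _ => ?_
  rw [integral_finsetSum _ fun k _ => (hint j k).mul_const _]
  refine Finset.sum_congr rfl fun k _ => ?_
  rw [integral_mul_const]
  rfl

theorem isHermitian_momentMatrix {N : ℕ} (u : CSpace N → EReal) (Ω : Set (CSpace N))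
    {χ : CSpace N → ℝ} (hχ : ContDiff ℝ 2 χ) : (momentMatrix u Ω χ).IsHermitian := by
  ext j k
  simp only [momentMatrix, Matrix.conjTranspose_apply, Matrix.of_apply]
  change conj _ = _
  rw [← integral_conj]
  refine integral_congr_ae (Filter.Eventually.of_forall fun z => ?_)
  simp only [map_mul, Complex.conj_ofReal]
  congr 1
  exact congrFun (congrFun (isHermitian_complexHessian hχ.contDiffAt) j) k

theorem integrableOn_mul_complexHessian {N : ℕ} {u : CSpace N → EReal} {Ω : Set (CSpace N)}
    (hu : LocallyIntegrableOn (fun z => (u z).toReal) Ω) {χ : CSpace N → ℝ}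
    (hχ : IsTestFunction χ Ω) (j k : Fin N) :
    IntegrableOn (fun z => ((u z).toReal : ℂ) * complexHessian χ z j k) Ω := by
  have h1 : IntegrableOn (fun z => (u z).toReal) (tsupport χ) :=
    hu.integrableOn_compact_subset hχ.subset hχ.compact
  have h2 : IntegrableOn (fun z => ((u z).toReal : ℂ) * complexHessian χ z j k) (tsupport χ) :=
    IntegrableOn.mul_continuousOn (g := fun z => ((u z).toReal : ℂ)) h1.ofReal
      (hχ.contDiff_two.continuous_complexHessian j k).continuousOn
      hχ.compact
  have h3 : Integrable (fun z => ((u z).toReal : ℂ) * complexHessian χ z j k) := by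
    refine (integrableOn_iff_integrable_of_support_subset fun z hz => ?_).1 h2
    by_contra hz'
    exact hz (by simp [complexHessian_eq_zero hz'])
  exact h3.integrableOn

theorem wedgeFunctional_prod {N k : ℕ} (α : Fin k → Matrix (Fin N) (Fin N) ℂ)
    (a : Matrix (Fin N) (Fin N) ℂ) :
    wedgeFunctional ((List.ofFn fun i => form11 (α i)).prod * kahlerForm N ^ (N - (k + 1))) a
      = polarForm N (k + 1) (Fin.cons a α) := by
  rw [polarForm_cons]
  rfl

/-- `k`-subharmonicity in terms of the matrices `∫ u dd^c χ`. -/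
theorem KSubharmonicOn.momentMatrix_mem {N k : ℕ} (hk1 : 1 ≤ k) (hk : k ≤ N) {u : CSpace N → EReal}
    {Ω : Set (CSpace N)} (hu : KSubharmonicOn k u Ω)
    (hloc : LocallyIntegrableOn (fun z => (u z).toReal) Ω) {χ : CSpace N → ℝ}
    (hχ : IsTestFunction χ Ω) : momentMatrix u Ω χ ∈ gammaCone N k := by
  obtain ⟨k, rfl⟩ : ∃ k', k = k' + 1 := ⟨k - 1, by omega⟩
  refine mem_gammaCone_of_forall hk (isHermitian_momentMatrix u Ω hχ.contDiff_two) fun a ha => ?_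
  -- Equal forms `α_i = a` are enough here, because `Γ_k` is determined by `x ∧ a^(k-1) ∧ β^(N-k) ≥
  -- 0`.
  have h := hu.ddc_nonneg (fun _ => a) (fun _ => ha) χ hχ.smooth hχ.compact hχ.subset hχ.nonneg
  simp only [volDensity_form11_mul] at h
  rw [wedgeFunctional_momentMatrix fun j k => integrableOn_mul_complexHessian hloc hχ j k] at h
  rw [← wedgeFunctional_prod]
  exact h

/-- The converse direction is Gårding's inequality, applied to the moment matrix together with the
`α_i`. -/
theorem kSubharmonicOn_of_momentMatrix_mem {N k : ℕ} (hk1 : 1 ≤ k) (hk : k ≤ N)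
    {u : CSpace N → EReal} {Ω : Set (CSpace N)} (hu : SubharmonicOn u Ω)
    (hloc : LocallyIntegrableOn (fun z => (u z).toReal) Ω)
    (h : ∀ χ, IsTestFunction χ Ω → momentMatrix u Ω χ ∈ gammaCone N k) : KSubharmonicOn k u Ω := by
  obtain ⟨k, rfl⟩ : ∃ k', k = k' + 1 := ⟨k - 1, by omega⟩
  refine ⟨hu, fun α hα χ h1 h2 h3 h4 => ?_⟩
  have hχ : IsTestFunction χ Ω := ⟨h1, h2, h3, h4⟩
  simp only [volDensity_form11_mul]
  rw [wedgeFunctional_momentMatrix fun j k => integrableOn_mul_complexHessian hloc hχ j k]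
  change 0 ≤ (wedgeFunctional ((List.ofFn fun i : Fin k => form11 (α i)).prod
    * kahlerForm N ^ (N - (k + 1))) (momentMatrix u Ω χ)).re
  rw [wedgeFunctional_prod]
  refine polarForm_nonneg hk _ fun i => ?_
  refine Fin.cases ?_ (fun i => ?_) i
  · exact h χ hχ
  · exact hα i

/-- For smooth functions `∫ G dd^c χ ∧ Θ = ∫ χ dd^c G ∧ Θ`. -/
theorem integral_mul_wedge {N : ℕ} {G χ : CSpace N → ℝ} {Ω : Set (CSpace N)}
    (hΩ : IsOpen Ω) (hG : ContDiffOn ℝ 2 G Ω) (hχ : IsTestFunction χ Ω)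
    (Λ : Matrix (Fin N) (Fin N) ℂ →ₗ[ℂ] ℂ) :
    ∫ z in Ω, G z * (Λ (complexHessian χ z)).re = ∫ z, (Λ (complexHessian G z)).re * χ z := by
  have hsub : ∀ z, z ∉ Ω → complexHessian χ z = 0 := fun z hz =>
    complexHessian_eq_zero fun h => hz (hχ.subset h)
  have hi1 : ∀ j k, Integrable fun z => (G z : ℂ) * complexHessian χ z j k := by
    intro j k
    have hcont : Continuous fun z => (G z : ℂ) * complexHessian χ z j k := by
      rw [continuous_iff_continuousAt]
      intro z
      by_cases hz : z ∈ tsupport χ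
      · exact (Complex.continuous_ofReal.continuousAt.comp
          (hG.continuousOn.continuousAt (hΩ.mem_nhds (hχ.subset hz)))).mul
          (hχ.contDiff_two.continuous_complexHessian j k).continuousAt
      · have : (fun z => (G z : ℂ) * complexHessian χ z j k) =ᶠ[nhds z] fun _ => 0 := by
          filter_upwards [(isClosed_tsupport χ).isOpen_compl.mem_nhds hz] with w hw
          rw [complexHessian_eq_zero hw]
          simp
        exact continuousAt_const.congr this.symm
    exact hcont.integrable_of_hasCompactSupport
      (hasCompactSupport_complexHessian hχ.compact j k).mul_left
  have hi2 : ∀ j k, Integrable fun z => complexHessian G z j k * (χ z : ℂ) := by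
    intro j k
    have hcont : Continuous fun z => complexHessian G z j k * (χ z : ℂ) := by
      rw [continuous_iff_continuousAt]
      intro z
      by_cases hz : z ∈ tsupport χ
      · exact ((hG.continuousOn_complexHessian hΩ j k).continuousAt
          (hΩ.mem_nhds (hχ.subset hz))).mul
          (Complex.continuous_ofReal.comp hχ.smooth.continuous).continuousAt
      · have : (fun z => complexHessian G z j k * (χ z : ℂ)) =ᶠ[nhds z] fun _ => 0 := by
          filter_upwards [(isClosed_tsupport χ).isOpen_compl.mem_nhds hz] with w hw
          rw [image_eq_zero_of_notMem_tsupport hw]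
          simp
        exact continuousAt_const.congr this.symm
    refine hcont.integrable_of_hasCompactSupport ?_
    exact (hχ.compact.comp_left (g := fun t : ℝ => (t : ℂ)) Complex.ofReal_zero).mul_left
  have hL : ∀ z, G z * (Λ (complexHessian χ z)).re
      = (∑ j, ∑ k, (G z : ℂ) * complexHessian χ z j k * Λ (Matrix.single j k 1)).re := by
    intro z
    rw [← Complex.re_ofReal_mul, linearMap_matrix_apply, Finset.mul_sum]
    simp only [Finset.mul_sum, mul_assoc]
  have hR : ∀ z, (Λ (complexHessian G z)).re * χ z
      = (∑ j, ∑ k, complexHessian G z j k * (χ z : ℂ) * Λ (Matrix.single j k 1)).re := by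
    intro z
    rw [← Complex.re_mul_ofReal, linearMap_matrix_apply, Finset.sum_mul]
    simp only [Finset.sum_mul]
    congr 1
    refine Finset.sum_congr rfl fun j _ => Finset.sum_congr rfl fun k _ => ?_
    ring
  rw [setIntegral_eq_integral_of_forall_compl_eq_zero fun z hz => by
    rw [hsub z hz, map_zero, Complex.zero_re, mul_zero]]
  simp only [hL, hR]
  have hs1 : ∀ j, Integrable (fun z => ∑ k, (G z : ℂ) * complexHessian χ z j k
      * Λ (Matrix.single j k 1)) := fun j =>
    integrable_finsetSum _ fun k _ => (hi1 j k).mul_const _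
  have hs2 : ∀ j, Integrable (fun z => ∑ k, complexHessian G z j k * (χ z : ℂ)
      * Λ (Matrix.single j k 1)) := fun j =>
    integrable_finsetSum _ fun k _ => (hi2 j k).mul_const _
  have h1 := Complex.reCLM.integral_comp_comm (integrable_finsetSum Finset.univ fun j _ => hs1 j)
  have h2 := Complex.reCLM.integral_comp_comm (integrable_finsetSum Finset.univ fun j _ => hs2 j)
  simp only [Complex.reCLM_apply] at h1 h2
  rw [h1, h2, integral_finsetSum _ fun j _ => hs1 j, integral_finsetSum _ fun j _ => hs2 j]
  congr 1
  refine Finset.sum_congr rfl fun j _ => ?_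
  rw [integral_finsetSum _ fun k _ => (hi1 j k).mul_const _,
    integral_finsetSum _ fun k _ => (hi2 j k).mul_const _]
  refine Finset.sum_congr rfl fun k _ => ?_
  rw [integral_mul_const, integral_mul_const, integral_mul_complexHessian hΩ hG hχ]

end Moments

/-! ### Local integrability and basic properties of subharmonic functions -/

section Subharmonic

open Metric Set

variable {N : ℕ} {u : CSpace N → EReal} {Ω : Set (CSpace N)}

theorem UpperSemicontinuousOn.aemeasurable_restrict {α : Type*} [TopologicalSpace α]
    [MeasurableSpace α] [BorelSpace α] {μ : Measure α} {u : α → EReal} {Ω : Set α}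
    (hΩ : IsOpen Ω) (hu : UpperSemicontinuousOn u Ω) : AEMeasurable u (μ.restrict Ω) := by
  classical
  have h : Measurable (Ω.piecewise u fun _ => ⊤) := by
    refine measurable_of_Iio fun b => ?_
    obtain ⟨U, hU, hUb⟩ := upperSemicontinuousOn_iff_preimage_Iio.1 hu b
    have : (Ω.piecewise u fun _ => ⊤) ⁻¹' Iio b = Ω ∩ U := by
      rw [← hUb]
      ext x
      by_cases hx : x ∈ Ω <;> simp [hx]
    rw [this]
    exact (hΩ.inter hU).measurableSet
  refine h.aemeasurable.congr ?_
  filter_upwards [ae_restrict_mem hΩ.measurableSet] with x hx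
  simp [hx]

theorem SubharmonicOn.exists_upper_bound (hu : SubharmonicOn u Ω) {K : Set (CSpace N)}
    (hK : IsCompact K) (hKΩ : K ⊆ Ω) : ∃ c : ℝ, 0 ≤ c ∧ ∀ x ∈ K, u x ≤ c := by
  rcases K.eq_empty_or_nonempty with rfl | hne
  · exact ⟨0, le_rfl, by simp⟩
  obtain ⟨p, hp, hmax⟩ := UpperSemicontinuousOn.exists_isMaxOn hne hK
    (SemicontinuousOn.mono hu.usc hKΩ)
  obtain ⟨c, hc, -⟩ := EReal.lt_iff_exists_real_btwn.1 (lt_top_iff_ne_top.2 (hu.ne_top p (hKΩ hp)))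
  refine ⟨max c 0, le_max_right _ _, fun x hx => (hmax hx).trans (hc.le.trans ?_)⟩
  exact EReal.coe_le_coe_iff.2 (le_max_left _ _)

theorem enorm_toReal_le (x : EReal) : ‖x.toReal‖ₑ ≤ x.toENNReal + (-x).toENNReal := by
  induction x with
  | bot => simp
  | top => simp
  | coe r =>
    rw [EReal.toReal_coe, Real.enorm_eq_ofReal_abs, ← EReal.coe_neg, EReal.toENNReal_of_ne_top
      (EReal.coe_ne_top _), EReal.toENNReal_of_ne_top (EReal.coe_ne_top _), EReal.toReal_coe,
      EReal.toReal_coe]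
    rcases abs_cases r with ⟨h, -⟩ | ⟨h, -⟩ <;> rw [h]
    · exact le_self_add
    · exact le_add_self

theorem SubharmonicOn.integrableOn_ball (hu : SubharmonicOn u Ω) (hΩ : IsOpen Ω) {z : CSpace N}
    (hz : u z ≠ ⊥) {r : ℝ} (hr : 0 < r) (hsub : closedBall z r ⊆ Ω) :
    IntegrableOn (fun x => (u x).toReal) (ball z r) ∧ ∀ᵐ x ∂volume.restrict (ball z r), u x ≠ ⊥ := by
  have hzΩ : z ∈ Ω := hsub (mem_closedBall_self hr.le)
  have hbΩ : ball z r ⊆ Ω := ball_subset_closedBall.trans hsub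
  have hmeas : AEMeasurable u (volume.restrict (ball z r)) :=
    (hu.usc.aemeasurable_restrict hΩ).mono_measure (Measure.restrict_mono hbΩ le_rfl)
  obtain ⟨c, hc0, hc⟩ := hu.exists_upper_bound (isCompact_closedBall z r) hsub
  have hvol : volume (ball z r) ≠ ⊤ := measure_ball_lt_top.ne
  have hvol0 : volume (ball z r) ≠ 0 := (measure_ball_pos volume z hr).ne'
  have hpos : ∫⁻ x in ball z r, (u x).toENNReal < ⊤ := by
    calc ∫⁻ x in ball z r, (u x).toENNReal ≤ ∫⁻ _x in ball z r, ENNReal.ofReal c := by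
          refine setLIntegral_mono_ae aemeasurable_const (Filter.Eventually.of_forall fun x hx => ?_)
          refine (EReal.toENNReal_le_toENNReal (hc x (ball_subset_closedBall hx))).trans ?_
          rw [EReal.toENNReal_of_ne_top (EReal.coe_ne_top _), EReal.toReal_coe]
      _ < ⊤ := by
          rw [setLIntegral_const]
          exact ENNReal.mul_lt_top ENNReal.ofReal_lt_top measure_ball_lt_top
  -- The positive part is bounded, so an infinite negative part would make the mean `-∞` and force
  -- `u z = -∞`.
  have hneg : ∫⁻ x in ball z r, (-u x).toENNReal ≠ ⊤ := by
    intro htop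
    have h := hu.sub_mean z hzΩ r hr hsub
    have h2 : ⨍⁻ x in ball z r, (-u x).toENNReal ∂volume = ⊤ := by
      rw [setLAverage_eq, htop, ENNReal.top_div_of_ne_top hvol]
    rw [ballMean, h2, EReal.coe_ennreal_top, EReal.sub_top, le_bot_iff] at h
    · exact hz h
  refine ⟨⟨(measurable_ereal_toReal.comp_aemeasurable hmeas).aestronglyMeasurable, ?_⟩, ?_⟩
  · refine (lintegral_mono fun x => enorm_toReal_le (u x)).trans_lt ?_
    rw [lintegral_add_left' hmeas.ereal_toENNReal]
    exact ENNReal.add_lt_top.2 ⟨hpos, lt_top_iff_ne_top.2 hneg⟩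
  · have := ae_lt_top' hmeas.neg.ereal_toENNReal hneg
    filter_upwards [this] with x hx hx'
    rw [Pi.neg_apply, hx'] at hx
    simp at hx

/-- A subharmonic function on a connected open set is locally integrable unless it is `-∞`. -/
theorem SubharmonicOn.locallyIntegrableOn (hu : SubharmonicOn u Ω) (hΩ : IsOpen Ω)
    (hconn : IsPreconnected Ω) {z₀ : CSpace N} (hz₀ : z₀ ∈ Ω) (hz₀' : u z₀ ≠ ⊥) :
    LocallyIntegrableOn (fun x => (u x).toReal) Ω := by
  set P : CSpace N → Prop := fun z => ∃ r > 0, IntegrableOn (fun x => (u x).toReal) (ball z r) ∧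
    ∀ᵐ x ∂volume.restrict (ball z r), u x ≠ ⊥ with hP
  have hPopen : IsOpen {z | P z} := by
    rw [isOpen_iff_mem_nhds]
    rintro z ⟨r, hr, h1, h2⟩
    filter_upwards [ball_mem_nhds z (half_pos hr)] with w hw
    have hsub : ball w (r / 2) ⊆ ball z r := ball_subset_ball' (by rw [mem_ball] at hw; linarith)
    exact ⟨r / 2, half_pos hr, h1.mono_set hsub, ae_restrict_of_ae_restrict_of_subset hsub h2⟩
  have hVopen : IsOpen {z | z ∈ Ω ∧ ¬ P z} := by
    rw [isOpen_iff_mem_nhds]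
    rintro z ⟨hz, hPz⟩
    obtain ⟨δ, hδ, hδΩ⟩ := Metric.isOpen_iff.1 hΩ z hz
    set r := δ / 4 with hr
    have hr0 : 0 < r := by positivity
    filter_upwards [ball_mem_nhds z hr0] with w hw
    refine ⟨hδΩ (ball_subset_ball (by linarith) hw), fun ⟨ρ, hρ, h1, h2⟩ => hPz ?_⟩
    -- Near a point `w` satisfying `P` the function is finite almost everywhere, so a point of
    -- finiteness lies close to `z`. The ball of radius `2r` about it covers `ball z r`, and `P z`
    -- follows.
    have hex : ∃ w' ∈ ball z r, u w' ≠ ⊥ := by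
      have hopen : IsOpen (ball w ρ ∩ ball z r) := isOpen_ball.inter isOpen_ball
      have hne : (ball w ρ ∩ ball z r).Nonempty := ⟨w, mem_ball_self hρ, hw⟩
      have hpos := hopen.measure_pos volume hne
      have h3 := ae_restrict_of_ae_restrict_of_subset (inter_subset_left : ball w ρ ∩ ball z r ⊆ _) h2
      rw [ae_restrict_iff' hopen.measurableSet] at h3
      by_contra! hcon
      have h4 : ∀ᵐ x, x ∉ ball w ρ ∩ ball z r := by
        filter_upwards [h3] with x hx hx'
        exact hx hx' (hcon x hx'.2)
      exact hpos.ne' (by simpa using measure_eq_zero_iff_ae_notMem.2 h4)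
    obtain ⟨w', hw', hne⟩ := hex
    rw [mem_ball] at hw'
    have hcb : closedBall w' (2 * r) ⊆ Ω :=
      (closedBall_subset_ball' (by linarith)).trans hδΩ
    obtain ⟨h3, h4⟩ := hu.integrableOn_ball hΩ hne (by positivity) hcb
    have hsub : ball z r ⊆ ball w' (2 * r) := ball_subset_ball' (by rw [dist_comm]; linarith)
    exact ⟨r, hr0, h3.mono_set hsub, ae_restrict_of_ae_restrict_of_subset hsub h4⟩
  have hPz₀ : P z₀ := by
    obtain ⟨δ, hδ, hδΩ⟩ := Metric.isOpen_iff.1 hΩ z₀ hz₀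
    exact ⟨δ / 2, half_pos hδ, hu.integrableOn_ball hΩ hz₀' (half_pos hδ)
      ((closedBall_subset_ball (by linarith)).trans hδΩ)⟩
  have hall : ∀ z ∈ Ω, P z := by
    intro z hz
    by_contra hPz
    obtain ⟨w, -, hw1, hw2⟩ := hconn _ _ hPopen hVopen
      (fun x hx => (em (P x)).imp id fun h => ⟨hx, h⟩) ⟨z₀, hz₀, hPz₀⟩ ⟨z, hz, hz, hPz⟩
    exact hw2.2 hw1
  intro z hz
  obtain ⟨r, hr, h1, -⟩ := hall z hz
  exact ⟨ball z r, mem_nhdsWithin_of_mem_nhds (ball_mem_nhds z hr), h1⟩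

theorem ballMean_coe {φ : CSpace N → ℝ} {z : CSpace N} {r : ℝ}
    (h : IntegrableOn φ (ball z r)) :
    ballMean (fun x => (φ x : EReal)) z r = ((⨍ x in ball z r, φ x : ℝ) : EReal) := by
  have hint : Integrable φ ((volume.restrict (ball z r) Set.univ)⁻¹ • volume.restrict (ball z r)) :=
    h.to_average
  have h1 : ∀ x : ℝ, (x : EReal).toENNReal = ENNReal.ofReal x := fun x => by
    rw [EReal.toENNReal_of_ne_top (EReal.coe_ne_top _), EReal.toReal_coe]
  rw [ballMean]
  simp only [← EReal.coe_neg, h1]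
  rw [average, integral_eq_lintegral_pos_part_sub_lintegral_neg_part hint, laverage, laverage,
    EReal.coe_sub]
  have hfin : ∀ f : CSpace N → ℝ, Integrable f
      ((volume.restrict (ball z r) Set.univ)⁻¹ • volume.restrict (ball z r)) →
      ((∫⁻ x, ENNReal.ofReal (f x)
        ∂((volume.restrict (ball z r) Set.univ)⁻¹ • volume.restrict (ball z r)) : ENNReal) : EReal)
      = ((∫⁻ x, ENNReal.ofReal (f x)
        ∂((volume.restrict (ball z r) Set.univ)⁻¹ • volume.restrict (ball z r)) : ENNReal).toReal
          : EReal) := by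
    intro f hf
    exact (EReal.coe_ennreal_toReal ((lintegral_ofReal_le_lintegral_enorm f).trans_lt hf.2).ne).symm
  rw [hfin φ hint, hfin (fun x => -φ x) hint.neg]

theorem SubharmonicOn.const (c : EReal) (hc : c ≠ ⊤) : SubharmonicOn (fun _ : CSpace N => c) Ω := by
  refine ⟨fun _ _ => hc, upperSemicontinuousOn_const, fun z _ r hr _ => ?_⟩
  induction c with
  | bot => exact bot_le
  | top => exact absurd rfl hc
  | coe c =>
    have hvol0 : volume (ball z r) ≠ 0 := (measure_ball_pos volume z hr).ne'
    rw [ballMean_coe (integrableOn_const measure_ball_lt_top.ne), setAverage_const hvol0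
      measure_ball_lt_top.ne]

theorem ballMean_congr {v : CSpace N → EReal} {z : CSpace N} {r : ℝ}
    (h : EqOn u v (ball z r)) : ballMean u z r = ballMean v z r := by
  have h1 : EqOn (fun x => (u x).toENNReal) (fun x => (v x).toENNReal) (ball z r) := fun x hx =>
    congrArg EReal.toENNReal (h hx)
  have h2 : EqOn (fun x => (-u x).toENNReal) (fun x => (-v x).toENNReal) (ball z r) := fun x hx =>
    congrArg (fun y => (-y).toENNReal) (h hx)
  rw [ballMean, ballMean, setLAverage_congr_fun measurableSet_ball h1,
    setLAverage_congr_fun measurableSet_ball h2]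

theorem SubharmonicOn.congr {v : CSpace N → EReal} (hu : SubharmonicOn u Ω) (h : EqOn v u Ω) :
    SubharmonicOn v Ω := by
  refine ⟨fun z hz => h hz ▸ hu.ne_top z hz, fun z hz => ?_, fun z hz r hr hsub => ?_⟩
  · intro y hy
    rw [h hz] at hy
    filter_upwards [hu.usc z hz y hy, self_mem_nhdsWithin] with x hx hxΩ
    rw [h hxΩ]
    exact hx
  · rw [h hz, ballMean_congr fun x hx => h (hsub (ball_subset_closedBall hx))]
    exact hu.sub_mean z hz r hr hsub

end Subharmonic

/-! ### Quadratic test functions and pointwise Hessian conditions -/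

section QuadForm

open scoped ComplexConjugate
open Metric

/-- The quadratic form of a matrix. -/
noncomputable def quadForm {M : ℕ} (H : Matrix (Fin M) (Fin M) ℂ) (w : CSpace M) : ℝ :=
  (∑ p : Fin M × Fin M, H p.1 p.2 * w p.1 * conj (w p.2)).re

theorem ofReal_quadForm {M : ℕ} {H : Matrix (Fin M) (Fin M) ℂ} (hH : H.IsHermitian) (w : CSpace M) :
    (quadForm H w : ℂ) = ∑ p : Fin M × Fin M, H p.1 p.2 * w p.1 * conj (w p.2) := by
  rw [quadForm]
  refine Complex.conj_eq_iff_re.1 ?_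
  rw [map_sum, ← (Equiv.prodComm _ _).sum_comp]
  refine Finset.sum_congr rfl fun p _ => ?_
  have := hH.apply p.1 p.2
  simp only [Equiv.prodComm_apply, Prod.fst_swap, Prod.snd_swap, map_mul, Complex.conj_conj]
  rw [starRingEnd_apply (H p.2 p.1), this]
  ring

theorem fderiv_sum_mul_conj {N : ℕ} {ι : Type*} [Fintype ι] {p q : ι → CSpace N → ℂ} {z : CSpace N}
    (hp : ∀ i, DifferentiableAt ℂ (p i) z) (hq : ∀ i, DifferentiableAt ℂ (q i) z) (v : CSpace N) :
    fderiv ℝ (fun w => ∑ i, p i w * conj (q i w)) z v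
      = ∑ i, (fderiv ℂ (p i) z v * conj (q i z) + p i z * conj (fderiv ℂ (q i) z v)) := by
  have hc : ∀ i, HasFDerivAt (fun w => conj (q i w))
      (Complex.conjCLE.toContinuousLinearMap ∘L (fderiv ℂ (q i) z).restrictScalars ℝ) z := fun i =>
    Complex.conjCLE.hasFDerivAt.comp z ((hq i).hasFDerivAt.restrictScalars ℝ)
  have h := HasFDerivAt.fun_sum (u := Finset.univ) fun i _ =>
    ((hp i).hasFDerivAt.restrictScalars ℝ).fun_mul (hc i)
  rw [h.fderiv, sum_apply]
  refine Finset.sum_congr rfl fun i _ => ?_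
  simp only [add_apply, smul_apply, smul_eq_mul, ContinuousLinearMap.comp_apply,
    ContinuousLinearMap.coe_restrictScalars', ContinuousLinearEquiv.coe_coe, Complex.conjCLE_apply]
  ring

theorem wirtingerBar_sum_mul_conj {N : ℕ} {ι : Type*} [Fintype ι] {p q : ι → CSpace N → ℂ}
    {z : CSpace N} (hp : ∀ i, DifferentiableAt ℂ (p i) z) (hq : ∀ i, DifferentiableAt ℂ (q i) z)
    (k : Fin N) : wirtingerBar k (fun w => ∑ i, p i w * conj (q i w)) z
      = ∑ i, p i z * conj (fderiv ℂ (q i) z (EuclideanSpace.single k 1)) := by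
  rw [wirtingerBar, fderiv_sum_mul_conj hp hq, fderiv_sum_mul_conj hp hq, Finset.mul_sum,
    ← Finset.sum_add_distrib, Finset.sum_div]
  refine Finset.sum_congr rfl fun i _ => ?_
  simp only [single_I_eq, map_smul, smul_eq_mul, map_mul, Complex.conj_I]
  linear_combination (fderiv ℂ (p i) z (EuclideanSpace.single k 1) * conj (q i z) / 2
    - p i z * conj (fderiv ℂ (q i) z (EuclideanSpace.single k 1)) / 2) * Complex.I_sq

theorem wirtinger_sum_mul_conj {N : ℕ} {ι : Type*} [Fintype ι] {p q : ι → CSpace N → ℂ}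
    {z : CSpace N} (hp : ∀ i, DifferentiableAt ℂ (p i) z) (hq : ∀ i, DifferentiableAt ℂ (q i) z)
    (k : Fin N) : wirtinger k (fun w => ∑ i, p i w * conj (q i w)) z
      = ∑ i, fderiv ℂ (p i) z (EuclideanSpace.single k 1) * conj (q i z) := by
  rw [wirtinger, fderiv_sum_mul_conj hp hq, fderiv_sum_mul_conj hp hq, Finset.mul_sum,
    ← Finset.sum_sub_distrib, Finset.sum_div]
  refine Finset.sum_congr rfl fun i _ => ?_
  simp only [single_I_eq, map_smul, smul_eq_mul, map_mul, Complex.conj_I]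
  linear_combination (-fderiv ℂ (p i) z (EuclideanSpace.single k 1) * conj (q i z) / 2
    + p i z * conj (fderiv ℂ (q i) z (EuclideanSpace.single k 1)) / 2) * Complex.I_sq

/-- The transposed Jacobian matrix `K_{ja} = ∂f_a/∂z_j`. -/
noncomputable def jacobian {N M : ℕ} (f : CSpace N → CSpace M) (z : CSpace N) :
    Matrix (Fin N) (Fin M) ℂ :=
  Matrix.of fun j a => fderiv ℂ (fun w => f w a) z (EuclideanSpace.single j 1)

theorem DifferentiableOn.coord {N M : ℕ} {f : CSpace N → CSpace M} {Ω : Set (CSpace N)}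
    (hf : DifferentiableOn ℂ f Ω) (a : Fin M) : DifferentiableOn ℂ (fun w => f w a) Ω :=
  (EuclideanSpace.proj (𝕜 := ℂ) a).differentiable.comp_differentiableOn hf

/-- In `∂_j ∂̄_k` of `∑ H_ab f_a conj(f_b)` the derivative `∂̄_k` sees only `conj(f_b)` and `∂_j`
only `f_a`; no second derivatives of `f` appear. -/
theorem complexHessian_quadForm_comp {N M : ℕ} {f : CSpace N → CSpace M} {Ω : Set (CSpace N)}
    (hΩ : IsOpen Ω) (hf : DifferentiableOn ℂ f Ω) {H : Matrix (Fin M) (Fin M) ℂ}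
    (hH : H.IsHermitian) {z : CSpace N} (hz : z ∈ Ω) :
    complexHessian (fun w => quadForm H (f w)) z = jacobian f z * H * (jacobian f z)ᴴ := by
  have hd : ∀ a, ∀ w ∈ Ω, DifferentiableAt ℂ (fun w => f w a) w := fun a w hw =>
    (hf.coord a).differentiableAt (hΩ.mem_nhds hw)
  have hd' : ∀ k a, DifferentiableAt ℂ (fun w => fderiv ℂ (fun w => f w a) w
      (EuclideanSpace.single k 1)) z := fun k a =>
    ((hf.coord a).fderiv_apply_complex hΩ _).differentiableAt (hΩ.mem_nhds hz)
  ext j k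
  let p : Fin M × Fin M → CSpace N → ℂ := fun i w => H i.1 i.2 * f w i.1
  let q : Fin M × Fin M → CSpace N → ℂ := fun i w => f w i.2
  let q' : Fin M × Fin M → CSpace N → ℂ := fun i w => fderiv ℂ (q i) w (EuclideanSpace.single k 1)
  have hp : ∀ i, ∀ w ∈ Ω, DifferentiableAt ℂ (p i) w := fun i w hw => (hd i.1 w hw).const_mul _
  have hq : ∀ i, ∀ w ∈ Ω, DifferentiableAt ℂ (q i) w := fun i w hw => hd i.2 w hw
  have hF : (fun w => (quadForm H (f w) : ℂ)) = fun w => ∑ i, p i w * conj (q i w) :=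
    funext fun w => ofReal_quadForm hH (f w)
  have hev : wirtingerBar k (fun w => (quadForm H (f w) : ℂ)) =ᶠ[nhds z]
      fun w => ∑ i, p i w * conj (q' i w) := by
    filter_upwards [hΩ.mem_nhds hz] with w hw
    rw [hF]
    exact wirtingerBar_sum_mul_conj (fun i => hp i w hw) (fun i => hq i w hw) k
  have h : wirtinger j (fun w => ∑ i, p i w * conj (q' i w)) z
      = ∑ i, fderiv ℂ (p i) z (EuclideanSpace.single j 1) * conj (q' i z) :=
    wirtinger_sum_mul_conj (fun i => hp i z hz) (fun i => hd' k i.2) j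
  rw [complexHessian, Matrix.of_apply, wirtinger, hev.fderiv_eq]
  refine h.trans ?_
  simp only [Matrix.mul_apply, Matrix.conjTranspose_apply, jacobian, Matrix.of_apply,
    Finset.sum_mul]
  rw [Fintype.sum_prod_type_right]
  refine Finset.sum_congr rfl fun b _ => Finset.sum_congr rfl fun a _ => ?_
  have h1 : fderiv ℂ (p (a, b)) z = H a b • fderiv ℂ (fun w => f w a) z :=
    fderiv_const_mul (hd a z hz) _
  rw [h1, smul_apply, smul_eq_mul, RCLike.star_def]
  ring

theorem contDiffOn_quadForm_comp {N M : ℕ} {f : CSpace N → CSpace M} {Ω : Set (CSpace N)}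
    (hΩ : IsOpen Ω) (hf : DifferentiableOn ℂ f Ω) (H : Matrix (Fin M) (Fin M) ℂ) :
    ContDiffOn ℝ 2 (fun w => quadForm H (f w)) Ω := by
  have hd : ∀ a, ContDiffOn ℝ 2 (fun w => f w a) Ω := fun a =>
    (((hf.coord a).contDiffOn_complex hΩ).of_le (WithTop.coe_le_coe.2 le_top)).restrict_scalars ℝ
  unfold quadForm
  refine Complex.reCLM.contDiff.comp_contDiffOn (ContDiffOn.sum fun p _ => ?_)
  exact (contDiffOn_const.mul (hd p.1)).mul (Complex.conjCLE.contDiff.comp_contDiffOn (hd p.2))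

theorem jacobian_id {M : ℕ} (z : CSpace M) : jacobian (fun w => w) z = 1 := by
  ext j a
  rw [jacobian, Matrix.of_apply]
  have h : fderiv ℂ (fun w : CSpace M => w a) z = EuclideanSpace.proj (𝕜 := ℂ) a :=
    (EuclideanSpace.proj (𝕜 := ℂ) a).fderiv
  rw [h]
  simp [Matrix.one_apply, eq_comm]

theorem complexHessian_quadForm {M : ℕ} {H : Matrix (Fin M) (Fin M) ℂ} (hH : H.IsHermitian)
    (z : CSpace M) : complexHessian (quadForm H) z = H := by
  have := complexHessian_quadForm_comp isOpen_univ (differentiableOn_id (𝕜 := ℂ)) hH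
    (Set.mem_univ z)
  rw [show (id : CSpace M → CSpace M) = fun w => w from rfl, jacobian_id] at this
  simpa using this

theorem contDiff_quadForm {M : ℕ} (H : Matrix (Fin M) (Fin M) ℂ) : ContDiff ℝ 2 (quadForm H) :=
  contDiffOn_univ.1 (contDiffOn_quadForm_comp isOpen_univ (differentiableOn_id (𝕜 := ℂ)) H)

theorem LinearIsometryEquiv.integral_ball_comp {M : ℕ} (g : CSpace M ≃ₗᵢ[ℝ] CSpace M)
    {F : Type*} [NormedAddCommGroup F] [NormedSpace ℝ F] (φ : CSpace M → F) (r : ℝ) :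
    ∫ y in ball 0 r, φ (g y) = ∫ y in ball 0 r, φ y := by
  have h := g.measurePreserving.setIntegral_preimage_emb
    g.toHomeomorph.measurableEmbedding φ (ball 0 r)
  rw [← h]
  congr 2
  ext y
  simp

/-- Changing the sign of the coordinate `a` is an isometry that reverses the integrand. -/
theorem integral_ball_mul_conj_of_ne {M : ℕ} {a b : Fin M} (hab : a ≠ b) (r : ℝ) :
    ∫ y in ball (0 : CSpace M) r, y a * conj (y b) = 0 := by
  let g : CSpace M ≃ₗᵢ[ℝ] CSpace M := LinearIsometryEquiv.piLpCongrRight 2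
    fun i => if i = a then LinearIsometryEquiv.neg ℝ else LinearIsometryEquiv.refl ℝ ℂ
  have h := g.integral_ball_comp (fun y => y a * conj (y b)) r
  have h1 : ∀ y, g y a * conj (g y b) = -(y a * conj (y b)) := by
    intro y
    simp [g, hab.symm]
  simp only [h1, integral_neg] at h
  exact CharZero.eq_neg_self_iff.1 h.symm

theorem integral_ball_mul_conj_self {M : ℕ} (a b : Fin M) (r : ℝ) :
    ∫ y in ball (0 : CSpace M) r, y a * conj (y a)
      = ∫ y in ball (0 : CSpace M) r, y b * conj (y b) := by
  let g : CSpace M ≃ₗᵢ[ℝ] CSpace M := LinearIsometryEquiv.piLpCongrLeft 2 ℝ ℂ (Equiv.swap a b)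
  have h := g.integral_ball_comp (fun y => y b * conj (y b)) r
  rw [← h]
  have h1 : ∀ y, g y b = y a := by
    intro y
    simp [g, LinearIsometryEquiv.piLpCongrLeft_apply, Equiv.piCongrLeft']
  simp only [h1]

/-- By the coordinate symmetries of the ball only the diagonal contributes, and the integral is the
real part of the trace times `∫ |y_a|²`. -/
theorem integral_ball_quadForm_nonneg {M : ℕ} {H : Matrix (Fin M) (Fin M) ℂ}
    (hH : 0 ≤ H.trace.re) (r : ℝ) : 0 ≤ ∫ y in ball (0 : CSpace M) r, quadForm H y := by
  rcases Nat.eq_zero_or_pos M with rfl | hM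
  · simp [quadForm]
  have hint : ∀ p : Fin M × Fin M, IntegrableOn
      (fun y : CSpace M => H p.1 p.2 * y p.1 * conj (y p.2)) (ball 0 r) := by
    intro p
    refine IntegrableOn.mono_set (t := closedBall 0 r) ?_ ball_subset_closedBall
    refine ContinuousOn.integrableOn_compact (isCompact_closedBall 0 r) (Continuous.continuousOn ?_)
    fun_prop
  have h1 := Complex.reCLM.integral_comp_comm (integrable_finsetSum Finset.univ fun p _ => hint p)
  simp only [Complex.reCLM_apply] at h1
  unfold quadForm
  rw [h1, integral_finsetSum _ fun p _ => hint p]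
  set a₀ : Fin M := ⟨0, hM⟩
  have h2 : ∀ p : Fin M × Fin M, ∫ y in ball (0 : CSpace M) r, H p.1 p.2 * y p.1 * conj (y p.2)
      = if p.1 = p.2 then H p.1 p.2 * ∫ y in ball (0 : CSpace M) r, y a₀ * conj (y a₀) else 0 := by
    intro p
    simp only [mul_assoc]
    rw [integral_const_mul]
    split_ifs with h
    · rw [← h, integral_ball_mul_conj_self p.1 a₀]
    · rw [integral_ball_mul_conj_of_ne h, mul_zero]
  have h3 : ∫ y in ball (0 : CSpace M) r, y a₀ * conj (y a₀)
      = ((∫ y in ball (0 : CSpace M) r, Complex.normSq (y a₀) : ℝ) : ℂ) := by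
    simp only [Complex.mul_conj]
    exact integral_complex_ofReal
  simp only [h2, h3]
  rw [Fintype.sum_prod_type]
  simp only [Finset.sum_ite_eq, Finset.mem_univ, if_true]
  rw [← Finset.sum_mul, Complex.re_mul_ofReal]
  exact mul_nonneg hH (integral_nonneg fun _ => Complex.normSq_nonneg _)

theorem quadForm_parallelogram {M : ℕ} (H : Matrix (Fin M) (Fin M) ℂ) (z y : CSpace M) :
    quadForm H (z + y) + quadForm H (z - y) = 2 * quadForm H z + 2 * quadForm H y := by
  simp only [quadForm, ← Complex.add_re, ← Complex.re_ofReal_mul, Finset.mul_sum,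
    ← Finset.sum_add_distrib]
  congr 1
  refine Finset.sum_congr rfl fun p _ => ?_
  simp only [PiLp.add_apply, PiLp.sub_apply, map_add, map_sub, Complex.ofReal_ofNat]
  ring

/-- Averaging over `y` and `-y`, the parallelogram law gives the mean over a ball about `z` as
`quadForm H z` plus the mean about `0`, which is nonnegative. -/
theorem subharmonicOn_quadForm {M : ℕ} {H : Matrix (Fin M) (Fin M) ℂ}
    (hH : 0 ≤ H.trace.re) (Ω : Set (CSpace M)) :
    SubharmonicOn (fun w => (quadForm H w : EReal)) Ω := by
  have hcont : Continuous (quadForm H) := (contDiff_quadForm H).continuous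
  refine ⟨fun _ _ => EReal.coe_ne_top _,
    (continuous_coe_real_ereal.comp hcont).upperSemicontinuous.upperSemicontinuousOn _,
    fun z _ r hr _ => ?_⟩
  have hint : ∀ c (φ : CSpace M → ℝ), Continuous φ → IntegrableOn φ (ball c r) := fun c φ hφ =>
    (hφ.continuousOn.integrableOn_compact (isCompact_closedBall c r)).mono_set ball_subset_closedBall
  rw [ballMean_coe (hint z _ hcont), EReal.coe_le_coe_iff, setAverage_eq, smul_eq_mul]
  have hv : 0 < volume.real (ball z r) :=
    ENNReal.toReal_pos (measure_ball_pos volume z hr).ne' measure_ball_lt_top.ne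
  rw [← div_eq_inv_mul, le_div_iff₀ hv]
  have hshift : ∫ x in ball z r, quadForm H x = ∫ y in ball 0 r, quadForm H (z + y) := by
    have h := (measurePreserving_add_left volume z).setIntegral_preimage_emb
      (Homeomorph.addLeft z).measurableEmbedding (quadForm H) (ball z r)
    rw [← h]
    congr 2
    ext y
    simp
  have hneg : ∫ y in ball 0 r, quadForm H (z - y) = ∫ y in ball 0 r, quadForm H (z + y) := by
    have h := (LinearIsometryEquiv.neg ℝ (E := CSpace M)).integral_ball_comp
      (fun y => quadForm H (z + y)) r
    simpa [sub_eq_add_neg] using h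
  have hsum : ∫ y in ball 0 r, (quadForm H (z + y) + quadForm H (z - y))
      = 2 * ∫ y in ball 0 r, quadForm H (z + y) := by
    rw [integral_add (hint _ _ (by fun_prop)) (hint _ _ (by fun_prop)), hneg, two_mul]
  simp only [quadForm_parallelogram] at hsum
  rw [integral_add (hint _ _ (by fun_prop)) (hint _ _ (by fun_prop)), integral_const_mul,
    integral_const_mul, setIntegral_const, smul_eq_mul,
    show volume.real (ball (0 : CSpace M) r) = volume.real (ball z r) by
      rw [measureReal_def, measureReal_def, ← Measure.addHaar_ball_center volume z]] at hsum
  rw [hshift]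
  linarith [integral_ball_quadForm_nonneg hH r]

theorem trace_nonneg_of_mem_gammaCone {M m : ℕ} (hm1 : 1 ≤ m) (hm : m ≤ M)
    {H : Matrix (Fin M) (Fin M) ℂ} (hH : H ∈ gammaCone M m) : 0 ≤ H.trace.re := by
  have : Nonempty (Fin M) := ⟨⟨0, by omega⟩⟩
  have h := ((mem_gammaCone_iff_coeff hm).1 hH).2 1 le_rfl hm1
  have h2 := Matrix.trace_eq_neg_charpoly_coeff (-H)
  rw [Fintype.card_fin, Matrix.trace_neg, neg_inj] at h2
  rwa [h2]

theorem integral_mul_volDensity {N : ℕ} {G χ : CSpace N → ℝ} {Ω : Set (CSpace N)}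
    (hΩ : IsOpen Ω) (hG : ContDiffOn ℝ 2 G Ω) (hχ : IsTestFunction χ Ω) (Θ : ConstForm N) :
    ∫ z in Ω, G z * volDensity (form11 (complexHessian χ z) * Θ)
      = ∫ z, volDensity (form11 (complexHessian G z) * Θ) * χ z :=
  integral_mul_wedge hΩ hG hχ (wedgeFunctional Θ)

/-- The Hessian is the constant `H`. After integration by parts the integrand is `χ` times the polar
form of `H` and the `α_i`. -/
theorem kSubharmonicOn_quadForm {M m : ℕ} (hm1 : 1 ≤ m) (hm : m ≤ M)
    {H : Matrix (Fin M) (Fin M) ℂ} (hH : H ∈ gammaCone M m) {Ω : Set (CSpace M)} (hΩ : IsOpen Ω) :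
    KSubharmonicOn m (fun w => (quadForm H w : EReal)) Ω := by
  obtain ⟨m, rfl⟩ : ∃ m', m = m' + 1 := ⟨m - 1, by omega⟩
  refine ⟨subharmonicOn_quadForm (trace_nonneg_of_mem_gammaCone hm1 hm hH) Ω,
    fun α hα χ h1 h2 h3 h4 => ?_⟩
  simp only [EReal.toReal_coe]
  rw [integral_mul_volDensity hΩ (contDiff_quadForm H).contDiffOn ⟨h1, h2, h3, h4⟩]
  refine integral_nonneg fun z => mul_nonneg ?_ (h4 z)
  rw [complexHessian_quadForm hH.1, volDensity_form11_mul]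
  change 0 ≤ (wedgeFunctional ((List.ofFn fun i : Fin m => form11 (α i)).prod
    * kahlerForm M ^ (M - (m + 1))) H).re
  rw [wedgeFunctional_prod]
  exact polarForm_nonneg hm _ fun i => Fin.cases hH hα i

/-- The complex Hessian of a smooth `k`-subharmonic function lies in `Γ_k`. -/
theorem KSubharmonicOn.complexHessian_mem {N k : ℕ} (hk1 : 1 ≤ k) (hk : k ≤ N)
    {G : CSpace N → ℝ} {Ω : Set (CSpace N)} (hΩ : IsOpen Ω) (hG : ContDiffOn ℝ 2 G Ω)
    (hu : KSubharmonicOn k (fun z => (G z : EReal)) Ω) {z : CSpace N} (hz : z ∈ Ω) :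
    complexHessian G z ∈ gammaCone N k := by
  obtain ⟨k, rfl⟩ : ∃ k', k = k' + 1 := ⟨k - 1, by omega⟩
  refine mem_gammaCone_of_forall hk
    (isHermitian_complexHessian (hG.contDiffAt (hΩ.mem_nhds hz))) fun a ha => ?_
  rw [← wedgeFunctional_prod]
  set Λ := wedgeFunctional ((List.ofFn fun _ : Fin k => form11 a).prod
    * kahlerForm N ^ (N - (k + 1))) with hΛ
  have hcont : ContinuousOn (fun w => (Λ (complexHessian G w)).re) Ω := by
    simp only [fun w => linearMap_matrix_apply Λ (complexHessian G w)]
    refine Complex.continuous_re.comp_continuousOn (continuousOn_finsetSum _ fun i _ =>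
      continuousOn_finsetSum _ fun j _ => ?_)
    exact (hG.continuousOn_complexHessian hΩ i j).mul continuousOn_const
  -- A bump function supported where the density is negative would violate the inequality of
  -- currents.
  by_contra! hneg
  have hopen : IsOpen (Ω ∩ (fun w => (Λ (complexHessian G w)).re) ⁻¹' Set.Iio 0) :=
    hcont.isOpen_inter_preimage hΩ isOpen_Iio
  obtain ⟨χ, hχs, hχc, hχsm, hχr, hχz⟩ := exists_contDiff_tsupport_subset (n := ⊤)
    (hopen.mem_nhds ⟨hz, hneg⟩)
  have hχ0 : ∀ w, 0 ≤ χ w := fun w => (hχr ⟨w, rfl⟩).1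
  have hχ : IsTestFunction χ Ω := ⟨hχsm, hχc, hχs.trans Set.inter_subset_left, hχ0⟩
  have h := hu.ddc_nonneg (fun _ => a) (fun _ => ha) χ hχ.smooth hχ.compact hχ.subset hχ.nonneg
  simp only [EReal.toReal_coe] at h
  rw [integral_mul_volDensity hΩ hG hχ] at h
  have hle : ∀ w, (Λ (complexHessian G w)).re * χ w ≤ 0 := by
    intro w
    by_cases hw : w ∈ tsupport χ
    · exact mul_nonpos_of_nonpos_of_nonneg (hχs hw).2.le (hχ0 w)
    · rw [image_eq_zero_of_notMem_tsupport hw, mul_zero]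
  have hcont2 := continuous_mul_of_tsupport hΩ hcont hχ.smooth.continuous hχ.subset
  have hpos : 0 < ∫ w, -((Λ (complexHessian G w)).re * χ w) := by
    refine hcont2.neg.integral_pos_of_hasCompactSupport_nonneg_nonzero (x := z)
      hχc.mul_left.neg (fun w => neg_nonneg.2 (hle w)) ?_
    rw [hχz, mul_one]
    exact (neg_pos.2 hneg).ne'
  rw [integral_neg] at hpos
  change 0 ≤ ∫ w, (Λ (complexHessian G w)).re * χ w at h
  linarith

end QuadForm

/-! ### From the morphism property to homothety -/

section Rigidity

open scoped ComplexConjugate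

variable {N M m n : ℕ} {f : CSpace N → CSpace M} {ΩN : Set (CSpace N)} {ΩM : Set (CSpace M)}

theorem ContinuousLinearMap.eq_zero_of_single {F : Type*} [NormedAddCommGroup F] [NormedSpace ℂ F]
    {L : CSpace N →L[ℂ] F} (h : ∀ i, L (EuclideanSpace.single i 1) = 0) : L = 0 := by
  refine ContinuousLinearMap.coe_injective ((EuclideanSpace.basisFun (Fin N) ℂ).toBasis.ext fun i => ?_)
  simpa using h i

theorem exists_const_of_fderiv_single_eq_zero (hΩ : IsOpen ΩN) (hΩ' : IsConnected ΩN)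
    {g : CSpace N → ℂ} (hg : DifferentiableOn ℂ g ΩN)
    (h : ∀ z ∈ ΩN, ∀ i, fderiv ℂ g z (EuclideanSpace.single i 1) = 0) :
    ∃ c, ∀ z ∈ ΩN, g z = c :=
  hΩ.exists_is_const_of_fderiv_eq_zero hΩ'.isPreconnected hg fun z hz =>
    ContinuousLinearMap.eq_zero_of_single (h z hz)

theorem isConstantOn_of_jacobian_eq_zero (hΩ : IsOpen ΩN) (hΩ' : IsConnected ΩN)
    (hf : DifferentiableOn ℂ f ΩN) (h : ∀ z ∈ ΩN, jacobian f z = 0) : IsConstantOn f ΩN := by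
  have h1 : ∀ a, ∃ c, ∀ z ∈ ΩN, f z a = c := fun a =>
    exists_const_of_fderiv_single_eq_zero hΩ hΩ' (hf.coord a) fun z hz i =>
      congrFun (congrFun (h z hz) i) a
  choose c hc using h1
  exact ⟨WithLp.toLp 2 c, fun z hz => by ext a; exact hc a z hz⟩

/-- The differential of a subharmonic morphism is a multiple of a coisometry. -/
theorem IsSubharmonicMorphism.exists_smul_one (hm1 : 1 ≤ m) (hmM : m < M) (hmn : m ≤ n)
    (hnN : n ≤ N) (hΩN : IsOpen ΩN) (hΩM : IsOpen ΩM) (hf : DifferentiableOn ℂ f ΩN)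
    (h : IsSubharmonicMorphism m n f ΩN ΩM) {z : CSpace N} (hz : z ∈ ΩN) :
    ∃ c : ℝ, (jacobian f z)ᴴ * jacobian f z = (c : ℂ) • 1 ∧ (m < n → c = 0) ∧ (N < M → c = 0) := by
  refine exists_smul_one_of_congr_mem hm1 hmM hmn hnN _ fun H hH => ?_
  rw [← complexHessian_quadForm_comp hΩN hf hH.1 hz]
  exact (h _ (kSubharmonicOn_quadForm hm1 hmM.le hH hΩM)).complexHessian_mem (hm1.trans hmn) hnN
    hΩN (contDiffOn_quadForm_comp hΩN hf H) hz

/-- Here the factor `c` vanishes, so `Kᴴ K = 0` and the Jacobian is zero. -/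
theorem IsSubharmonicMorphism.isConstantOn (hm1 : 1 ≤ m) (hmM : m < M) (hmn : m ≤ n)
    (hnN : n ≤ N) (hΩN : IsOpen ΩN) (hΩN' : IsConnected ΩN) (hΩM : IsOpen ΩM)
    (hf : DifferentiableOn ℂ f ΩN) (h : IsSubharmonicMorphism m n f ΩN ΩM) (hlt : m < n ∨ N < M) :
    IsConstantOn f ΩN := by
  refine isConstantOn_of_jacobian_eq_zero hΩN hΩN' hf fun z hz => ?_
  obtain ⟨c, hc, h1, h2⟩ := h.exists_smul_one hm1 hmM hmn hnN hΩN hΩM hf hz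
  rw [hlt.elim h1 h2, Complex.ofReal_zero, zero_smul] at hc
  open scoped ComplexOrder in exact Matrix.conjTranspose_mul_self_eq_zero.1 hc

theorem conjTranspose_jacobian_mul_apply (f : CSpace N → CSpace M) (z : CSpace N) (a b : Fin M) :
    ((jacobian f z)ᴴ * jacobian f z) b a
      = ∑ i, fderiv ℂ (fun w => f w a) z (EuclideanSpace.single i 1)
        * conj (fderiv ℂ (fun w => f w b) z (EuclideanSpace.single i 1)) := by
  rw [Matrix.mul_apply]
  exact Finset.sum_congr rfl fun i _ => mul_comm _ _

/-- A holomorphic map whose differential is everywhere a multiple of a coisometry is homothetic. -/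
theorem isHomotheticProjectionOn_of_jacobian (hM : 1 < M) (hΩ : IsOpen ΩN) (hΩ' : IsConnected ΩN)
    (hf : DifferentiableOn ℂ f ΩN)
    (h : ∀ z ∈ ΩN, ∃ c : ℝ, (jacobian f z)ᴴ * jacobian f z = (c : ℂ) • 1) :
    IsHomotheticProjectionOn f ΩN := by
  have hoff : ∀ z ∈ ΩN, ∀ a b, a ≠ b →
      ∑ i, fderiv ℂ (fun w => f w a) z (EuclideanSpace.single i 1)
        * conj (fderiv ℂ (fun w => f w b) z (EuclideanSpace.single i 1)) = 0 := by
    intro z hz a b hab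
    obtain ⟨c, hc⟩ := h z hz
    rw [← conjTranspose_jacobian_mul_apply, hc, Matrix.smul_apply, Matrix.one_apply_ne hab.symm,
      smul_zero]
  have hdiag : ∀ z ∈ ΩN, ∃ c : ℝ, ∀ a,
      ∑ i, fderiv ℂ (fun w => f w a) z (EuclideanSpace.single i 1)
        * conj (fderiv ℂ (fun w => f w a) z (EuclideanSpace.single i 1)) = c := by
    intro z hz
    obtain ⟨c, hc⟩ := h z hz
    refine ⟨c, fun a => ?_⟩
    rw [← conjTranspose_jacobian_mul_apply, hc, Matrix.smul_apply, Matrix.one_apply_eq,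
      smul_eq_mul, mul_one]
  have hJ : ∀ a i, ∃ x, ∀ z ∈ ΩN, fderiv ℂ (fun w => f w a) z (EuclideanSpace.single i 1) = x := by
    intro a i
    refine exists_const_of_fderiv_single_eq_zero hΩ hΩ' ((hf.coord a).fderiv_apply_complex hΩ _)
      fun z hz j => ?_
    refine fderiv_fderiv_eq_zero_of_orthogonal hM (fun a w => f w a) hΩ (fun a => hf.coord a)
      hoff (fun z hz a b => ?_) hz a i j
    obtain ⟨c, hc⟩ := hdiag z hz
    rw [hc, hc]
  choose X hX using hJ
  have haff : ∀ a, ∃ w₀, ∀ z ∈ ΩN, f z a - ∑ i, X a i * z i = w₀ := by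
    intro a
    have hlin : ∀ z : CSpace N, HasFDerivAt (fun z : CSpace N => ∑ i, X a i * z i)
        (∑ i, X a i • EuclideanSpace.proj (𝕜 := ℂ) i) z := fun z =>
      HasFDerivAt.fun_sum fun i _ => (EuclideanSpace.proj (𝕜 := ℂ) i).hasFDerivAt.const_mul _
    refine exists_const_of_fderiv_single_eq_zero hΩ hΩ'
      ((hf.coord a).sub fun z _ => (hlin z).differentiableAt.differentiableWithinAt)
      fun z hz j => ?_
    have h1 := (((hf.coord a).differentiableAt (hΩ.mem_nhds hz)).hasFDerivAt.fun_sub (hlin z)).fderiv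
    rw [h1, sub_apply, hX a j z hz, sum_apply]
    simp
  choose w₀ hw₀ using haff
  obtain ⟨z₀, hz₀⟩ := hΩ'.nonempty
  have hinner : ∀ a b, inner ℂ (WithLp.toLp 2 (X b) : CSpace N) (WithLp.toLp 2 (X a))
      = ∑ i, X a i * conj (X b i) := fun a b => by
    rw [PiLp.inner_apply]
    rfl
  -- The rows are the constant gradients themselves, so the homothety factor can be `1`.
  refine ⟨1, fun a => WithLp.toLp 2 (X a), WithLp.toLp 2 w₀, fun a b => ?_, fun a b hab => ?_,
    fun z hz => ?_⟩
  · obtain ⟨c, hc⟩ := hdiag z₀ hz₀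
    simp only [hX _ _ z₀ hz₀] at hc
    rw [← sq_eq_sq₀ (norm_nonneg _) (norm_nonneg _), ← Complex.ofReal_inj]
    push_cast
    rw [← Complex.coe_algebraMap]
    have h1 := fun a => inner_self_eq_norm_sq_to_K (𝕜 := ℂ) (WithLp.toLp 2 (X a) : CSpace N)
    simp only [hinner, hc] at h1
    exact (h1 a).symm.trans (h1 b)
  · have := hoff z₀ hz₀ b a hab.symm
    simp only [hX _ _ z₀ hz₀] at this
    rw [hinner, this]
  · ext a
    simp only [Complex.ofReal_one, one_smul, PiLp.add_apply, Matrix.mulVec, dotProduct,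
      Matrix.of_apply]
    exact eq_add_of_sub_eq' (hw₀ a z hz)

end Rigidity

/-! ### Constant maps -/

section Constant

variable {N : ℕ} {Ω : Set (CSpace N)}

theorem KSubharmonicOn.congr {k : ℕ} {u v : CSpace N → EReal} (hΩ : IsOpen Ω)
    (hu : KSubharmonicOn k u Ω) (h : Set.EqOn v u Ω) : KSubharmonicOn k v Ω := by
  refine ⟨hu.subharmonic.congr h, fun α hα χ h1 h2 h3 h4 => ?_⟩
  rw [setIntegral_congr_fun (g := fun z => (u z).toReal * volDensity (form11 (complexHessian χ z) *
    ((List.ofFn fun i => form11 (α i)).prod * kahlerForm N ^ (N - k)))) hΩ.measurableSet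
    fun z hz => by simp only [h hz]]
  exact hu.ddc_nonneg α hα χ h1 h2 h3 h4

theorem complexHessian_const (c : ℝ) (z : CSpace N) : complexHessian (fun _ => c) z = 0 := by
  ext j k
  have h : wirtingerBar k (fun _ : CSpace N => (c : ℂ)) = fun _ => 0 := by
    ext w
    simp [wirtingerBar]
  simp [complexHessian, wirtinger, h]

theorem kSubharmonicOn_const (k : ℕ) (hΩ : IsOpen Ω) {c : EReal} (hc : c ≠ ⊤) :
    KSubharmonicOn k (fun _ => c) Ω := by
  refine ⟨SubharmonicOn.const c hc, fun α hα χ h1 h2 h3 h4 => ?_⟩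
  rw [integral_mul_volDensity (G := fun _ => c.toReal) hΩ contDiffOn_const ⟨h1, h2, h3, h4⟩]
  simp only [complexHessian_const, volDensity_form11_mul, map_zero, Complex.zero_re, zero_mul,
    integral_zero, le_refl]

theorem IsConstantOn.isSubharmonicMorphism {M m n : ℕ} {f : CSpace N → CSpace M}
    {ΩM : Set (CSpace M)} (hΩ : IsOpen Ω) (hne : Ω.Nonempty) (hmaps : Set.MapsTo f Ω ΩM)
    (h : IsConstantOn f Ω) : IsSubharmonicMorphism m n f Ω ΩM := by
  intro φ hφ
  obtain ⟨w, hw⟩ := h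
  obtain ⟨z, hz⟩ := hne
  have hwΩ : w ∈ ΩM := hw z hz ▸ hmaps hz
  refine (kSubharmonicOn_const n hΩ (hφ.subharmonic.ne_top w hwΩ)).congr hΩ fun z hz => ?_
  simp only [Function.comp_apply, hw z hz]

end Constant

/-! ### The sub-mean value inequality without subtraction of infinities -/

section SubMean

open Metric

/-- The identity `C + x⁻ = (C - x) + x⁺` has only nonnegative terms and stays true at `x = -∞`, so
it may be integrated. -/
theorem ofReal_add_toENNReal_neg {C : ℝ} (hC : 0 ≤ C) {x : EReal} (hx : x ≤ C) :
    ENNReal.ofReal C + (-x).toENNReal = (C - x).toENNReal + x.toENNReal := by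
  induction x with
  | bot => simp [sub_eq_add_neg]
  | top => simp at hx
  | coe x =>
    have h1 : ∀ y : ℝ, (y : EReal).toENNReal = ENNReal.ofReal y := fun y => by
      rw [EReal.toENNReal_of_ne_top (EReal.coe_ne_top _), EReal.toReal_coe]
    have hx' : x ≤ C := EReal.coe_le_coe_iff.1 hx
    rw [← EReal.coe_neg, ← EReal.coe_sub, h1, h1, h1]
    rcases le_total 0 x with h | h
    · rw [ENNReal.ofReal_of_nonpos (neg_nonpos.2 h), add_zero,
        ← ENNReal.ofReal_add (sub_nonneg.2 hx') h, sub_add_cancel]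
    · rw [ENNReal.ofReal_of_nonpos h, add_zero, ← ENNReal.ofReal_add hC (neg_nonneg.2 h),
        sub_eq_add_neg]

/-- The sub-mean value inequality, in terms of the nonnegative function `C - u`. -/
theorem le_ballMean_iff {N : ℕ} {u : CSpace N → EReal} {z : CSpace N} {r : ℝ} (hr : 0 < r)
    {C : ℝ} (hC : 0 ≤ C) (hu : ∀ x ∈ ball z r, u x ≤ C)
    (hmeas : AEMeasurable u (volume.restrict (ball z r))) :
    u z ≤ ballMean u z r ↔ ∫⁻ x in ball z r, (C - u x).toENNReal
      ≤ volume (ball z r) * (C - u z).toENNReal := by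
  have hv0 : volume (ball z r) ≠ 0 := (measure_ball_pos volume z hr).ne'
  have hvt : volume (ball z r) ≠ ⊤ := measure_ball_lt_top.ne
  set P := ⨍⁻ x in ball z r, (u x).toENNReal ∂volume with hP
  set Q := ⨍⁻ x in ball z r, (-u x).toENNReal ∂volume with hQ
  set D := ⨍⁻ x in ball z r, (C - u x).toENNReal ∂volume with hD
  have hPC : P ≤ ENNReal.ofReal C := by
    rw [hP, setLAverage_eq]
    refine ENNReal.div_le_of_le_mul ?_
    rw [← setLIntegral_const]
    refine setLIntegral_mono measurable_const fun x hx => ?_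
    refine (EReal.toENNReal_le_toENNReal (hu x hx)).trans ?_
    rw [EReal.toENNReal_of_ne_top (EReal.coe_ne_top _), EReal.toReal_coe]
  have hsum : ENNReal.ofReal C + Q = D + P := by
    rw [hP, hQ, hD, setLAverage_eq, setLAverage_eq, setLAverage_eq, ← ENNReal.add_div,
      ← lintegral_add_right' _ hmeas.ereal_toENNReal]
    rw [← setLIntegral_congr_fun measurableSet_ball fun x hx => ofReal_add_toENNReal_neg hC (hu x hx),
      lintegral_add_left measurable_const, setLIntegral_const, ENNReal.add_div,
      ENNReal.mul_div_cancel_right hv0 hvt]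
  have hD' : (∫⁻ x in ball z r, (C - u x).toENNReal ≤ volume (ball z r) * (C - u z).toENNReal)
      ↔ D ≤ (C - u z).toENNReal := by
    rw [hD, setLAverage_eq, ENNReal.div_le_iff hv0 hvt, mul_comm]
  rw [hD', ballMean, ← hP, ← hQ]
  have hPt : P ≠ ⊤ := (hPC.trans_lt ENNReal.ofReal_lt_top).ne
  have hzC := hu z (mem_ball_self hr)
  generalize u z = x at hzC ⊢
  induction x with
  | bot => simp [sub_eq_add_neg]
  | top => simp at hzC
  | coe x =>
    rw [← EReal.coe_sub, EReal.toENNReal_of_ne_top (EReal.coe_ne_top _), EReal.toReal_coe]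
    have hxC : x ≤ C := EReal.coe_le_coe_iff.1 hzC
    by_cases hQt : Q = ⊤
    · have hDt : D = ⊤ := by
        by_contra hDt
        rw [hQt, add_top] at hsum
        exact (ENNReal.add_ne_top.2 ⟨hDt, hPt⟩) hsum.symm
      rw [hQt, hDt, EReal.coe_ennreal_top, EReal.sub_top]
      · simp
    · have hDt : D ≠ ⊤ := fun hDt => by
        rw [hDt, top_add] at hsum
        exact (ENNReal.add_ne_top.2 ⟨ENNReal.ofReal_ne_top, hQt⟩) hsum
      clear_value P Q D
      lift P to NNReal using hPt
      lift Q to NNReal using hQt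
      lift D to NNReal using hDt
      rw [ENNReal.ofReal] at hsum ⊢
      norm_cast at hsum
      have hs := congrArg NNReal.toReal hsum
      push_cast at hs
      rw [Real.coe_toNNReal _ hC] at hs
      rw [ENNReal.coe_le_coe, ← NNReal.coe_le_coe, Real.coe_toNNReal _ (sub_nonneg.2 hxC)]
      have e : ∀ p : NNReal, (((p : NNReal) : ENNReal) : EReal) = ((p : ℝ) : EReal) := fun _ => rfl
      rw [e, e, ← EReal.coe_sub, EReal.coe_le_coe_iff]
      constructor <;> intro h <;> linarith

end SubMean

/-! ### Orthogonal slicing and Fubini -/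

section Slicing

open Metric

/-- A decomposition of `ℂ^N` into the affine slices `R (ℂ^M) + ι k`, on which the affine map
`z ↦ J z + w₀` is bijective. -/
structure Slicing (N M : ℕ) (K : Type*) [NormedAddCommGroup K] [NormedSpace ℝ K]
    [MeasurableSpace K] (ν : Measure K) where
  J : CSpace N →L[ℂ] CSpace M
  R : CSpace M →L[ℂ] CSpace N
  ι : K →L[ℝ] CSpace N
  w₀ : CSpace M
  lam : ℝ
  lam_pos : 0 < lam
  J_R : ∀ w, J (R w) = w
  J_ι : ∀ k, J (ι k) = 0
  exists_fiber : ∀ z, ∃ k, z = R (J z) + ι k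
  norm_sq : ∀ w k, ‖R w + ι k‖ ^ 2 = ‖w‖ ^ 2 / lam + ‖k‖ ^ 2
  C : ENNReal
  C_ne_top : C ≠ ⊤
  gram : (Matrix.of fun j a => J (EuclideanSpace.single j 1) a : Matrix (Fin N) (Fin M) ℂ)ᴴ
    * (Matrix.of fun j a => J (EuclideanSpace.single j 1) a) = (lam : ℂ) • 1
  volume_eq : (volume : Measure (CSpace N))
    = C • ((volume : Measure (CSpace M)).prod ν).map fun p => R (p.1 - w₀) + ι p.2

/-- Uniqueness of Haar measure up to a factor; the translation by `w₀` does not change the product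
measure. The value of the factor is never needed. -/
theorem exists_volume_eq_smul_map {E W K : Type*} [NormedAddCommGroup E] [NormedSpace ℝ E]
    [FiniteDimensional ℝ E] [MeasurableSpace E] [BorelSpace E] [NormedAddCommGroup W]
    [NormedSpace ℝ W] [FiniteDimensional ℝ W] [MeasurableSpace W] [BorelSpace W]
    [NormedAddCommGroup K] [NormedSpace ℝ K] [FiniteDimensional ℝ K] [MeasurableSpace K]
    [BorelSpace K] (μ : Measure E) [μ.IsAddHaarMeasure] (ρ : Measure W) [ρ.IsAddHaarMeasure]
    (ν : Measure K) [ν.IsAddHaarMeasure] (Ψ : (W × K) ≃L[ℝ] E) (w₀ : W) :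
    ∃ C : ENNReal, C ≠ ⊤ ∧ μ = C • (ρ.prod ν).map fun p => Ψ (p.1 - w₀, p.2) := by
  have h1 : (ρ.prod ν).map (fun p => Ψ (p.1 - w₀, p.2)) = (ρ.prod ν).map Ψ := by
    have h2 : (fun p : W × K => Ψ (p.1 - w₀, p.2)) = Ψ ∘ fun p => p + (-w₀, 0) := by
      ext p
      rw [Function.comp_apply, Prod.add_def, add_zero, sub_eq_add_neg]
    rw [h2, ← Measure.map_map Ψ.continuous.measurable (measurable_add_const _),
      map_add_right_eq_self]
  have h3 : ((ρ.prod ν).map Ψ).IsAddHaarMeasure :=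
    Ψ.isAddHaarMeasure_map _
  refine ⟨(μ.addHaarScalarFactor ((ρ.prod ν).map Ψ) : ENNReal), ENNReal.coe_ne_top, ?_⟩
  rw [h1]
  exact Measure.isAddLeftInvariant_eq_smul μ ((ρ.prod ν).map Ψ)

namespace Slicing

variable {N M : ℕ} {K : Type*} [NormedAddCommGroup K] [NormedSpace ℝ K] [MeasurableSpace K]
  {ν : Measure K} (S : Slicing N M K ν)

/-- The affine projection. -/
noncomputable def proj (z : CSpace N) : CSpace M := S.J z + S.w₀

/-- The slices. -/
noncomputable def slice (k : K) (w : CSpace M) : CSpace N := S.R (w - S.w₀) + S.ι k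

theorem proj_slice (k : K) (w : CSpace M) : S.proj (S.slice k w) = w := by
  rw [proj, slice, map_add, S.J_R, S.J_ι, add_zero, sub_add_cancel]

theorem exists_slice_eq (z : CSpace N) : ∃ k, z = S.slice k (S.proj z) := by
  obtain ⟨k, hk⟩ := S.exists_fiber z
  exact ⟨k, by rw [slice, proj, add_sub_cancel_right, ← hk]⟩

theorem slice_sub (k k' : K) (w w' : CSpace M) :
    ‖S.slice k w - S.slice k' w'‖ ^ 2 = ‖w - w'‖ ^ 2 / S.lam + ‖k - k'‖ ^ 2 := by
  rw [← S.norm_sq, slice, slice, map_sub, map_sub, map_sub, map_sub]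
  congr 2
  abel

theorem continuous_slice : Continuous fun p : CSpace M × K => S.slice p.2 p.1 := by
  unfold slice
  fun_prop

/-- Pythagoras in the splitting into slices and kernel. If the slice misses the ball, the square
root is `0` and so is the radius. -/
theorem slice_mem_ball_iff {k k₀ : K} {w a : CSpace M} {r : ℝ} (hr : 0 < r) :
    S.slice k w ∈ ball (S.slice k₀ a) r ↔ w ∈ ball a (Real.sqrt (S.lam * (r ^ 2 - ‖k - k₀‖ ^ 2))) := by
  rw [mem_ball, mem_ball, dist_eq_norm, dist_eq_norm, Real.lt_sqrt (norm_nonneg _),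
    ← sq_lt_sq₀ (norm_nonneg _) hr.le, S.slice_sub, ← div_lt_iff₀' S.lam_pos, lt_sub_iff_add_lt]

theorem slice_mem_closedBall {k k₀ : K} {w a : CSpace M} {r : ℝ} (hr : 0 < r)
    (hρ : 0 < Real.sqrt (S.lam * (r ^ 2 - ‖k - k₀‖ ^ 2)))
    (hw : w ∈ closedBall a (Real.sqrt (S.lam * (r ^ 2 - ‖k - k₀‖ ^ 2)))) :
    S.slice k w ∈ closedBall (S.slice k₀ a) r := by
  rw [mem_closedBall, dist_eq_norm] at hw ⊢
  rw [Real.le_sqrt (norm_nonneg _) (Real.sqrt_pos.1 hρ).le, ← div_le_iff₀' S.lam_pos,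
    le_sub_iff_add_le] at hw
  rwa [← sq_le_sq₀ (norm_nonneg _) hr.le, S.slice_sub]

theorem continuous_proj : Continuous S.proj := by
  unfold proj
  fun_prop

theorem C_ne_zero : S.C ≠ 0 := by
  intro h
  have h1 := S.volume_eq
  rw [h, zero_smul] at h1
  have := measure_ball_pos (volume : Measure (CSpace N)) 0 one_pos
  rw [h1] at this
  simp at this

variable [FiniteDimensional ℝ K] [BorelSpace K]

/-- Fubini along the slices. -/
theorem integrable_comp_slice {G : Type*} [NormedAddCommGroup G] {F : CSpace N → G}
    (hF : Integrable F) :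
    Integrable (fun p : CSpace M × K => F (S.slice p.2 p.1))
      ((volume : Measure (CSpace M)).prod ν) := by
  have h : Integrable F (((volume : Measure (CSpace M)).prod ν).map
      fun p => S.slice p.2 p.1) := by
    rw [S.volume_eq] at hF
    exact (integrable_smul_measure S.C_ne_zero S.C_ne_top).1 hF
  exact (integrable_map_measure h.aestronglyMeasurable
    S.continuous_slice.measurable.aemeasurable).1 h

theorem integral_eq {G : Type*} [NormedAddCommGroup G] [NormedSpace ℝ G] {F : CSpace N → G}
    (hF : Integrable F) :
    ∫ z, F z = S.C.toReal • ∫ p : CSpace M × K, F (S.slice p.2 p.1)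
      ∂((volume : Measure (CSpace M)).prod ν) := by
  have h : Integrable F (((volume : Measure (CSpace M)).prod ν).map
      fun p => S.slice p.2 p.1) := by
    rw [S.volume_eq] at hF
    exact (integrable_smul_measure S.C_ne_zero S.C_ne_top).1 hF
  conv_lhs => rw [S.volume_eq]
  rw [integral_smul_measure]
  congr 1
  exact integral_map S.continuous_slice.measurable.aemeasurable h.aestronglyMeasurable

variable [SFinite ν]

theorem lintegral_eq {F : CSpace N → ENNReal} (hF : AEMeasurable F) :
    ∫⁻ z, F z = S.C * ∫⁻ k, (∫⁻ w, F (S.slice k w)) ∂ν := by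
  have h : AEMeasurable F (((volume : Measure (CSpace M)).prod ν).map
      fun p => S.slice p.2 p.1) := by
    rw [S.volume_eq] at hF
    exact (aemeasurable_smul_measure_iff S.C_ne_zero).1 hF
  have hm := S.continuous_slice.measurable
  conv_lhs => rw [S.volume_eq]
  rw [lintegral_smul_measure, smul_eq_mul]
  congr 1
  refine (lintegral_map' h hm.aemeasurable).trans ?_
  exact lintegral_prod_symm _ (h.comp_measurable hm)

/-- A ball about `z` meets the slices in balls that all project to balls about the image `a` of `z`.
The inequality for `u` on each, in the form `∫ (c - u) ≤ vol · (c - u a)`, involves no normalisation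
and can be integrated over the slices. -/
theorem subharmonicOn_comp {u : CSpace M → EReal} {ΩN : Set (CSpace N)} {ΩM : Set (CSpace M)}
    (hΩN : IsOpen ΩN) (hΩM : IsOpen ΩM) (hmaps : Set.MapsTo S.proj ΩN ΩM)
    (hu : SubharmonicOn u ΩM) : SubharmonicOn (u ∘ S.proj) ΩN := by
  have husc : UpperSemicontinuousOn (u ∘ S.proj) ΩN :=
    hu.usc.comp S.continuous_proj.continuousOn hmaps
  refine ⟨fun z hz => hu.ne_top _ (hmaps hz), husc, fun z hz r hr hsub => ?_⟩
  obtain ⟨c, hc0, hc⟩ := hu.exists_upper_bound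
    ((isCompact_closedBall z r).image S.continuous_proj)
    (Set.image_subset_iff.2 fun x hx => hmaps (hsub hx))
  have hc' : ∀ x ∈ ball z r, u (S.proj x) ≤ c := fun x hx =>
    hc _ ⟨x, ball_subset_closedBall hx, rfl⟩
  have hmeas : AEMeasurable (u ∘ S.proj) (volume.restrict (ball z r)) :=
    (husc.aemeasurable_restrict hΩN).mono_measure
      (Measure.restrict_mono (ball_subset_closedBall.trans hsub) le_rfl)
  rcases eq_or_ne (u (S.proj z)) ⊥ with hbot | hbot
  · rw [Function.comp_apply, hbot]
    exact bot_le
  refine (le_ballMean_iff hr hc0 hc' hmeas).2 ?_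
  have hm2 : AEMeasurable (fun x => ((c : EReal) - u (S.proj x)).toENNReal)
      (volume.restrict (ball z r)) := by
    simp only [sub_eq_add_neg]
    exact (aemeasurable_const.add hmeas.neg).ereal_toENNReal
  have hvol : volume (ball z r) = ∫⁻ x, (ball z r).indicator (fun _ => 1) x := by
    rw [lintegral_indicator measurableSet_ball, setLIntegral_const, one_mul]
  obtain ⟨k₀, hk₀⟩ := S.exists_slice_eq z
  rw [← lintegral_indicator measurableSet_ball,
    S.lintegral_eq ((aemeasurable_indicator_iff measurableSet_ball).2 hm2), hvol,
    S.lintegral_eq (measurable_const.indicator measurableSet_ball).aemeasurable, mul_assoc]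
  gcongr
  set a := S.proj z with ha
  have htop : ((c : EReal) - u a).toENNReal ≠ ⊤ := by
    rw [Ne, EReal.toENNReal_eq_top_iff]
    rw [← EReal.coe_toReal (hu.ne_top a (hmaps hz)) hbot, ← EReal.coe_sub]
    exact EReal.coe_ne_top _
  rw [← lintegral_mul_const' _ _ htop]
  refine lintegral_mono fun k => ?_
  set ρ := Real.sqrt (S.lam * (r ^ 2 - ‖k - k₀‖ ^ 2)) with hρ
  have hmem : ∀ w, S.slice k w ∈ ball z r ↔ w ∈ ball a ρ := fun w => by
    conv_lhs => rw [hk₀]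
    exact S.slice_mem_ball_iff hr
  have hind : ∀ (F : CSpace N → ENNReal) (w : CSpace M), (ball z r).indicator F (S.slice k w)
      = (ball a ρ).indicator (fun w => F (S.slice k w)) w := by
    intro F w
    by_cases hw : w ∈ ball a ρ
    · rw [Set.indicator_of_mem hw, Set.indicator_of_mem ((hmem w).2 hw)]
    · rw [Set.indicator_of_notMem hw, Set.indicator_of_notMem (mt (hmem w).1 hw)]
  simp only [hind, lintegral_indicator measurableSet_ball, setLIntegral_const, one_mul,
    S.proj_slice]
  -- `ρ = 0` covers the slices that miss the ball; they contribute nothing to either side.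
  rcases (Real.sqrt_nonneg _ : 0 ≤ ρ).eq_or_lt with h0 | hpos
  · have h0' : ρ = 0 := h0.symm
    simp [h0']
  have hsubM : closedBall a ρ ⊆ ΩM := by
    intro w hw
    have h := S.slice_mem_closedBall (k₀ := k₀) hr hpos hw
    rw [← hk₀] at h
    have h2 := hmaps (hsub h)
    rwa [S.proj_slice] at h2
  refine (le_ballMean_iff hpos hc0 (fun w hw => ?_) ?_).1 (hu.sub_mean a (hmaps hz) ρ hpos hsubM)
  · have h := hc' _ ((hmem w).2 hw)
    rwa [S.proj_slice] at h
  · exact (hu.usc.aemeasurable_restrict hΩM).mono_measure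
      (Measure.restrict_mono (ball_subset_closedBall.trans hsubM) le_rfl)

end Slicing
end Slicing

/-! ### Moment matrices of a pullback under a homothetic projection -/

section SlicedMoments

open scoped ComplexConjugate

section

variable {N : ℕ} {u : CSpace N → EReal} {Ω : Set (CSpace N)} {χ : CSpace N → ℝ}

theorem integrable_mul_hess (hu : LocallyIntegrableOn (fun z => (u z).toReal) Ω)
    (hχ : IsTestFunction χ Ω) (a b : CSpace N) :
    Integrable fun z => (u z).toReal * hess χ z a b := by
  have h1 : IntegrableOn (fun z => (u z).toReal) (tsupport χ) :=
    hu.integrableOn_compact_subset hχ.subset hχ.compact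
  refine (integrableOn_iff_integrable_of_support_subset fun z hz => ?_).1
    (h1.mul_continuousOn (hχ.contDiff_two.continuous_hess a b).continuousOn hχ.compact)
  by_contra hz'
  have := image_eq_zero_of_notMem_tsupport (fun h => hz' (tsupport_hess_subset χ a b h))
  exact hz (by simp only [this, mul_zero])

theorem ofReal_mul_leviForm (t : ℝ) (z a b : CSpace N) : (t : ℂ) * leviForm χ z a b
    = (((t * hess χ z a b + t * hess χ z (Complex.I • a) (Complex.I • b) : ℝ) : ℂ)
      + Complex.I * ((t * hess χ z a (Complex.I • b) - t * hess χ z (Complex.I • a) b : ℝ) : ℂ))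
        / 4 := by
  rw [leviForm]
  push_cast
  ring

theorem integrable_mul_leviForm (hu : LocallyIntegrableOn (fun z => (u z).toReal) Ω)
    (hχ : IsTestFunction χ Ω) (a b : CSpace N) :
    Integrable fun z => ((u z).toReal : ℂ) * leviForm χ z a b := by
  have h := integrable_mul_hess hu hχ
  simp only [ofReal_mul_leviForm]
  exact (((h a b).add (h _ _)).ofReal.add (((h _ _).sub (h _ _)).ofReal.const_mul _)).div_const 4

theorem momentMatrix_apply (u : CSpace N → EReal) (hχ : IsTestFunction χ Ω) (j k : Fin N) :
    momentMatrix u Ω χ j k = ∫ z, ((u z).toReal : ℂ)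
      * leviForm χ z (EuclideanSpace.single j 1) (EuclideanSpace.single k 1) := by
  rw [momentMatrix, Matrix.of_apply, setIntegral_eq_integral_of_forall_compl_eq_zero fun z hz => by
    rw [complexHessian_eq_zero fun h => hz (hχ.subset h), Matrix.zero_apply, mul_zero]]
  simp only [fun z => complexHessian_apply (hχ.contDiff_two.contDiffAt (x := z)) j k]

theorem integral_mul_leviForm_eq_sum (hu : LocallyIntegrableOn (fun z => (u z).toReal) Ω)
    (hχ : IsTestFunction χ Ω) (a b : CSpace N) :
    ∫ z, ((u z).toReal : ℂ) * leviForm χ z a b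
      = ∑ j, ∑ k, a j * momentMatrix u Ω χ j k * conj (b k) := by
  have hi := integrable_mul_leviForm hu hχ
  have h1 : ∀ z, ((u z).toReal : ℂ) * leviForm χ z a b
      = ∑ j, ∑ k, a j * (((u z).toReal : ℂ) * leviForm χ z (EuclideanSpace.single j 1)
        (EuclideanSpace.single k 1)) * conj (b k) := by
    intro z
    rw [leviForm_eq_sum hχ.contDiff_two.contDiffAt, Finset.mul_sum]
    simp only [Finset.mul_sum, fun j k => complexHessian_apply
      (hχ.contDiff_two.contDiffAt (x := z)) j k]
    refine Finset.sum_congr rfl fun j _ => Finset.sum_congr rfl fun k _ => ?_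
    ring
  simp only [h1]
  rw [integral_finsetSum _ fun j _ => integrable_finsetSum _ fun k _ =>
    ((hi _ _).const_mul _).mul_const _]
  refine Finset.sum_congr rfl fun j _ => ?_
  rw [integral_finsetSum _ fun k _ => ((hi _ _).const_mul _).mul_const _]
  refine Finset.sum_congr rfl fun k _ => ?_
  rw [integral_mul_const, integral_const_mul, momentMatrix_apply u hχ]

end

theorem integral_linearMap {M : ℕ} {K : Type*} [MeasurableSpace K] {ν : Measure K}
    (Λ : Matrix (Fin M) (Fin M) ℂ →ₗ[ℂ] ℂ)
    {φ : K → Matrix (Fin M) (Fin M) ℂ} (hφ : ∀ a b, Integrable (fun k => φ k a b) ν) :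
    Λ (Matrix.of fun a b => ∫ k, φ k a b ∂ν) = ∫ k, Λ (φ k) ∂ν := by
  have hi : ∀ a, Integrable (fun k => ∑ b, φ k a b * Λ (Matrix.single a b 1)) ν := fun a =>
    integrable_finsetSum _ fun b _ => (hφ a b).mul_const _
  simp only [linearMap_matrix_apply Λ (Matrix.of _), fun k => linearMap_matrix_apply Λ (φ k)]
  rw [integral_finsetSum _ fun a _ => hi a]
  refine Finset.sum_congr rfl fun a _ => ?_
  rw [integral_finsetSum _ fun b _ => (hφ a b).mul_const _]
  refine Finset.sum_congr rfl fun b _ => ?_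
  rw [integral_mul_const, Matrix.of_apply]

namespace Slicing

variable {N M : ℕ} {K : Type*} [NormedAddCommGroup K] [NormedSpace ℝ K]
  [MeasurableSpace K] {ν : Measure K} (S : Slicing N M K ν)
  {u : CSpace M → EReal} {ΩN : Set (CSpace N)} {ΩM : Set (CSpace M)} {χ : CSpace N → ℝ}

theorem slice_eq (k : K) (w : CSpace M) :
    S.slice k w = S.R.restrictScalars ℝ w + (S.ι k - S.R S.w₀) := by
  rw [slice, map_sub, ContinuousLinearMap.coe_restrictScalars']
  abel

theorem leviForm_comp_slice (hχ : ContDiff ℝ 2 χ) (k : K) (w a b : CSpace M) :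
    leviForm (fun w => χ (S.slice k w)) w a b = leviForm χ (S.slice k w) (S.R a) (S.R b) := by
  have h : ∀ a b, hess (fun w => χ (S.slice k w)) w a b = hess χ (S.slice k w) (S.R a) (S.R b) :=
    fun a b => by
      simp only [slice_eq]
      exact hess_comp_affine hχ (S.R.restrictScalars ℝ) _ w a b
  simp only [leviForm, h, map_smul]

/-- Since `proj` inverts `slice`, the support on a slice lies in the projection of the support of
`χ`, which is compact and contained in `ΩM`. -/
theorem isTestFunction_comp_slice (hmaps : Set.MapsTo S.proj ΩN ΩM) (hχ : IsTestFunction χ ΩN)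
    (k : K) : IsTestFunction (fun w => χ (S.slice k w)) ΩM := by
  have hcont : Continuous (S.slice k) := by
    unfold slice
    fun_prop
  have hsm : ContDiff ℝ ∞ (S.slice k) := by
    have : S.slice k = fun w => S.R.restrictScalars ℝ w + (S.ι k - S.R S.w₀) :=
      funext (S.slice_eq k)
    rw [this]
    exact (S.R.restrictScalars ℝ).contDiff.add contDiff_const
  have hsub : tsupport (fun w => χ (S.slice k w)) ⊆ S.slice k ⁻¹' tsupport χ :=
    tsupport_comp_subset_preimage χ hcont
  have hsub2 : S.slice k ⁻¹' tsupport χ ⊆ S.proj '' tsupport χ := fun w hw =>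
    ⟨_, hw, S.proj_slice k w⟩
  refine ⟨hχ.smooth.comp hsm, ?_, ?_, fun w => hχ.nonneg _⟩
  · exact HasCompactSupport.of_support_subset_isCompact (hχ.compact.image S.continuous_proj)
      ((subset_tsupport _).trans (hsub.trans hsub2))
  · rintro w hw
    obtain ⟨x, hx, rfl⟩ := hsub2 (hsub hw)
    exact hmaps (hχ.subset hx)

/-- The matrix of the transposed projection. -/
noncomputable def projMatrix : Matrix (Fin N) (Fin M) ℂ :=
  Matrix.of fun j a => S.J (EuclideanSpace.single j 1) a

/-- The matrix of the transposed section. -/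
noncomputable def sectionMatrix : Matrix (Fin M) (Fin N) ℂ :=
  Matrix.of fun a j => S.R (EuclideanSpace.single a 1) j

theorem projMatrix_mul_sectionMatrix (l k : Fin N) :
    (S.projMatrix * S.sectionMatrix) l k = S.R (S.J (EuclideanSpace.single l 1)) k := by
  set v := S.J (EuclideanSpace.single l 1) with hv
  have h : v = ∑ a, v a • (EuclideanSpace.single a 1 : CSpace M) := by
    ext i
    simp [Pi.single_apply]
  conv_rhs => rw [h]
  rw [map_sum, Matrix.mul_apply, WithLp.ofLp_sum, Finset.sum_apply]
  refine Finset.sum_congr rfl fun a _ => ?_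
  rw [map_smul]
  rfl

theorem sectionMatrix_mul_apply
    (hloc : LocallyIntegrableOn (fun z => (u (S.proj z)).toReal) ΩN) (hχ : IsTestFunction χ ΩN)
    (a b : Fin M) :
    (S.sectionMatrix * momentMatrix (u ∘ S.proj) ΩN χ * S.sectionMatrixᴴ) a b
      = ∫ z, ((u (S.proj z)).toReal : ℂ)
        * leviForm χ z (S.R (EuclideanSpace.single a 1)) (S.R (EuclideanSpace.single b 1)) := by
  rw [show ∫ z, ((u (S.proj z)).toReal : ℂ) * leviForm χ z (S.R (EuclideanSpace.single a 1))
    (S.R (EuclideanSpace.single b 1)) = _ from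
    integral_mul_leviForm_eq_sum (u := u ∘ S.proj) hloc hχ _ _, Finset.sum_comm]
  simp only [Matrix.mul_apply, Finset.sum_mul]
  rfl

variable [FiniteDimensional ℝ K] [BorelSpace K]

theorem integrable_leviForm_slice
    (hloc : LocallyIntegrableOn (fun z => (u (S.proj z)).toReal) ΩN) (hχ : IsTestFunction χ ΩN)
    (a b : CSpace M) : Integrable (fun p : CSpace M × K => ((u p.1).toReal : ℂ)
      * leviForm (fun w => χ (S.slice p.2 w)) p.1 a b) ((volume : Measure (CSpace M)).prod ν) := by
  have h := S.integrable_comp_slice (integrable_mul_leviForm (u := u ∘ S.proj) hloc hχ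
    (S.R a) (S.R b))
  simpa only [Function.comp_apply, S.proj_slice, ← S.leviForm_comp_slice hχ.contDiff_two] using h

theorem integral_fderiv_fiber [ν.IsAddHaarMeasure] {g : CSpace N → ℝ} (hg : ContDiff ℝ 1 g)
    (hc : HasCompactSupport g) (w : CSpace M) (κ : K) :
    ∫ k, fderiv ℝ g (S.slice k w) (S.ι κ) ∂ν = 0 := by
  have hs : ∀ k, HasFDerivAt (fun k => S.slice k w) S.ι k := fun k =>
    S.ι.hasFDerivAt.const_add _
  have hd : ∀ k, fderiv ℝ (fun k => g (S.slice k w)) k κ = fderiv ℝ g (S.slice k w) (S.ι κ) :=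
    fun k => by
      have h := (hg.differentiable one_ne_zero (S.slice k w)).hasFDerivAt.comp k (hs k)
      exact congrArg (fun L => L κ) h.fderiv
  have hcont : Continuous fun k => S.slice k w := by
    unfold slice
    fun_prop
  have hemb : Topology.IsClosedEmbedding fun k => S.slice k w := by
    refine Isometry.isClosedEmbedding (Isometry.of_dist_eq fun k k' => ?_)
    have h := S.slice_sub k k' w w
    rw [sub_self, norm_zero, zero_pow two_ne_zero, zero_div, zero_add,
      sq_eq_sq₀ (norm_nonneg _) (norm_nonneg _)] at h
    rw [dist_eq_norm, dist_eq_norm, h]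
  have hC1 : ContDiff ℝ 1 fun k => g (S.slice k w) := by
    refine hg.comp ?_
    unfold slice
    exact contDiff_const.add S.ι.contDiff
  have hcs : HasCompactSupport fun k => g (S.slice k w) := hc.comp_isClosedEmbedding hemb
  simp only [← hd]
  have h := integral_mul_fderiv_eq_neg_fderiv_mul_of_integrable (μ := ν) (f := fun _ : K => (1 : ℝ))
    (g := fun k => g (S.slice k w)) (v := κ) (𝕜 := ℝ) ?_ ?_ ?_ ?_ ?_
  · simpa using h
  · simp
  · simp only [one_mul]
    exact ((hC1.continuous_fderiv one_ne_zero).clm_apply continuous_const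
      ).integrable_of_hasCompactSupport (hcs.fderiv_apply ℝ κ)
  · simp only [one_mul]
    exact hC1.continuous.integrable_of_hasCompactSupport hcs
  · simp
  · exact fun k _ => hC1.differentiable one_ne_zero k

variable [ν.IsAddHaarMeasure] [SFinite ν]

/-- The pullback is constant along fibres, so on each fibre it multiplies the integral of a
derivative of a compactly supported function, which is zero. No smoothness of `u` is used. -/
theorem integral_mul_hess_fiber
    (hloc : LocallyIntegrableOn (fun z => (u (S.proj z)).toReal) ΩN) (hχ : IsTestFunction χ ΩN)
    (a : CSpace N) (κ : K) : ∫ z, (u (S.proj z)).toReal * hess χ z a (S.ι κ) = 0 := by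
  have hint := integrable_mul_hess (u := u ∘ S.proj) hloc hχ a (S.ι κ)
  refine (S.integral_eq hint).trans ?_
  rw [integral_prod _ (S.integrable_comp_slice hint)]
  simp only [Function.comp_apply, S.proj_slice, hχ.contDiff_two.contDiffAt.hess_comm a]
  have hg : ContDiff ℝ 1 fun w => fderiv ℝ χ w a :=
    (hχ.contDiff_two.fderiv_right (m := 1) (by norm_num)).clm_apply contDiff_const
  have h0 := fun w => S.integral_fderiv_fiber hg (hχ.compact.fderiv_apply ℝ a) w κ
  simp only [integral_const_mul]
  simp only [hess, h0, mul_zero, integral_zero, smul_zero]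

theorem integral_mul_leviForm_fiber
    (hloc : LocallyIntegrableOn (fun z => (u (S.proj z)).toReal) ΩN) (hχ : IsTestFunction χ ΩN)
    (a : CSpace N) (κ : K) : ∫ z, ((u (S.proj z)).toReal : ℂ) * leviForm χ z a (S.ι κ) = 0 := by
  -- `J` is complex linear, so its kernel is stable under `i`; the real statement then covers all
  -- four terms of the Levi form.
  have hI : ∃ κ', Complex.I • S.ι κ = S.ι κ' := by
    obtain ⟨κ', h⟩ := S.exists_fiber (Complex.I • S.ι κ)
    exact ⟨κ', by rw [h, map_smul, S.J_ι, smul_zero, map_zero, zero_add]⟩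
  obtain ⟨κ', hκ'⟩ := hI
  have hi := integrable_mul_hess (u := u ∘ S.proj) hloc hχ
  have h0 := S.integral_mul_hess_fiber hloc hχ
  simp only [ofReal_mul_leviForm, hκ']
  simp only [Function.comp_apply] at hi
  rw [integral_div, integral_add ((hi _ _).add (hi _ _)).ofReal
    (((hi _ _).sub (hi _ _)).ofReal.const_mul _), integral_const_mul,
    integral_complex_ofReal, integral_complex_ofReal, integral_add (hi _ _) (hi _ _),
    integral_sub (hi _ _) (hi _ _), h0, h0, h0, h0]
  simp

/-- Each basis vector is `R (J e_l)` plus a fibre vector, and the moment matrix annihilates fibre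
vectors. So it is unchanged by the projection `R J` on either side. -/
theorem momentMatrix_eq
    (hloc : LocallyIntegrableOn (fun z => (u (S.proj z)).toReal) ΩN) (hχ : IsTestFunction χ ΩN) :
    momentMatrix (u ∘ S.proj) ΩN χ = S.projMatrix
      * (S.sectionMatrix * momentMatrix (u ∘ S.proj) ΩN χ * S.sectionMatrixᴴ) * S.projMatrixᴴ := by
  set V := momentMatrix (u ∘ S.proj) ΩN χ with hV
  have hH : Vᴴ = V := isHermitian_momentMatrix _ _ hχ.contDiff_two
  have h1 : V * (S.projMatrix * S.sectionMatrix)ᴴ = V := by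
    ext j l
    obtain ⟨κ, hκ⟩ := S.exists_fiber (EuclideanSpace.single l 1)
    have h := integral_mul_leviForm_eq_sum (u := u ∘ S.proj) hloc hχ (EuclideanSpace.single j 1)
      (S.ι κ)
    rw [show ∫ z, (((u ∘ S.proj) z).toReal : ℂ) * leviForm χ z (EuclideanSpace.single j 1) (S.ι κ)
      = 0 from S.integral_mul_leviForm_fiber hloc hχ _ κ, ← hV] at h
    have hκ' : S.ι κ = EuclideanSpace.single l 1 - S.R (S.J (EuclideanSpace.single l 1)) :=
      eq_sub_of_add_eq' hκ.symm
    rw [hκ', Finset.sum_eq_single j (fun i _ hij => by simp [hij]) (by simp)] at h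
    simp only [PiLp.sub_apply, map_sub, mul_sub, Finset.sum_sub_distrib] at h
    rw [Matrix.mul_apply]
    simp only [Matrix.conjTranspose_apply, projMatrix_mul_sectionMatrix]
    have h3 := (sub_eq_zero.1 h.symm).symm
    simpa [Pi.single_apply] using h3
  have h2 : S.projMatrix * S.sectionMatrix * V = V := by
    have h := congrArg Matrix.conjTranspose h1
    rwa [Matrix.conjTranspose_mul, Matrix.conjTranspose_conjTranspose, hH] at h
  calc V = S.projMatrix * S.sectionMatrix * (V * (S.projMatrix * S.sectionMatrix)ᴴ) := by
        rw [h1, h2]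
    _ = _ := by
        rw [Matrix.conjTranspose_mul]
        simp only [Matrix.mul_assoc]

theorem integrable_momentMatrix_slice (hmaps : Set.MapsTo S.proj ΩN ΩM)
    (hloc : LocallyIntegrableOn (fun z => (u (S.proj z)).toReal) ΩN) (hχ : IsTestFunction χ ΩN)
    (a b : Fin M) :
    Integrable (fun k => momentMatrix u ΩM (fun w => χ (S.slice k w)) a b) ν := by
  simp only [fun k => momentMatrix_apply u (S.isTestFunction_comp_slice hmaps hχ k)]
  exact (S.integrable_leviForm_slice hloc hχ _ _).integral_prod_right

theorem sectionMatrix_mul_eq (hmaps : Set.MapsTo S.proj ΩN ΩM)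
    (hloc : LocallyIntegrableOn (fun z => (u (S.proj z)).toReal) ΩN) (hχ : IsTestFunction χ ΩN)
    (a b : Fin M) :
    (S.sectionMatrix * momentMatrix (u ∘ S.proj) ΩN χ * S.sectionMatrixᴴ) a b
      = S.C.toReal * ∫ k, momentMatrix u ΩM (fun w => χ (S.slice k w)) a b ∂ν := by
  have hint := integrable_mul_leviForm (u := u ∘ S.proj) hloc hχ
    (S.R (EuclideanSpace.single a 1)) (S.R (EuclideanSpace.single b 1))
  rw [S.sectionMatrix_mul_apply hloc hχ]
  refine (S.integral_eq hint).trans ?_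
  rw [Complex.real_smul]
  congr 1
  rw [integral_prod_symm _ (S.integrable_comp_slice hint)]
  refine integral_congr_ae (Filter.Eventually.of_forall fun k => ?_)
  simp only [momentMatrix_apply u (S.isTestFunction_comp_slice hmaps hχ k), Function.comp_apply,
    S.proj_slice, ← S.leviForm_comp_slice hχ.contDiff_two]

/-- The matrix is a nonnegative multiple of an integral of slice moments lying in `Γ_m`. The cone is
cut out by linear inequalities, which survive integration. -/
theorem sectionMatrix_mul_mem {m : ℕ} (hm1 : 1 ≤ m) (hm : m ≤ M)
    (hmaps : Set.MapsTo S.proj ΩN ΩM) (hu : KSubharmonicOn m u ΩM)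
    (hlocM : LocallyIntegrableOn (fun z => (u z).toReal) ΩM)
    (hloc : LocallyIntegrableOn (fun z => (u (S.proj z)).toReal) ΩN) (hχ : IsTestFunction χ ΩN) :
    S.sectionMatrix * momentMatrix (u ∘ S.proj) ΩN χ * S.sectionMatrixᴴ ∈ gammaCone M m := by
  have hi := S.integrable_momentMatrix_slice hmaps hloc hχ
  have hmem := fun k => hu.momentMatrix_mem hm1 hm hlocM (S.isTestFunction_comp_slice hmaps hχ k)
  have heq : S.sectionMatrix * momentMatrix (u ∘ S.proj) ΩN χ * S.sectionMatrixᴴ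
      = (S.C.toReal : ℂ) • Matrix.of fun a b =>
        ∫ k, momentMatrix u ΩM (fun w => χ (S.slice k w)) a b ∂ν := by
    ext a b
    exact S.sectionMatrix_mul_eq hmaps hloc hχ a b
  obtain ⟨m, rfl⟩ : ∃ m', m = m' + 1 := ⟨m - 1, by omega⟩
  refine mem_gammaCone_of_forall hm (Matrix.isHermitian_mul_mul_conjTranspose _
    (isHermitian_momentMatrix _ _ hχ.contDiff_two)) fun a ha => ?_
  rw [← wedgeFunctional_prod, heq, map_smul, integral_linearMap _ hi, smul_eq_mul,
    Complex.re_ofReal_mul]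
  refine mul_nonneg ENNReal.toReal_nonneg ?_
  set Λ := wedgeFunctional ((List.ofFn fun _ : Fin m => form11 a).prod
    * kahlerForm M ^ (M - (m + 1))) with hΛ
  have hiΛ : Integrable (fun k => Λ (momentMatrix u ΩM fun w => χ (S.slice k w))) ν := by
    simp only [fun k => linearMap_matrix_apply Λ (momentMatrix u ΩM fun w => χ (S.slice k w))]
    exact integrable_finsetSum _ fun a _ => integrable_finsetSum _ fun b _ =>
      (hi a b).mul_const _
  have h1 := Complex.reCLM.integral_comp_comm hiΛ
  simp only [Complex.reCLM_apply] at h1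
  rw [← h1]
  refine integral_nonneg fun k => ?_
  change 0 ≤ (Λ _).re
  rw [hΛ, wedgeFunctional_prod]
  exact polarForm_nonneg hm _ fun i => Fin.cases (hmem k) (fun _ => ha) i

/-- Composition with a homothetic projection preserves `m`-subharmonicity. -/
theorem kSubharmonicOn_comp {m : ℕ} (hm1 : 1 ≤ m) (hm : m ≤ M) (hmN : m ≤ N)
    (hΩN : IsOpen ΩN) (hΩN' : IsPreconnected ΩN) (hΩM : IsOpen ΩM) (hΩM' : IsPreconnected ΩM)
    (hmaps : Set.MapsTo S.proj ΩN ΩM) (hu : KSubharmonicOn m u ΩM) :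
    KSubharmonicOn m (u ∘ S.proj) ΩN := by
  have hsub := S.subharmonicOn_comp hΩN hΩM hmaps hu.subharmonic
  -- One point of finiteness yields local integrability of both functions; otherwise the pullback is
  -- the constant `-∞`.
  by_cases h : ∃ z ∈ ΩN, u (S.proj z) ≠ ⊥
  · obtain ⟨z, hz, hzu⟩ := h
    have hloc := hsub.locallyIntegrableOn hΩN hΩN' hz hzu
    have hlocM := hu.subharmonic.locallyIntegrableOn hΩM hΩM' (hmaps hz) hzu
    refine kSubharmonicOn_of_momentMatrix_mem hm1 hmN hsub hloc fun χ hχ => ?_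
    rw [S.momentMatrix_eq hloc hχ]
    exact congr_mem_gammaCone hm hmN S.lam_pos.le S.gram
      (S.sectionMatrix_mul_mem hm1 hm hmaps hu hlocM hloc hχ)
  · push Not at h
    refine (kSubharmonicOn_const m hΩN bot_ne_top).congr hΩN fun z hz => h z hz

end Slicing

end SlicedMoments

/-! ### Homothetic projections are morphisms -/

section Homothetic

open scoped ComplexConjugate

variable {M N : ℕ}

theorem exists_slicing (A : Matrix (Fin M) (Fin N) ℂ) {lam : ℝ} (hlam : 0 < lam)
    (hA : A * Aᴴ = (lam : ℂ) • 1) (w₀ : CSpace M) :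
    ∃ S : Slicing N M (LinearMap.ker (Matrix.toEuclideanLin A))
      (Measure.addHaar : Measure (LinearMap.ker (Matrix.toEuclideanLin A))),
      S.proj = fun z => Matrix.toEuclideanLin A z + w₀ := by
  set J := Matrix.toEuclideanLin A with hJ
  set J' := Matrix.toEuclideanLin Aᴴ with hJ'
  have hadj : ∀ w z, inner ℂ (J' w) z = inner ℂ w (J z) := fun w z => by
    rw [hJ', Matrix.toEuclideanLin_conjTranspose_eq_adjoint, LinearMap.adjoint_inner_left]
  have hl : (lam : ℂ) ≠ 0 := Complex.ofReal_ne_zero.2 hlam.ne'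
  have hJJ : ∀ w, J (J' w) = (lam : ℂ) • w := by
    intro w
    rw [hJ, hJ', Matrix.toLpLin_apply, Matrix.toLpLin_apply, Matrix.mulVec_mulVec, hA,
      Matrix.smul_mulVec, Matrix.one_mulVec]
    rfl
  -- The right inverse of `J` with range orthogonal to its kernel; it scales norms by `lam^(-1/2)`.
  set R := (lam : ℂ)⁻¹ • J' with hR
  have hJR : ∀ w, J (R w) = w := by
    intro w
    rw [hR, LinearMap.smul_apply, map_smul, hJJ, inv_smul_smul₀ hl]
  have hker : ∀ z, z - R (J z) ∈ LinearMap.ker J := fun z => by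
    rw [LinearMap.mem_ker, map_sub, hJR, sub_self]
  have hnorm : ∀ w, ∀ k ∈ LinearMap.ker J, ‖R w + k‖ ^ 2 = ‖w‖ ^ 2 / lam + ‖k‖ ^ 2 := by
    intro w k hk
    have h1 : inner ℂ (R w) k = 0 := by
      rw [hR, LinearMap.smul_apply, inner_smul_left, hadj, LinearMap.mem_ker.1 hk, inner_zero_right,
        mul_zero]
    have h2 : ‖J' w‖ ^ 2 = lam * ‖w‖ ^ 2 := by
      have h3 := hadj w (J' w)
      rw [hJJ, inner_smul_right, inner_self_eq_norm_sq_to_K, inner_self_eq_norm_sq_to_K] at h3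
      rw [← Complex.ofReal_inj]
      push_cast
      exact h3
    have h3 := norm_add_sq_eq_norm_sq_add_norm_sq_of_inner_eq_zero (R w) k h1
    rw [← sq, ← sq, ← sq] at h3
    rw [h3, hR, LinearMap.smul_apply, norm_smul, mul_pow, h2, norm_inv, Complex.norm_real,
      Real.norm_of_nonneg hlam.le]
    field_simp
  let e : (CSpace M × LinearMap.ker J) ≃ₗ[ℂ] CSpace N :=
    { toFun := fun p => R p.1 + p.2
      map_add' := fun p q => by
        simp only [Prod.fst_add, Prod.snd_add, map_add, Submodule.coe_add]
        abel
      map_smul' := fun c p => by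
        simp only [Prod.smul_fst, Prod.smul_snd, map_smul, Submodule.coe_smul, smul_add,
          RingHom.id_apply]
      invFun := fun z => (J z, ⟨z - R (J z), hker z⟩)
      left_inv := fun p => by
        have h : J (R p.1 + p.2) = p.1 := by
          rw [map_add, hJR, LinearMap.mem_ker.1 p.2.2, add_zero]
        ext1
        · exact h
        · ext1
          simp only [h, add_sub_cancel_left]
      right_inv := fun z => by simp }
  obtain ⟨C, hC, hvol⟩ := exists_volume_eq_smul_map (volume : Measure (CSpace N))
    (volume : Measure (CSpace M)) (Measure.addHaar : Measure (LinearMap.ker J))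
    (e.restrictScalars ℝ).toContinuousLinearEquiv w₀
  refine ⟨{ J := J.toContinuousLinearMap, R := R.toContinuousLinearMap,
            ι := (LinearMap.ker J).subtypeL.restrictScalars ℝ, w₀ := w₀, lam := lam,
            lam_pos := hlam, J_R := hJR, J_ι := fun k => LinearMap.mem_ker.1 k.2,
            exists_fiber := fun z => ⟨⟨z - R (J z), hker z⟩, by simp⟩,
            norm_sq := fun w k => hnorm w k k.2, C := C, C_ne_top := hC, gram := ?_,
            volume_eq := hvol }, rfl⟩
  ext a b
  have h := congrFun (congrFun hA b) a
  rw [Matrix.mul_apply] at h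
  rw [Matrix.mul_apply, Matrix.smul_apply, Matrix.one_apply, if_congr eq_comm rfl rfl,
    ← Matrix.one_apply, ← Matrix.smul_apply, ← h]
  refine Finset.sum_congr rfl fun j _ => ?_
  simp only [Matrix.conjTranspose_apply, Matrix.of_apply, LinearMap.coe_toContinuousLinearMap', hJ,
    Matrix.toLpLin_apply]
  rw [mul_comm]
  simp [Matrix.mulVec_single]

/-- Homothetic projections preserve `m`-subharmonicity. -/
theorem IsHomotheticProjectionOn.isSubharmonicMorphism {m : ℕ} (hM : 0 < M) (hm1 : 1 ≤ m)
    (hm : m ≤ M) (hmN : m ≤ N) {ΩN : Set (CSpace N)} {ΩM : Set (CSpace M)} (hΩN : IsOpen ΩN)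
    (hΩN' : IsConnected ΩN) (hΩM : IsOpen ΩM) (hΩM' : IsConnected ΩM) {f : CSpace N → CSpace M}
    (hmaps : Set.MapsTo f ΩN ΩM) (h : IsHomotheticProjectionOn f ΩN) :
    IsSubharmonicMorphism m m f ΩN ΩM := by
  obtain ⟨c, X, w₀, hnorm, horth, hf⟩ := h
  set A : Matrix (Fin M) (Fin N) ℂ := (c : ℂ) • Matrix.of fun j i => X j i with hA
  have hfA : ∀ z ∈ ΩN, f z = Matrix.toEuclideanLin A z + w₀ := by
    intro z hz
    rw [hf z hz, Matrix.toLpLin_apply, hA, Matrix.smul_mulVec]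
    rfl
  set lam : ℝ := c ^ 2 * ‖X ⟨0, hM⟩‖ ^ 2 with hlam
  have hAA : A * Aᴴ = (lam : ℂ) • 1 := by
    ext a b
    have hab : (A * Aᴴ) a b = (c : ℂ) ^ 2 * inner ℂ (X b) (X a) := by
      rw [Matrix.mul_apply, PiLp.inner_apply, Finset.mul_sum]
      refine Finset.sum_congr rfl fun i _ => ?_
      simp only [hA, Matrix.conjTranspose_apply, Matrix.smul_apply, Matrix.of_apply, smul_eq_mul,
        RCLike.star_def, map_mul, Complex.conj_ofReal, RCLike.inner_apply]
      ring
    rw [hab, Matrix.smul_apply, smul_eq_mul]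
    by_cases h : a = b
    · rw [h, inner_self_eq_norm_sq_to_K, Matrix.one_apply_eq, hnorm b ⟨0, hM⟩, hlam]
      push_cast
      rw [mul_one]
      rfl
    · rw [horth b a (Ne.symm h), Matrix.one_apply_ne h, mul_zero, mul_zero]
  have hlam0 : 0 ≤ lam := by positivity
  -- The factor or the rows may vanish; then `A = 0` and the map is constant, which slicing does not
  -- cover.
  rcases hlam0.eq_or_lt with h0 | hpos
  · rw [← h0, Complex.ofReal_zero, zero_smul] at hAA
    have hA0 : A = 0 := by
      open scoped ComplexOrder in exact Matrix.self_mul_conjTranspose_eq_zero.1 hAA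
    have hconst : IsConstantOn f ΩN := ⟨w₀, fun z hz => by rw [hfA z hz, hA0]; simp⟩
    exact hconst.isSubharmonicMorphism hΩN hΩN'.nonempty hmaps
  · obtain ⟨S, hS⟩ := exists_slicing A hpos hAA w₀
    intro φ hφ
    have heq : Set.EqOn f S.proj ΩN := fun z hz => by rw [hS]; exact hfA z hz
    refine (S.kSubharmonicOn_comp hm1 hm hmN hΩN hΩN'.isPreconnected hΩM hΩM'.isPreconnected
      (hmaps.congr heq) hφ).congr hΩN fun z hz => ?_
    rw [Function.comp_apply, Function.comp_apply, heq hz]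

end Homothetic

theorem theoremC (M N m n : ℕ) (hM : 1 < M) (hN : 1 < N)
    (hm : 1 ≤ m) (hmM : m < M) (hn : 1 ≤ n) (hnN : n ≤ N) (hmn : m ≤ n)
    (ΩN : Set (CSpace N)) (ΩM : Set (CSpace M))
    (hΩN : IsOpen ΩN) (hΩN' : IsConnected ΩN) (hΩM : IsOpen ΩM) (hΩM' : IsConnected ΩM)
    (f : CSpace N → CSpace M) (hf : DifferentiableOn ℂ f ΩN) (hmaps : Set.MapsTo f ΩN ΩM) :
    IsSubharmonicMorphism m n f ΩN ΩM ↔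
      ((M ≤ N → m = n → IsConstantOn f ΩN ∨ IsHomotheticProjectionOn f ΩN) ∧
        (M ≤ N → m < n → IsConstantOn f ΩN) ∧
        (N < M → IsConstantOn f ΩN)) := by
  constructor
  · intro h
    -- The second alternative includes the constant maps, with all rows zero.
    refine ⟨fun _ _ => Or.inr ?_, fun _ hlt => ?_, fun hlt => ?_⟩
    · refine isHomotheticProjectionOn_of_jacobian hM hΩN hΩN' hf fun z hz => ?_
      obtain ⟨c, hc, -⟩ := h.exists_smul_one hm hmM hmn hnN hΩN hΩM hf hz
      exact ⟨c, hc⟩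
    · exact h.isConstantOn hm hmM hmn hnN hΩN hΩN' hΩM hf (Or.inl hlt)
    · exact h.isConstantOn hm hmM hmn hnN hΩN hΩN' hΩM hf (Or.inr hlt)
  · rintro ⟨h1, h2, h3⟩
    have hcase : IsConstantOn f ΩN ∨ (m = n ∧ IsHomotheticProjectionOn f ΩN) := by
      rcases lt_or_ge N M with h | h
      · exact Or.inl (h3 h)
      · rcases hmn.eq_or_lt with h' | h'
        · exact (h1 h h').imp id fun h4 => ⟨h', h4⟩
        · exact Or.inl (h2 h h')
    rcases hcase with hc | ⟨rfl, hc⟩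
    · exact hc.isSubharmonicMorphism hΩN hΩN'.nonempty hmaps
    · exact hc.isSubharmonicMorphism (by omega) hm hmM.le hnN hΩN hΩN' hΩM hΩM' hmaps
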